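/- **Definitions.** An $n\times n$ Wigner matrix $M_n=(\xi_{ij})$ is a random Hermitian matrix whose entries $\xi_{ij}$, $1\le i\le j\le n$, are jointly independent, where for $i<j$ the entry $\xi_{ij}$ has mean zero and variance one and independent real and imaginary parts, and where the diagonal entries $\xi_{ii}$ have mean zero and a common variance $\sigma^2>0$. It obeys the exponential decay condition with constants $C,C'>0$ if $\mathbf P(|\xi_{ij}|\ge t^C)\le e^{-t}$ for all $1\le i,j\le n$ and all $t\ge C'$. Two Wigner matrices $M_n=(\xi_{ij})$, $M_n'=(\xi_{ij}')$ on the same probability space are adjacent if $\xi_{ij}=\xi'_{ij}$ (almost surely) except for a single position $(i,j)=(a,b)$ and its transpose $(b,a)$, and $\xi_{ab},\xi_{ab}'$ have (almost surely) identical real parts or identical imaginary parts. Their moments match to order $m$ if $\mathbf E\,\mathrm{Re}(\xi_{ij})^p\,\mathrm{Im}(\xi_{ij})^q=\mathbf E\,\mathrm{Re}(\xi'_{ij})^p\,\mathrm{Im}(\xi'_{ij})^q$ for all $i,j$ and all integers $p,q\ge 0$ with $p+q\le m$. Set $\eta:=n^{-2/3}$ and, for a real number $E$ and a Hermitian $n\times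 n$ matrix $W$, $$B(W)=B(W,E):=n\eta\,\mathrm{Im}\,s_W(E+\sqrt{-1}\,\eta),\qquad s_W(z):=\tfrac1n\,\mathrm{tr}\,(W-z)^{-1}.$$ **Proposition (Stability of moments, edge version).** Let $C,C'>0$ be real and let $m\ge 0$ be an integer. There are constants $K,c>0$, depending only on $C,C',m$, such that the following holds. Let $n\ge 1$, let $M_n,M_n'$ be two adjacent Wigner matrices which both obey the exponential decay condition with constants $C,C'$ and whose moments match to order $m$, and put $W_n:=\frac1{\sqrt n}M_n$, $W_n':=\frac1{\sqrt n}M_n'$. Let $T>0$ and $E\in[2+n^{-2/3}T,\,3]$. Then for every integer $k$ with $\log n\le k\le n^{0.1}$, $$\mathbf E\,B(W_n)^k\le\Bigl(1+K\bigl(k/\sqrt n\bigr)^{m+1}\Bigr)\,\mathbf E\,B(W_n')^k+K\,100^{-k}+K\,n^{Kk}\exp(-c\,T^c).$$ -/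

import Mathlib

open MeasureTheory ProbabilityTheory

noncomputable section

namespace WignerEdge

variable {Ω : Type*} [MeasurableSpace Ω] {n : ℕ}

/-- A random `n × n` matrix `M` on the probability space `(Ω, P)` is a Wigner matrix: it is Hermitian,
its entries on and above the diagonal are jointly independent, the real and imaginary parts of each
entry above the diagonal are independent, the entries above the diagonal have mean zero and
variance one, and the diagonal entries have mean zero and a common variance `σ² > 0`.
(The second moments are required to be nonzero, so all these entries are square integrable.) -/
structure IsWigner (P : Measure Ω) (M : Ω → Matrix (Fin n) (Fin n) ℂ) : Prop where
  measurable_entry : ∀ i j, Measurable fun ω => M ω i j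
  isHermitian : ∀ ω, (M ω).IsHermitian
  indep_entries :
    iIndepFun (fun (p : {p : Fin n × Fin n // p.1 ≤ p.2}) (ω : Ω) => M ω p.1.1 p.1.2) P
  indep_re_im : ∀ i j, i < j →
    IndepFun (fun ω => (M ω i j).re) (fun ω => (M ω i j).im) P
  mean_eq_zero : ∀ i j, ∫ ω, M ω i j ∂P = 0
  variance_off_diag : ∀ i j, i < j → ∫ ω, ‖M ω i j‖ ^ 2 ∂P = 1
  variance_diag : ∃ σ : ℝ, 0 < σ ∧ ∀ i, ∫ ω, ‖M ω i i‖ ^ 2 ∂P = σ ^ 2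

/-- The exponential decay condition with constants `C`, `C'`:
`ℙ(|ξ_ij| ≥ t ^ C) ≤ exp (-t)` for all `i, j` and all `t ≥ C'`. -/
def ExpDecay (P : Measure Ω) (C C' : ℝ) (M : Ω → Matrix (Fin n) (Fin n) ℂ) : Prop :=
  ∀ i j, ∀ t : ℝ, C' ≤ t → P.real {ω | t ^ C ≤ ‖M ω i j‖} ≤ Real.exp (-t)

/-- The moments of the entries of `M` and `M'` match to order `m`. (It is only used for matrices obeying
the exponential decay condition, for which all the moments are finite.) -/
def MatchingMoments (P : Measure Ω) (m : ℕ) (M M' : Ω → Matrix (Fin n) (Fin n) ℂ) : Prop :=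
  ∀ i j, ∀ p q : ℕ, p + q ≤ m →
    ∫ ω, (M ω i j).re ^ p * (M ω i j).im ^ q ∂P =
      ∫ ω, (M' ω i j).re ^ p * (M' ω i j).im ^ q ∂P

/-- `M` and `M'` are (real-)adjacent: their entries agree except for a single position `(a, b)` and its
transpose `(b, a)`, where they have the same real part or the same imaginary part. -/
def Adjacent (P : Measure Ω) (M M' : Ω → Matrix (Fin n) (Fin n) ℂ) : Prop :=
  ∃ a b : Fin n,
    (∀ i j, (i, j) ≠ (a, b) → (i, j) ≠ (b, a) →
      (fun ω => M ω i j) =ᵐ[P] fun ω => M' ω i j) ∧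
    (((fun ω => (M ω a b).re) =ᵐ[P] fun ω => (M' ω a b).re) ∨
      ((fun ω => (M ω a b).im) =ᵐ[P] fun ω => (M' ω a b).im))

/-- The normalized matrix `W = M / √n`. -/
def normalized (M : Matrix (Fin n) (Fin n) ℂ) : Matrix (Fin n) (Fin n) ℂ :=
  (((Real.sqrt n)⁻¹ : ℝ) : ℂ) • M

/-- The Stieltjes transform `s_W(z) = (1/n) tr (W - z)⁻¹`. -/
def stieltjes (W : Matrix (Fin n) (Fin n) ℂ) (z : ℂ) : ℂ :=
  (1 / (n : ℂ)) * ((W - z • (1 : Matrix (Fin n) (Fin n) ℂ))⁻¹).trace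

/-- The scale `η = n ^ (-2/3)`. -/
def edgeScale (n : ℕ) : ℝ := (n : ℝ) ^ (-(2 / 3) : ℝ)

/-- `B(W) = n η Im s_W(E + i η)` with `η = n ^ (-2/3)`. -/
def edgeB (E : ℝ) (W : Matrix (Fin n) (Fin n) ℂ) : ℝ :=
  n * edgeScale n * (stieltjes W ((E : ℂ) + Complex.I * (edgeScale n : ℂ))).im

end WignerEdge

end

/-! Condition on everything except the single real variable `t` (the real or imaginary part of one
entry) in which the two matrices differ. The other data form a Hermitian matrix `A`, almost surely
common to both, and `B` becomes a function `β(t)` of the direction `A + t V`, with `V` supported on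
the block `{a, b} × {a, b}`.

Suppose the resolvent of `A / √n` has entries at most `L` on this block. The Born series then gives
`β(t) = ∑ c_j t^j` with `|c_j| ≤ (4L / √n)^j` for `j ≥ 1`: the prefactor `η` of `B` cancels the
`1/η` that the Ward identity yields for entries of a squared resolvent (`exists_trace_expansion`).
So for `|t| ≤ τ = √n / (3200 L k)` the function `β` moves by at most `1 / (400 k)`. Either `β(0) <
1/200`, and then `β^k ≤ 100^{-k}` on this range; or the relative variation is at most `1 / (2k)`, so
`β^k` is comparable to a constant and has a power series whose norm on the disc of radius `τ` is at
most `2 β(0)^k`. In the second case the moments up to order `m` cancel in the Taylor expansion, and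
the remainder, of size `τ^{-(m+1)}` relative to `β^k`, is the factor `(k / √n)^{m+1}`
(`integral_compare`, `integral_edgeB_compare`).

The boundedness of the resolvent is a weak local law, with failure probability `exp(-n^c)`
(`exists_local_law`). Schur's formula and concentration of quadratic forms give `1 / R_ii ≈ u` with
`u = -(z + m(z))`, hence `u + 1/u ≈ -z`. This forbids `|u|` from lying between `1/20` and `1/10`;
starting from `Im z = 1`, where `|u| ≥ 1`, a fine grid in `Im z` carries the lower bound down to `η`
(`norm_gap`, `norm_lower_of_grid`). Concentration comes from high moments built up one variable at a
time (`MomBound.add_of_orthogonal`, `momBound_quadratic`).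

On exceptional events `B ≤ n` suffices: `E ≤ 3` forces `T ≤ n`, so `n^k exp(-n^c)` is absorbed by
the last error term. -/

noncomputable section

namespace WignerEdge

/-! ### Resolvents of Hermitian matrices and the Ward identity -/

section Resolvent

open Matrix

variable {ι : Type*} [Fintype ι] [DecidableEq ι]

/-- The resolvent `(H - z)⁻¹`. -/
def green (H : Matrix ι ι ℂ) (z : ℂ) : Matrix ι ι ℂ := (H - z • (1 : Matrix ι ι ℂ))⁻¹

variable {H : Matrix ι ι ℂ} {z w : ℂ}

/-- A Hermitian quadratic form is real, so taking imaginary parts of `⟨x, H x⟩ = z ‖x‖²` forces a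
kernel vector `x` to vanish. -/
lemma isUnit_sub_smul_one (hH : H.IsHermitian) (hz : z.im ≠ 0) :
    IsUnit (H - z • (1 : Matrix ι ι ℂ)) := by
  rw [← mulVec_injective_iff_isUnit]
  rw [← Matrix.coe_mulVecLin, ← LinearMap.ker_eq_bot, LinearMap.ker_eq_bot']
  intro x hx
  have h1 : H *ᵥ x = z • x := by
    have : (H - z • (1 : Matrix ι ι ℂ)) *ᵥ x = 0 := hx
    rw [sub_mulVec, smul_mulVec, one_mulVec, sub_eq_zero] at this
    exact this
  have h2 : star x ⬝ᵥ (H *ᵥ x) = z * (star x ⬝ᵥ x) := by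
    rw [h1, dotProduct_smul, smul_eq_mul]
  have h3 : (star x ⬝ᵥ (H *ᵥ x)).im = 0 := hH.im_star_dotProduct_mulVec_self x
  have h4 : star x ⬝ᵥ x = ((∑ i, ‖x i‖ ^ 2 : ℝ) : ℂ) := by
    simp only [dotProduct, Pi.star_apply, RCLike.star_def, Complex.ofReal_sum]
    refine Finset.sum_congr rfl fun i _ => ?_
    rw [mul_comm, Complex.mul_conj, Complex.normSq_eq_norm_sq]
  rw [h2, h4, Complex.im_mul_ofReal] at h3
  have h5 : ∑ i, ‖x i‖ ^ 2 = 0 := by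
    rcases mul_eq_zero.1 h3 with h | h
    · exact absurd h hz
    · exact h
  rw [Finset.sum_eq_zero_iff_of_nonneg (fun i _ => by positivity)] at h5
  funext i
  simpa using h5 i (Finset.mem_univ i)

lemma sub_mul_green (hH : H.IsHermitian) (hz : z.im ≠ 0) :
    (H - z • (1 : Matrix ι ι ℂ)) * green H z = 1 :=
  Matrix.mul_nonsing_inv _ ((Matrix.isUnit_iff_isUnit_det _).1 (isUnit_sub_smul_one hH hz))

lemma green_mul_sub (hH : H.IsHermitian) (hz : z.im ≠ 0) :
    green H z * (H - z • (1 : Matrix ι ι ℂ)) = 1 :=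
  Matrix.nonsing_inv_mul _ ((Matrix.isUnit_iff_isUnit_det _).1 (isUnit_sub_smul_one hH hz))

lemma conjTranspose_green (hH : H.IsHermitian) : (green H z)ᴴ = green H (star z) := by
  rw [green, green, conjTranspose_nonsing_inv, conjTranspose_sub, conjTranspose_smul,
    conjTranspose_one, hH.eq]

/-- The resolvent identity for two matrices and two spectral parameters. -/
lemma green_sub_green {H' : Matrix ι ι ℂ} (hH : H.IsHermitian) (hH' : H'.IsHermitian)
    (hz : z.im ≠ 0) (hw : w.im ≠ 0) :
    green H z - green H' w = green H z * (H' - H + (z - w) • (1 : Matrix ι ι ℂ)) * green H' w := by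
  have h : H' - H + (z - w) • (1 : Matrix ι ι ℂ) =
      (H' - w • (1 : Matrix ι ι ℂ)) - (H - z • (1 : Matrix ι ι ℂ)) := by
    rw [sub_smul]; abel
  rw [h, mul_sub, sub_mul, mul_assoc, sub_mul_green hH' hw, green_mul_sub hH hz, mul_one, one_mul]

lemma green_sub_green_param (hH : H.IsHermitian) (hz : z.im ≠ 0) (hw : w.im ≠ 0) :
    green H z - green H w = (z - w) • (green H z * green H w) := by
  rw [green_sub_green hH hH hz hw]
  simp

/-- Ward identity along a row. -/
lemma im_green_eq_row (hH : H.IsHermitian) (hz : z.im ≠ 0) (k : ι) :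
    (green H z k k).im = z.im * ∑ l, ‖green H z k l‖ ^ 2 := by
  have hw : (star z).im ≠ 0 := by simpa using hz
  have h := congrFun (congrFun (green_sub_green_param hH hz hw) k) k
  rw [← conjTranspose_green hH] at h
  simp only [Matrix.sub_apply, Matrix.smul_apply, mul_apply, conjTranspose_apply, smul_eq_mul,
    RCLike.star_def, Complex.mul_conj, Complex.normSq_eq_norm_sq] at h
  have h2 := congrArg Complex.im h
  rw [← Complex.ofReal_sum, Complex.im_mul_ofReal] at h2
  simp at h2
  linarith

/-- Ward identity along a column. -/
lemma im_green_eq_col (hH : H.IsHermitian) (hz : z.im ≠ 0) (k : ι) :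
    (green H z k k).im = z.im * ∑ l, ‖green H z l k‖ ^ 2 := by
  have hw : (star z).im ≠ 0 := by simpa using hz
  have h := im_green_eq_row hH hw k
  rw [← conjTranspose_green hH] at h
  simp only [conjTranspose_apply, RCLike.star_def, Complex.conj_im, RCLike.norm_conj] at h
  linarith

lemma exists_green_row_ne_zero (hH : H.IsHermitian) (hz : z.im ≠ 0) (k : ι) :
    ∃ l, green H z k l ≠ 0 := by
  by_contra! h
  have h1 := congrFun (congrFun (green_mul_sub hH hz) k) k
  simp [mul_apply, h] at h1

lemma im_green_pos (hH : H.IsHermitian) (hz : 0 < z.im) (k : ι) : 0 < (green H z k k).im := by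
  rw [im_green_eq_row hH hz.ne' k]
  obtain ⟨l, hl⟩ := exists_green_row_ne_zero hH hz.ne' k
  exact mul_pos hz (Finset.sum_pos' (fun _ _ => by positivity) ⟨l, Finset.mem_univ l, by positivity⟩)

lemma green_diag_ne_zero (hH : H.IsHermitian) (hz : 0 < z.im) (k : ι) : green H z k k ≠ 0 := by
  intro h
  have := im_green_pos hH hz k
  simp [h] at this

lemma sum_sq_row (hH : H.IsHermitian) (hz : 0 < z.im) (k : ι) :
    ∑ l, ‖green H z k l‖ ^ 2 = (green H z k k).im / z.im := by
  rw [im_green_eq_row hH hz.ne' k]; field_simp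

lemma sum_sq_col (hH : H.IsHermitian) (hz : 0 < z.im) (k : ι) :
    ∑ l, ‖green H z l k‖ ^ 2 = (green H z k k).im / z.im := by
  rw [im_green_eq_col hH hz.ne' k]; field_simp

lemma norm_green_diag_le (hH : H.IsHermitian) (hz : 0 < z.im) (k : ι) :
    ‖green H z k k‖ ≤ 1 / z.im := by
  have h1 : ‖green H z k k‖ ^ 2 ≤ (green H z k k).im / z.im := by
    rw [← sum_sq_row hH hz k]
    exact Finset.single_le_sum (f := fun l => ‖green H z k l‖ ^ 2) (fun _ _ => by positivity)
      (Finset.mem_univ k)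
  have h2 : (green H z k k).im ≤ ‖green H z k k‖ := (le_abs_self _).trans (Complex.abs_im_le_norm _)
  have h0 : 0 < ‖green H z k k‖ := norm_pos_iff.2 (green_diag_ne_zero hH hz k)
  have h3 : ‖green H z k k‖ ^ 2 ≤ ‖green H z k k‖ / z.im := h1.trans (by gcongr)
  rw [le_div_iff₀ hz] at h3 ⊢
  nlinarith

/-- An entry of a product of two resolvents. -/
lemma sum_norm_mul_norm_le {H' : Matrix ι ι ℂ} (hH : H.IsHermitian) (hH' : H'.IsHermitian)
    (hz : 0 < z.im) (hw : 0 < w.im) (k l : ι) :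
    ∑ j, ‖green H z k j‖ * ‖green H' w j l‖ ≤
      ((green H z k k).im / z.im + (green H' w l l).im / w.im) / 2 := by
  rw [← sum_sq_row hH hz, ← sum_sq_col hH' hw, ← Finset.sum_add_distrib, Finset.sum_div]
  refine Finset.sum_le_sum fun j _ => ?_
  nlinarith [sq_nonneg (‖green H z k j‖ - ‖green H' w j l‖)]

/-- Controls one step of the descent in `Im z`: the difference is `(z - w) tr (R(z) R(w))`, and each
diagonal entry of the product is at most `1 / y²` by the Ward identities. -/
lemma norm_trace_green_sub_le (hH : H.IsHermitian) (hz : 0 < z.im) (hw : 0 < w.im) {y : ℝ}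
    (hy : 0 < y) (hyz : y ≤ z.im) (hyw : y ≤ w.im) :
    ‖(green H z).trace - (green H w).trace‖ ≤ ‖z - w‖ * (Fintype.card ι / y ^ 2) := by
  rw [← trace_sub, green_sub_green_param hH hz.ne' hw.ne', trace_smul, norm_smul]
  refine mul_le_mul_of_nonneg_left ?_ (norm_nonneg _)
  have key : ∀ {v : ℂ}, y ≤ v.im → ∀ k, (green H v k k).im / v.im ≤ 1 / y ^ 2 := by
    intro v hv k
    have hv0 : 0 < v.im := hy.trans_le hv
    have h1 : (green H v k k).im ≤ 1 / y :=
      ((le_abs_self _).trans (Complex.abs_im_le_norm _)).trans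
        ((norm_green_diag_le hH hv0 k).trans (one_div_le_one_div_of_le hy hv))
    calc (green H v k k).im / v.im ≤ (1 / y) / y := by
          gcongr
      _ = 1 / y ^ 2 := by field_simp
  have : ∀ k, ‖(green H z * green H w) k k‖ ≤ 1 / y ^ 2 := by
    intro k
    rw [mul_apply]
    refine (norm_sum_le _ _).trans ?_
    simp only [norm_mul]
    refine (sum_norm_mul_norm_le hH hH hz hw k k).trans ?_
    linarith [key hyz k, key hyw k]
  calc ‖(green H z * green H w).trace‖ ≤ ∑ k, ‖(green H z * green H w) k k‖ := norm_sum_le _ _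
    _ ≤ ∑ _k : ι, 1 / y ^ 2 := Finset.sum_le_sum fun k _ => this k
    _ = _ := by simp; ring

end Resolvent


/-! ### Minors and Schur's complement formula -/

section Minor

open Matrix

variable {ι : Type*} [Fintype ι] [DecidableEq ι]

/-- The matrix `H` with its `i`-th row and column replaced by zero. -/
def zeroed (H : Matrix ι ι ℂ) (i : ι) : Matrix ι ι ℂ :=
  fun k l => if k = i ∨ l = i then 0 else H k l

/-- The `i`-th column of `H`, with the diagonal entry replaced by zero. -/
def offCol (H : Matrix ι ι ℂ) (i : ι) : ι → ℂ := fun k => if k = i then 0 else H k i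

variable {H : Matrix ι ι ℂ} {z : ℂ}

omit [Fintype ι] in
lemma zeroed_isHermitian (hH : H.IsHermitian) (i : ι) : (zeroed H i).IsHermitian := by
  ext k l
  simp only [zeroed, conjTranspose_apply]
  by_cases h : k = i ∨ l = i
  · rw [if_pos h, if_pos h.symm, star_zero]
  · rw [if_neg h, if_neg (fun h' => h h'.symm), ← conjTranspose_apply, hH.eq]

lemma green_transpose (H : Matrix ι ι ℂ) (z : ℂ) : green Hᵀ z = (green H z)ᵀ := by
  rw [green, green, transpose_nonsing_inv, transpose_sub, transpose_smul, transpose_one]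

omit [Fintype ι] in
lemma zeroed_transpose (H : Matrix ι ι ℂ) (i : ι) : zeroed Hᵀ i = (zeroed H i)ᵀ := by
  ext k l
  simp [zeroed, or_comm]

/-- Zeroing a row and column instead of deleting them keeps the index type. The index `i` then forms
an isolated block with resolvent `-z⁻¹`, the origin of the last term; the rest is the usual rank-one
formula, checked by multiplying the candidate by `zeroed H i - z`. -/
lemma green_zeroed (hH : H.IsHermitian) (hz : 0 < z.im) (i k l : ι) :
    green (zeroed H i) z k l =
      green H z k l - green H z k i * green H z i l / green H z i i -
        if k = i ∧ l = i then z⁻¹ else 0 := by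
  have hz0 : z ≠ 0 := by rintro rfl; simp at hz
  have hR := green_diag_ne_zero hH hz i
  set R := green H z with hRdef
  let X : Matrix ι ι ℂ := fun k l => R k l - R k i * R i l / R i i -
    if k = i ∧ l = i then z⁻¹ else 0
  have hmul : (zeroed H i - z • (1 : Matrix ι ι ℂ)) * X = 1 := by
    ext k l
    rw [mul_apply]
    by_cases hk : k = i
    · subst hk
      rw [Finset.sum_eq_single k]
      · simp only [Matrix.sub_apply, zeroed, true_or, if_true, Matrix.smul_apply, one_apply_eq, X]
        by_cases hl : l = k
        · subst hl
          simp [hz0]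
        · rw [one_apply_ne (Ne.symm hl)]
          simp [hl]
          right
          field_simp
          simp
      · intro j _ hj
        simp [zeroed, one_apply_ne (Ne.symm hj)]
      · simp
    · have h1 : ∀ j, (zeroed H i - z • (1 : Matrix ι ι ℂ)) k j * X j l =
          (H - z • (1 : Matrix ι ι ℂ)) k j * R j l
            - ((H - z • (1 : Matrix ι ι ℂ)) k j * R j i) * (R i l / R i i) := by
        intro j
        by_cases hj : j = i
        · subst hj
          simp only [Matrix.sub_apply, zeroed, or_true, if_true, Matrix.smul_apply,
            one_apply_ne hk, smul_zero, sub_zero, zero_mul]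
          field_simp
          simp
        · simp only [Matrix.sub_apply, zeroed, hk, hj, or_self, if_false, false_and, X, sub_zero]
          ring
      rw [Finset.sum_congr rfl fun j _ => h1 j, Finset.sum_sub_distrib, ← Finset.sum_mul,
        ← mul_apply, ← mul_apply, hRdef, sub_mul_green hH hz.ne', one_apply_ne hk]
      simp
  have : green (zeroed H i) z = X := inv_eq_right_inv hmul
  rw [this]

/-- Away from `i`, column `i` of `(H - z) R = 1` is a linear system governed by the minor, solved
here with the minor's resolvent. For Wigner matrices the result is a linear form in variables
independent of its coefficients, up to the factor `Rᵢᵢ`. -/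
lemma green_col_eq (hH : H.IsHermitian) (hz : 0 < z.im) {i k : ι} (hk : k ≠ i) :
    green H z k i = -green H z i i * ∑ l, green (zeroed H i) z k l * offCol H i l := by
  have hz0 : z ≠ 0 := by rintro rfl; simp at hz
  have hR := green_diag_ne_zero hH hz i
  have h1 := sub_mul_green hH hz.ne'
  have h2 := green_mul_sub (zeroed_isHermitian hH i) hz.ne'
  set R := green H z
  set G := green (zeroed H i) z with hG
  have h3 : ∀ j, ∑ l, (zeroed H i - z • (1 : Matrix ι ι ℂ)) j l * R l i =
      -(R i i) * offCol H i j - (if j = i then z * R i i else 0) := by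
    intro j
    by_cases hj : j = i
    · subst hj
      rw [Finset.sum_eq_single j]
      · simp [zeroed, offCol]
      · intro l _ hl
        simp [zeroed, one_apply_ne (Ne.symm hl)]
      · simp
    · have h4 := congrFun (congrFun h1 j) i
      rw [one_apply_ne hj, mul_apply] at h4
      have h5 : ∀ l, (zeroed H i - z • (1 : Matrix ι ι ℂ)) j l * R l i =
          (H - z • (1 : Matrix ι ι ℂ)) j l * R l i - if l = i then H j i * R i i else 0 := by
        intro l
        by_cases hl : l = i
        · subst hl
          simp [zeroed, one_apply_ne hj]
        · simp [zeroed, hj, hl]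
      rw [Finset.sum_congr rfl fun l _ => h5 l, Finset.sum_sub_distrib, h4]
      simp [offCol, hj, mul_comm]
  have h6 : R k i = ∑ j, G k j * ∑ l, (zeroed H i - z • (1 : Matrix ι ι ℂ)) j l * R l i := by
    have h7 : R k i = ((G * (zeroed H i - z • (1 : Matrix ι ι ℂ))) * R) k i := by
      rw [h2, one_mul]
    rw [h7, mul_assoc, mul_apply]
    simp only [mul_apply]
  rw [h6]
  have h8 : G k i = 0 := by
    rw [hG, green_zeroed hH hz]
    simp only [hk, false_and, if_false, sub_zero]
    have : green H z i i ≠ 0 := hR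
    field_simp
    simp
  rw [Finset.mul_sum]
  refine Finset.sum_congr rfl fun j _ => ?_
  rw [h3]
  by_cases hj : j = i
  · subst hj; simp [h8]
  · simp [hj]; ring

lemma green_row_eq (hH : H.IsHermitian) (hz : 0 < z.im) {i k : ι} (hk : k ≠ i) :
    green H z i k =
      -green H z i i * ∑ l, green (zeroed H i) z l k * star (offCol H i l) := by
  have h := green_col_eq (H := Hᵀ) hH.transpose hz hk
  rw [green_transpose, zeroed_transpose, green_transpose] at h
  simp only [transpose_apply] at h
  rw [h]
  congr 2
  funext l
  simp only [offCol, transpose_apply]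
  split_ifs
  · simp
  · rw [← conjTranspose_apply, hH.eq]

/-- Schur's complement formula. -/
lemma inv_green_diag (hH : H.IsHermitian) (hz : 0 < z.im) (i : ι) :
    (green H z i i)⁻¹ = H i i - z -
      ∑ k, ∑ l, star (offCol H i k) * green (zeroed H i) z k l * offCol H i l := by
  have hR := green_diag_ne_zero hH hz i
  have h1 := congrFun (congrFun (sub_mul_green hH hz.ne') i) i
  rw [one_apply_eq, mul_apply] at h1
  refine inv_eq_of_mul_eq_one_left (Eq.trans ?_ h1)
  refine Eq.trans ?_ (Finset.add_sum_erase _ _ (Finset.mem_univ i))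
  rw [sub_mul]
  rw [sub_eq_add_neg]
  congr 1
  · simp
  · rw [Finset.sum_mul, ← Finset.add_sum_erase _ _ (Finset.mem_univ i)]
    simp only [offCol, if_true, star_zero, zero_mul, Finset.sum_const_zero, zero_add]
    rw [← Finset.sum_neg_distrib]
    refine Finset.sum_congr rfl fun k hk => ?_
    have hk' : k ≠ i := Finset.ne_of_mem_erase hk
    rw [green_col_eq hH hz hk']
    simp only [Matrix.sub_apply, Matrix.smul_apply, one_apply_ne (Ne.symm hk'), smul_zero,
      sub_zero, if_neg hk', offCol]
    rw [← conjTranspose_apply, hH.eq]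
    simp only [mul_assoc]
    rw [← Finset.mul_sum]
    ring

/-- By the minor formula the difference is `-(R²)ᵢᵢ / Rᵢᵢ`, and the Ward identities give `|(R²)ᵢᵢ| ≤
Im Rᵢᵢ / Im z`. The term `z⁻¹` compensates the isolated index. -/
lemma norm_trace_green_zeroed_sub_le (hH : H.IsHermitian) (hz : 0 < z.im) (i : ι) :
    ‖(green (zeroed H i) z).trace + z⁻¹ - (green H z).trace‖ ≤ 1 / z.im := by
  have hR := green_diag_ne_zero hH hz i
  have h1 : (green (zeroed H i) z).trace + z⁻¹ - (green H z).trace =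
      -(∑ k, green H z k i * green H z i k) / green H z i i := by
    simp only [trace, diag_apply, green_zeroed hH hz, Finset.sum_sub_distrib, and_self,
      Finset.sum_ite_eq', Finset.mem_univ, if_true, ← Finset.sum_div]
    ring
  have h2 : ‖∑ k, green H z k i * green H z i k‖ ≤ ‖green H z i i‖ / z.im := by
    refine (norm_sum_le _ _).trans ?_
    simp only [norm_mul]
    have := sum_norm_mul_norm_le hH hH hz hz i i
    simp only [mul_comm (‖green H z _ i‖)]
    refine this.trans ?_
    have h3 : (green H z i i).im ≤ ‖green H z i i‖ :=
      (le_abs_self _).trans (Complex.abs_im_le_norm _)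
    have : (green H z i i).im / z.im ≤ ‖green H z i i‖ / z.im := by gcongr
    linarith
  rw [h1, norm_div, norm_neg, div_le_iff₀ (norm_pos_iff.2 hR)]
  refine h2.trans (le_of_eq ?_)
  ring

end Minor


/-! ### The self-consistent equation and the deterministic bootstrap -/

section Bootstrap

open Matrix

variable {ι : Type*} [Fintype ι] [DecidableEq ι]

/-- The normalized trace of the resolvent. -/
def meanTrace (H : Matrix ι ι ℂ) (z : ℂ) : ℂ := (green H z).trace / (Fintype.card ι : ℂ)

/-- The deviation of the quadratic form in Schur's complement formula from its mean. -/
def schurDev (H : Matrix ι ι ℂ) (z : ℂ) (i : ι) : ℂ :=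
  ∑ k, ∑ l, star (offCol H i k) * green (zeroed H i) z k l * offCol H i l -
    ((green (zeroed H i) z).trace + z⁻¹) / (Fintype.card ι : ℂ)

/-- The squared Frobenius norm. -/
def frobSq (A : Matrix ι ι ℂ) : ℝ := ∑ k, ∑ l, ‖A k l‖ ^ 2

variable {H : Matrix ι ι ℂ} {z : ℂ}

lemma frobSq_green (hH : H.IsHermitian) (hz : 0 < z.im) :
    frobSq (green H z) = (green H z).trace.im / z.im := by
  simp only [frobSq, sum_sq_row hH hz, trace, diag_apply, Complex.im_sum, Finset.sum_div]

lemma im_meanTrace_nonneg (hH : H.IsHermitian) (hz : 0 < z.im) : 0 ≤ (meanTrace H z).im := by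
  have : meanTrace H z = (green H z).trace / ((Fintype.card ι : ℝ) : ℂ) := by
    simp [meanTrace]
  rw [this, Complex.div_ofReal_im]
  refine div_nonneg ?_ (by positivity)
  rw [trace, Complex.im_sum]
  exact Finset.sum_nonneg fun i _ => (im_green_pos hH hz i).le

lemma inv_green_diag_sub (hH : H.IsHermitian) (hz : 0 < z.im) (i : ι) :
    (green H z i i)⁻¹ - (-(z + meanTrace H z)) = H i i - schurDev H z i -
      ((green (zeroed H i) z).trace + z⁻¹ - (green H z).trace) / (Fintype.card ι : ℂ) := by
  rw [inv_green_diag hH hz, schurDev, meanTrace]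
  ring

/-- The Ward identity turns the Frobenius norm in the fluctuation bound into `Im tr G / Im z`, with
`G` the minor's resolvent. As `Im tr G / n` is at most `‖u‖ + 6`, the fluctuation is controlled by
`u` itself and no a priori bound on the resolvent is needed. -/
lemma norm_inv_green_diag_sub_le [Nonempty ι] (hH : H.IsHermitian) (hz : 0 < z.im) (hz1 : ‖z‖ ≤ 4)
    (i : ι) {θ : ℝ} (hθ : θ ≤ 1) (h1 : ‖H i i‖ ≤ θ) (h2 : 1 / (Fintype.card ι * z.im) ≤ θ)
    (h3 : ‖schurDev H z i‖ ^ 2 ≤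
      θ * z.im / Fintype.card ι * frobSq (green (zeroed H i) z)) :
    ‖(green H z i i)⁻¹ - (-(z + meanTrace H z))‖ ≤
      7 * Real.sqrt θ * (1 + ‖-(z + meanTrace H z)‖) := by
  set u := -(z + meanTrace H z) with hu
  have hn : (0 : ℝ) < Fintype.card ι := by exact_mod_cast Fintype.card_pos
  have hθ0 : 0 ≤ θ := (norm_nonneg _).trans h1
  have htr := norm_trace_green_zeroed_sub_le hH hz i
  set D := (green (zeroed H i) z).trace + z⁻¹ - (green H z).trace with hD
  have hDn : ‖D / (Fintype.card ι : ℂ)‖ ≤ θ := by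
    rw [norm_div, Complex.norm_natCast]
    refine le_trans ?_ h2
    rw [div_le_iff₀ hn]
    refine htr.trans (le_of_eq ?_)
    field_simp
  have hzinv : ‖z⁻¹ / (Fintype.card ι : ℂ)‖ ≤ θ := by
    rw [norm_div, Complex.norm_natCast, norm_inv]
    refine le_trans ?_ h2
    rw [← one_div, div_div, mul_comm]
    have : z.im ≤ ‖z‖ := (le_abs_self _).trans (Complex.abs_im_le_norm _)
    gcongr
  have hG : frobSq (green (zeroed H i) z) * z.im / Fintype.card ι ≤ ‖u‖ + 6 := by
    rw [frobSq_green (zeroed_isHermitian hH i) hz]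
    have e1 : (green (zeroed H i) z).trace.im / z.im * z.im / Fintype.card ι
        = (D / (Fintype.card ι : ℂ) - z⁻¹ / (Fintype.card ι : ℂ) - u - z).im := by
      have : D / (Fintype.card ι : ℂ) - z⁻¹ / (Fintype.card ι : ℂ) - u - z =
          (green (zeroed H i) z).trace / ((Fintype.card ι : ℝ) : ℂ) := by
        rw [hu, hD, meanTrace]; push_cast; ring
      rw [this, Complex.div_ofReal_im, div_mul_cancel₀ _ hz.ne']
    rw [e1]
    refine ((le_abs_self _).trans (Complex.abs_im_le_norm _)).trans ?_
    calc _ ≤ ‖D / (Fintype.card ι : ℂ)‖ + ‖z⁻¹ / (Fintype.card ι : ℂ)‖ + ‖u‖ + ‖z‖ := by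
          refine (norm_sub_le _ _).trans ?_
          gcongr
          refine (norm_sub_le _ _).trans ?_
          gcongr
          exact norm_sub_le _ _
      _ ≤ _ := by linarith
  have hs : ‖schurDev H z i‖ ≤ 3 * Real.sqrt θ * (1 + ‖u‖) := by
    refine abs_le_of_sq_le_sq' (a := ‖schurDev H z i‖) ?_ (by positivity) |>.2
    rw [mul_pow, mul_pow, Real.sq_sqrt hθ0]
    refine h3.trans ?_
    have : θ * z.im / Fintype.card ι * frobSq (green (zeroed H i) z) =
        θ * (frobSq (green (zeroed H i) z) * z.im / Fintype.card ι) := by ring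
    rw [this]
    have := mul_le_mul_of_nonneg_left hG hθ0
    refine this.trans ?_
    have : 0 ≤ θ * (2 * ‖u‖ + 3 + ‖u‖ ^ 2 * 9 + 15 * ‖u‖) := by positivity
    nlinarith
  have hθs : θ ≤ Real.sqrt θ := by
    have h := Real.sq_sqrt hθ0
    have h' : Real.sqrt θ ≤ 1 := Real.sqrt_le_one.2 hθ
    nlinarith [Real.sqrt_nonneg θ]
  rw [hu, inv_green_diag_sub hH hz, ← hu, ← hD]
  calc ‖H i i - schurDev H z i - D / (Fintype.card ι : ℂ)‖
      ≤ ‖H i i‖ + ‖schurDev H z i‖ + ‖D / (Fintype.card ι : ℂ)‖ := by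
        refine (norm_sub_le _ _).trans ?_
        gcongr
        exact norm_sub_le _ _
    _ ≤ Real.sqrt θ + 3 * Real.sqrt θ * (1 + ‖u‖) + Real.sqrt θ := by linarith
    _ ≤ _ := by nlinarith [Real.sqrt_nonneg θ, norm_nonneg u,
                  mul_nonneg (Real.sqrt_nonneg θ) (norm_nonneg u)]

/-- The self-consistent equation leaves a gap in the possible values of `|z + m(z)|`. -/
lemma norm_gap [Nonempty ι] (hH : H.IsHermitian) (hz : 0 < z.im) (hz1 : ‖z‖ ≤ 4)
    (h : ∀ i, ‖(green H z i i)⁻¹ - (-(z + meanTrace H z))‖ ≤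
      1 / 1000 * (1 + ‖-(z + meanTrace H z)‖)) (hu0 : 1 / 20 ≤ ‖-(z + meanTrace H z)‖) :
    1 / 10 ≤ ‖-(z + meanTrace H z)‖ ∧ (∀ i, ‖green H z i i‖ ≤ 11) ∧
      ‖-(z + meanTrace H z)‖ ≤ 16 := by
  set m := meanTrace H z with hm
  set u := -(z + m) with hu
  have hn : (0 : ℝ) < Fintype.card ι := by exact_mod_cast Fintype.card_pos
  have hupos : 0 < ‖u‖ := by linarith
  have hune : u ≠ 0 := norm_pos_iff.1 hupos
  -- Since `1 ≤ 20 ‖u‖`, the error `(1 + ‖u‖) / 1000` is a small multiple of `‖u‖`.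
  have hdev : ∀ i, ‖(green H z i i)⁻¹ - u‖ ≤ 21 / 1000 * ‖u‖ := fun i =>
    (h i).trans (by linarith)
  have hGi : ∀ i, ‖green H z i i‖ * (979 / 1000 * ‖u‖) ≤ 1 := by
    intro i
    have hR := green_diag_ne_zero hH hz i
    have h1 : 979 / 1000 * ‖u‖ ≤ ‖(green H z i i)⁻¹‖ := by
      have := norm_sub_norm_le u (green H z i i)⁻¹
      rw [norm_sub_rev] at this
      linarith [hdev i]
    calc _ ≤ ‖green H z i i‖ * ‖(green H z i i)⁻¹‖ := by gcongr
      _ = 1 := by rw [← norm_mul, mul_inv_cancel₀ hR, norm_one]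
  have hdiff : ∀ i, ‖green H z i i - u⁻¹‖ ≤ 22 / 1000 * ‖u‖⁻¹ := by
    intro i
    have hR := green_diag_ne_zero hH hz i
    have e : green H z i i - u⁻¹ = -(green H z i i * u⁻¹ * ((green H z i i)⁻¹ - u)) := by
      field_simp; ring
    rw [e, norm_neg, norm_mul, norm_mul, norm_inv]
    have h1 := hGi i
    have h2 := hdev i
    calc ‖green H z i i‖ * ‖u‖⁻¹ * ‖(green H z i i)⁻¹ - u‖
        ≤ ‖green H z i i‖ * ‖u‖⁻¹ * (21 / 1000 * ‖u‖) := by gcongr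
      _ = (‖green H z i i‖ * (979 / 1000 * ‖u‖)) * (21 / 979 * ‖u‖⁻¹) := by ring
      _ ≤ 1 * (21 / 979 * ‖u‖⁻¹) := by gcongr
      _ ≤ _ := by
        have : 0 < ‖u‖⁻¹ := inv_pos.2 hupos
        linarith
  have havg : ‖m - u⁻¹‖ ≤ 22 / 1000 * ‖u‖⁻¹ := by
    have e : m - u⁻¹ = (∑ i, (green H z i i - u⁻¹)) / (Fintype.card ι : ℂ) := by
      have hn' : (Fintype.card ι : ℂ) ≠ 0 := by exact_mod_cast hn.ne'
      rw [hm, meanTrace, Finset.sum_sub_distrib, trace]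
      simp only [diag_apply, Finset.sum_const, Finset.card_univ, nsmul_eq_mul]
      field_simp
    rw [e, norm_div, Complex.norm_natCast, div_le_iff₀ hn]
    refine (norm_sum_le _ _).trans ((Finset.sum_le_sum fun i _ => hdiff i).trans (le_of_eq ?_))
    rw [Finset.sum_const, Finset.card_univ, nsmul_eq_mul, mul_comm]
  -- `u⁻¹ ≈ m = -u - z`. If `‖u‖` were below `1/10`, the left side would exceed `9.7` and the right
  -- side would be below `4.1`.
  have hinv : 978 / 1000 * ‖u‖⁻¹ ≤ ‖u‖ + 4 := by
    have e : u⁻¹ = -u - z - (m - u⁻¹) := by rw [hu]; ring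
    have h1 : ‖u⁻¹‖ ≤ ‖u‖ + ‖z‖ + ‖m - u⁻¹‖ := by
      conv_lhs => rw [e]
      refine (norm_sub_le _ _).trans ?_
      gcongr
      refine (norm_sub_le _ _).trans ?_
      rw [norm_neg]
    rw [norm_inv] at h1
    linarith
  have hmul : ‖u‖⁻¹ * ‖u‖ = 1 := inv_mul_cancel₀ hupos.ne'
  have hip : 0 < ‖u‖⁻¹ := inv_pos.2 hupos
  have hu1 : 1 / 10 ≤ ‖u‖ := by
    by_contra! hlt
    have : 10 < ‖u‖⁻¹ := by nlinarith
    linarith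
  have hip2 : ‖u‖⁻¹ ≤ 10 := by nlinarith
  refine ⟨hu1, fun i => ?_, ?_⟩
  · have := hGi i
    nlinarith [norm_nonneg (green H z i i)]
  · have h1 : ‖m‖ ≤ ‖m - u⁻¹‖ + ‖u⁻¹‖ := by
      have := norm_add_le (m - u⁻¹) u⁻¹
      simpa using this
    rw [norm_inv] at h1
    have h2 : ‖u‖ ≤ ‖z‖ + ‖m‖ := by rw [hu, norm_neg]; exact norm_add_le _ _
    linarith

/-- Descent in the imaginary part of the spectral parameter along a fine grid. -/
lemma norm_lower_of_grid [Nonempty ι] (hH : H.IsHermitian) {E y₀ : ℝ} (hE : |E| ≤ 3) (hy₀ : 0 < y₀)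
    (hy₁ : y₀ ≤ 1) {N : ℕ} (hN : 40 / y₀ ^ 2 ≤ N)
    (h : ∀ l ≤ N, ∀ i, ‖(green H ⟨E, 1 - (1 - y₀) * (l / N)⟩ i i)⁻¹ -
        (-(⟨E, 1 - (1 - y₀) * (l / N)⟩ + meanTrace H ⟨E, 1 - (1 - y₀) * (l / N)⟩))‖ ≤
      1 / 1000 * (1 + ‖-((⟨E, 1 - (1 - y₀) * (l / N)⟩ : ℂ) +
        meanTrace H ⟨E, 1 - (1 - y₀) * (l / N)⟩)‖)) :
    (∀ i, ‖green H ⟨E, y₀⟩ i i‖ ≤ 11) ∧ ‖-((⟨E, y₀⟩ : ℂ) + meanTrace H ⟨E, y₀⟩)‖ ≤ 16 := by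
  have hn : (0 : ℝ) < Fintype.card ι := by exact_mod_cast Fintype.card_pos
  have hNpos : (0 : ℝ) < N := lt_of_lt_of_le (by positivity) hN
  set ζ : ℕ → ℂ := fun l => ⟨E, 1 - (1 - y₀) * (l / N)⟩ with hζ
  have him : ∀ l ≤ N, y₀ ≤ (ζ l).im := by
    intro l hl
    have h1 : (l : ℝ) / N ≤ 1 := by
      rw [div_le_one hNpos]; exact_mod_cast hl
    have h2 : (1 - y₀) * (l / N) ≤ (1 - y₀) * 1 := by
      apply mul_le_mul_of_nonneg_left h1; linarith
    simp only [hζ]; linarith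
  have him1 : ∀ l, (ζ l).im ≤ 1 := by
    intro l
    have : 0 ≤ (1 - y₀) * ((l : ℝ) / N) := mul_nonneg (by linarith) (by positivity)
    simp only [hζ]; linarith
  have hnorm : ∀ l ≤ N, ‖ζ l‖ ≤ 4 := by
    intro l hl
    refine (Complex.norm_le_abs_re_add_abs_im _).trans ?_
    have h1 : |(ζ l).im| ≤ 1 := abs_le.2 ⟨by linarith [him l hl], him1 l⟩
    have h2 : |(ζ l).re| ≤ 3 := hE
    linarith
  have hgap := fun l (hl : l ≤ N) => norm_gap hH (hy₀.trans_le (him l hl)) (hnorm l hl) (h l hl)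
  -- Between neighbouring grid points `z` and `m` each move by at most `1/40`, so `‖u‖` drops by at
  -- most `1/20` and cannot jump over the gap.
  have hstep : ∀ l < N, 1 / 10 ≤ ‖-(ζ l + meanTrace H (ζ l))‖ →
      1 / 20 ≤ ‖-(ζ (l + 1) + meanTrace H (ζ (l + 1)))‖ := by
    intro l hl hlow
    have hz1 := him l hl.le
    have hz2 := him (l + 1) hl
    have hd : ‖ζ l - ζ (l + 1)‖ ≤ 1 / N := by
      have : ζ l - ζ (l + 1) = (((1 - y₀) / N : ℝ) : ℂ) * Complex.I := by
        apply Complex.ext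
        · simp [hζ]
        · simp [hζ]; ring
      rw [this, norm_mul, Complex.norm_I, mul_one, Complex.norm_real, Real.norm_eq_abs,
        abs_of_nonneg (div_nonneg (by linarith) hNpos.le)]
      gcongr; linarith
    have ht := norm_trace_green_sub_le hH (hy₀.trans_le hz1) (hy₀.trans_le hz2) hy₀ hz1 hz2
    have hm : ‖meanTrace H (ζ l) - meanTrace H (ζ (l + 1))‖ ≤ 1 / N * (1 / y₀ ^ 2) := by
      rw [meanTrace, meanTrace, ← sub_div, norm_div, Complex.norm_natCast, div_le_iff₀ hn]
      refine ht.trans ?_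
      calc _ ≤ 1 / (N : ℝ) * (Fintype.card ι / y₀ ^ 2) := by gcongr
        _ = _ := by ring
    have h1 : 1 / (N : ℝ) * (1 / y₀ ^ 2) ≤ 1 / 40 := by
      rw [div_le_iff₀ (by positivity)] at hN
      rw [div_mul_div_comm, div_le_div_iff₀ (by positivity) (by norm_num)]
      linarith
    have h2 : 1 / (N : ℝ) ≤ 1 / 40 := by
      refine le_trans ?_ h1
      have : 1 ≤ 1 / y₀ ^ 2 := by
        rw [le_div_iff₀ (by positivity)]; nlinarith
      exact le_mul_of_one_le_right (by positivity) this
    have h3 := norm_sub_norm_le (-(ζ l + meanTrace H (ζ l))) (-(ζ (l + 1) + meanTrace H (ζ (l + 1))))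
    have h4 : ‖-(ζ l + meanTrace H (ζ l)) - -(ζ (l + 1) + meanTrace H (ζ (l + 1)))‖ ≤ 1 / 20 := by
      have e : -(ζ l + meanTrace H (ζ l)) - -(ζ (l + 1) + meanTrace H (ζ (l + 1))) =
          -((ζ l - ζ (l + 1)) + (meanTrace H (ζ l) - meanTrace H (ζ (l + 1)))) := by ring
      rw [e, norm_neg]
      refine (norm_add_le _ _).trans ?_
      linarith
    linarith
  have hall : ∀ l ≤ N, 1 / 10 ≤ ‖-(ζ l + meanTrace H (ζ l))‖ := by
    intro l
    induction l with
    | zero =>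
      intro _
      -- The descent starts at `Im z = 1`, where `Im (z + m) ≥ Im z` suffices.
      have h1 : 1 ≤ ‖-(ζ 0 + meanTrace H (ζ 0))‖ := by
        rw [norm_neg]
        refine le_trans ?_ ((le_abs_self _).trans (Complex.abs_im_le_norm _))
        have h2 := im_meanTrace_nonneg hH (hy₀.trans_le (him 0 (Nat.zero_le _)))
        have h3 : (ζ 0).im = 1 := by simp [hζ]
        rw [Complex.add_im]; linarith
      linarith
    | succ l ih =>
      intro hl
      exact (hgap (l + 1) hl (hstep l hl (ih (by omega)))).1
  have hζN : ζ N = ⟨E, y₀⟩ := by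
    simp only [hζ]
    rw [div_self hNpos.ne']
    congr 1; ring
  have := hgap N le_rfl (by linarith [hall N le_rfl])
  rw [hζN] at this
  exact this.2

/-- The two entries are `-Rₐₐ` times linear forms whose squares are at most `θ Im G_bb`, and the
minor formula bounds `|G_bb|` by `11 + 17 x x'` in terms of the two moduli `x`, `x'` themselves.
With `θ` small this inequality closes. -/
lemma norm_green_offDiag_le (hH : H.IsHermitian) (hz : 0 < z.im) {a b : ι} (hab : b ≠ a)
    {θ : ℝ} (hθ : θ ≤ 1 / 10000) (hθ0 : 0 ≤ θ)
    (hdiag : ∀ i, ‖green H z i i‖ ≤ 11) (hu : ‖(green H z a a)⁻¹‖ ≤ 17)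
    (h1 : ‖∑ l, green (zeroed H a) z b l * offCol H a l‖ ^ 2 ≤
      θ * z.im * ∑ l, ‖green (zeroed H a) z b l‖ ^ 2)
    (h2 : ‖∑ l, green (zeroed H a) z l b * star (offCol H a l)‖ ^ 2 ≤
      θ * z.im * ∑ l, ‖green (zeroed H a) z l b‖ ^ 2) :
    ‖green H z b a‖ ≤ 1 ∧ ‖green H z a b‖ ≤ 1 := by
  have hR := green_diag_ne_zero hH hz a
  have hHa := zeroed_isHermitian hH a
  rw [sum_sq_row hHa hz] at h1
  rw [sum_sq_col hHa hz] at h2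
  have e : θ * z.im * ((green (zeroed H a) z b b).im / z.im) =
    θ * (green (zeroed H a) z b b).im := by field_simp
  rw [e] at h1 h2
  set x := ‖green H z b a‖ with hx
  set x' := ‖green H z a b‖ with hx'
  have hbb : (green (zeroed H a) z b b).im ≤ 11 + 17 * (x * x') := by
    refine ((le_abs_self _).trans (Complex.abs_im_le_norm _)).trans ?_
    rw [green_zeroed hH hz]
    simp only [hab, false_and, if_false, sub_zero]
    refine (norm_sub_le _ _).trans ?_
    refine add_le_add (hdiag b) ?_
    rw [div_eq_mul_inv, norm_mul, norm_mul, ← hx, ← hx', mul_comm]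
    gcongr
  have hb : ∀ S : ℂ, ‖S‖ ^ 2 ≤ θ * (green (zeroed H a) z b b).im →
      (‖green H z a a‖ * ‖S‖) ^ 2 ≤ 121 / 10000 * (11 + 17 * (x * x')) := by
    intro S hS
    rw [mul_pow]
    have i1 : ‖green H z a a‖ ^ 2 ≤ 121 := by
      have := pow_le_pow_left₀ (norm_nonneg _) (hdiag a) 2
      norm_num at this ⊢; exact this
    have i2 : ‖S‖ ^ 2 ≤ 1 / 10000 * (11 + 17 * (x * x')) := by
      refine hS.trans ((mul_le_mul_of_nonneg_left hbb hθ0).trans ?_)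
      gcongr
    calc _ ≤ 121 * (1 / 10000 * (11 + 17 * (x * x'))) := by gcongr
      _ = _ := by ring
  have hxs : x ^ 2 ≤ 121 / 10000 * (11 + 17 * (x * x')) := by
    have := hb _ h1
    rwa [← norm_neg (green H z a a), ← norm_mul, ← green_col_eq hH hz hab] at this
  have hxs' : x' ^ 2 ≤ 121 / 10000 * (11 + 17 * (x * x')) := by
    have := hb _ h2
    rwa [← norm_neg (green H z a a), ← norm_mul, ← green_row_eq hH hz hab] at this
  have hx0 : 0 ≤ x := norm_nonneg _
  have hx0' : 0 ≤ x' := norm_nonneg _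
  constructor <;> nlinarith [sq_nonneg (x - x')]

end Bootstrap


/-! ### High moments under orthogonal increments -/

section Moments

variable {Ω : Type*} [MeasurableSpace Ω] {P : Measure Ω}

/-- Applied to `‖x + y‖² = A + 2r + B` with `A = ‖x‖²`, `B = ‖y‖²`. The term linear in `r` is kept
exactly, since it integrates to zero for a martingale increment; the rest costs only a factor `(q +
1)²` on `B`. -/
lemma pow_expansion_le {A B r : ℝ} (hA : 0 ≤ A) (hB : 0 ≤ B) (hr : r ^ 2 ≤ A * B) (q : ℕ) :
    (A + 2 * r + B) ^ (q + 1) ≤ A ^ (q + 1) + 2 * (q + 1) * A ^ q * r +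
      10 * (q + 1) ^ 2 * A ^ q * B + (72 * (q + 1) ^ 2 * B) ^ (q + 1) := by
  have hr2 : 2 * |r| ≤ A + B := by
    have h1 : (2 * |r|) ^ 2 ≤ (A + B) ^ 2 := by
      rw [mul_pow, sq_abs]; nlinarith [sq_nonneg (A - B)]
    exact abs_le_of_sq_le_sq' h1 (by positivity) |>.2
  have hr3 := abs_le.1 (show |2 * r| ≤ A + B by rw [abs_mul, abs_two]; exact hr2)
  have hq1 : (1 : ℝ) ≤ (q : ℝ) + 1 := by linarith [(Nat.cast_nonneg q : (0 : ℝ) ≤ q)]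
  have hQ : (1 : ℝ) ≤ ((q : ℝ) + 1) ^ 2 := by nlinarith
  have hBQ : B ≤ 9 * ((q : ℝ) + 1) ^ 2 * B := by nlinarith [mul_nonneg hB (sub_nonneg.2 hQ)]
  by_cases hcase : 9 * ((q : ℝ) + 1) ^ 2 * B ≤ A
  · rcases hA.eq_or_lt with h0 | hApos
    · have hB0 : B = 0 := by
        have : (0 : ℝ) < 9 * ((q : ℝ) + 1) ^ 2 := by positivity
        rw [← h0] at hcase
        nlinarith
      have hr0 : r = 0 := by
        rw [← h0, hB0] at hr
        exact pow_eq_zero_iff (two_ne_zero) |>.1 (le_antisymm (by linarith) (sq_nonneg r))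
      simp [← h0, hB0, hr0]
    -- When `A` dominates, `|v| ≤ 1` and `(1 + (2r + B)/A)^(q+1) ≤ exp v ≤ 1 + v + v²`.
    · set v := ((q : ℝ) + 1) * ((2 * r + B) / A) with hv
      have hBA : B ≤ A := hBQ.trans hcase
      have hw2 : (2 * r + B) ^ 2 ≤ 9 * (A * B) := by
        have h1 : (2 * r + B) ^ 2 = 4 * r ^ 2 + 4 * r * B + B ^ 2 := by ring
        have h2 : B ^ 2 ≤ A * B := by nlinarith
        have h3 : 4 * r * B ≤ 4 * (A * B) := by
          have h5 : (r * B) ^ 2 ≤ (A * B) ^ 2 := by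
            rw [mul_pow, mul_pow]
            have : r ^ 2 * B ^ 2 ≤ (A * B) * B ^ 2 := by gcongr
            have : (A * B) * B ^ 2 ≤ (A * A) * B ^ 2 := by gcongr
            nlinarith
          have := abs_le_of_sq_le_sq' h5 (by positivity) |>.2
          linarith
        linarith
      have hv2 : v ^ 2 * A ≤ 9 * ((q : ℝ) + 1) ^ 2 * B := by
        have : v ^ 2 * A = ((q : ℝ) + 1) ^ 2 * ((2 * r + B) ^ 2 / A) := by
          rw [hv]; field_simp
        rw [this]
        have h6 : (2 * r + B) ^ 2 / A ≤ 9 * B := by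
          rw [div_le_iff₀ hApos]; linarith
        nlinarith [sq_nonneg ((q : ℝ) + 1)]
      have hv1 : |v| ≤ 1 := by
        rw [← sq_le_one_iff_abs_le_one]
        nlinarith
      have hexp : Real.exp v ≤ 1 + v + v ^ 2 := by
        have := (abs_le.1 (Real.abs_exp_sub_one_sub_id_le hv1)).2
        linarith
      have e1 : A + 2 * r + B = A * (1 + (2 * r + B) / A) := by field_simp; ring
      have h1w : 0 ≤ 1 + (2 * r + B) / A := by
        have : 0 ≤ A * (1 + (2 * r + B) / A) := by rw [← e1]; linarith
        exact nonneg_of_mul_nonneg_right this hApos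
      have hpow : (1 + (2 * r + B) / A) ^ (q + 1) ≤ Real.exp v := by
        have h7 : 1 + (2 * r + B) / A ≤ Real.exp ((2 * r + B) / A) := by
          have := Real.add_one_le_exp ((2 * r + B) / A); linarith
        refine (pow_le_pow_left₀ h1w h7 (q + 1)).trans (le_of_eq ?_)
        rw [← Real.exp_nat_mul, hv]; push_cast; ring_nf
      have hpos : 0 ≤ (72 * ((q : ℝ) + 1) ^ 2 * B) ^ (q + 1) := by positivity
      rw [e1, mul_pow]
      calc A ^ (q + 1) * (1 + (2 * r + B) / A) ^ (q + 1) ≤ A ^ (q + 1) * (1 + v + v ^ 2) := by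
            gcongr; exact hpow.trans hexp
        _ = A ^ (q + 1) + ((q : ℝ) + 1) * A ^ q * (2 * r + B) + A ^ q * (v ^ 2 * A) := by
            rw [hv]; field_simp; ring
        _ ≤ A ^ (q + 1) + ((q : ℝ) + 1) * A ^ q * (2 * r + B) +
              A ^ q * (9 * ((q : ℝ) + 1) ^ 2 * B) := by gcongr
        _ ≤ _ := by
            have h8 : ((q : ℝ) + 1) * A ^ q * B ≤ ((q : ℝ) + 1) ^ 2 * A ^ q * B := by
              have : ((q : ℝ) + 1) ≤ ((q : ℝ) + 1) ^ 2 := by nlinarith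
              gcongr
            nlinarith
  -- When `A < Y = 9 (q+1)² B`, every term, including a negative linear one, is bounded by a power
  -- of `Y`; `72 = 8 · 9`.
  · push Not at hcase
    set Y := 9 * ((q : ℝ) + 1) ^ 2 * B with hY
    have hBY : B ≤ Y := hBQ
    have hY0 : 0 ≤ Y := hA.trans hcase.le
    clear_value Y
    have h1 : (A + 2 * r + B) ^ (q + 1) ≤ (4 * Y) ^ (q + 1) :=
      pow_le_pow_left₀ (by linarith) (by linarith) _
    have h2 : -(2 * ((q : ℝ) + 1) * A ^ q * r) ≤ (2 * Y) ^ (q + 1) := by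
      calc -(2 * ((q : ℝ) + 1) * A ^ q * r) = ((q : ℝ) + 1) * A ^ q * (-(2 * r)) := by ring
        _ ≤ ((q : ℝ) + 1) * A ^ q * (2 * Y) := by gcongr; linarith
        _ ≤ ((q : ℝ) + 1) * Y ^ q * (2 * Y) := by gcongr
        _ = ((q : ℝ) + 1) * 2 * Y ^ (q + 1) := by ring
        _ ≤ 2 ^ q * 2 * Y ^ (q + 1) := by
            gcongr
            exact_mod_cast Nat.lt_two_pow_self
        _ = _ := by rw [mul_pow]; ring
    have h3 : (4 * Y) ^ (q + 1) + (2 * Y) ^ (q + 1) ≤ (8 * Y) ^ (q + 1) := by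
      rw [mul_pow, mul_pow, mul_pow, ← add_mul]
      gcongr
      calc (4 : ℝ) ^ (q + 1) + 2 ^ (q + 1) ≤ (4 + 2) ^ (q + 1) :=
            pow_add_pow_le (by norm_num) (by norm_num) (by omega)
        _ ≤ 8 ^ (q + 1) := by gcongr; norm_num
    have h4 : (8 * Y) ^ (q + 1) = (72 * ((q : ℝ) + 1) ^ 2 * B) ^ (q + 1) := by
      rw [hY]; ring
    have h5 : 0 ≤ A ^ (q + 1) := by positivity
    have h6 : 0 ≤ 10 * ((q : ℝ) + 1) ^ 2 * A ^ q * B := by positivity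
    linarith

/-- `f` has a finite moment of order `2 (q + 1)`, at most `F ^ (q + 1)`. -/
structure MomBound (P : Measure Ω) (q : ℕ) (f : Ω → ℂ) (F : ℝ) : Prop where
  meas : Measurable f
  nonneg : 0 ≤ F
  integrable : Integrable (fun ω => (‖f ω‖ ^ 2) ^ (q + 1)) P
  le : ∫ ω, (‖f ω‖ ^ 2) ^ (q + 1) ∂P ≤ F ^ (q + 1)

variable {q : ℕ} {f g : Ω → ℂ} {F G : ℝ}

lemma MomBound.mono (hf : MomBound P q f F) (h : F ≤ G) : MomBound P q f G :=
  ⟨hf.meas, hf.nonneg.trans h, hf.integrable, hf.le.trans (pow_le_pow_left₀ hf.nonneg h _)⟩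

lemma pow_mul_le_add {A B : ℝ} (hA : 0 ≤ A) (hB : 0 ≤ B) (q : ℕ) :
    A ^ q * B ≤ A ^ (q + 1) + B ^ (q + 1) := by
  rcases le_total A B with h | h
  · have : A ^ q * B ≤ B ^ q * B := by gcongr
    rw [← pow_succ] at this
    have := pow_nonneg hA (q + 1)
    linarith
  · have : A ^ q * B ≤ A ^ q * A := by gcongr
    rw [← pow_succ] at this
    have := pow_nonneg hB (q + 1)
    linarith

/-- Young's inequality with exponents `(q+1)/q` and `q+1`, obtained from Bernoulli's inequality for
`v / u`. -/
lemma pow_mul_le_weighted {u v : ℝ} (hu : 0 ≤ u) (hv : 0 ≤ v) (q : ℕ) :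
    (q + 1) * (u ^ q * v) ≤ q * u ^ (q + 1) + v ^ (q + 1) := by
  rcases hu.eq_or_lt with h | h
  · rw [← h]
    rcases Nat.eq_zero_or_pos q with hq | hq
    · subst hq; simp
    · rw [zero_pow hq.ne', zero_pow (by omega)]
      have := pow_nonneg hv (q + 1)
      simpa using this
  · have hb := one_add_mul_le_pow (a := v / u - 1) (by
      have : 0 ≤ v / u := by positivity
      linarith) (q + 1)
    have e : 1 + (v / u - 1) = v / u := by ring
    rw [e, div_pow, le_div_iff₀ (by positivity)] at hb
    have e2 : (1 + ((q + 1 : ℕ) : ℝ) * (v / u - 1)) * u ^ (q + 1) =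
        (q + 1) * (u ^ q * v) - q * u ^ (q + 1) := by
      push_cast; field_simp; ring
    linarith

lemma MomBound.integrable_pow_mul (hf : MomBound P q f F) (hg : MomBound P q g G) :
    Integrable (fun ω => (‖f ω‖ ^ 2) ^ q * ‖g ω‖ ^ 2) P := by
  refine (hf.integrable.add hg.integrable).mono' ?_ (ae_of_all _ fun ω => ?_)
  · have := hf.meas; have := hg.meas
    exact (by fun_prop : Measurable _).aestronglyMeasurable
  · rw [Real.norm_of_nonneg (by positivity)]
    exact pow_mul_le_add (by positivity) (by positivity) q

/-- Hölder's inequality: integrate the pointwise Young inequality for the normalised functions.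
Normalising by `F + ε` and `G + ε`, then letting `ε → 0`, covers vanishing `F` or `G`. -/
lemma MomBound.integral_pow_mul_le (hf : MomBound P q f F) (hg : MomBound P q g G) :
    ∫ ω, (‖f ω‖ ^ 2) ^ q * ‖g ω‖ ^ 2 ∂P ≤ F ^ q * G := by
  have key : ∀ ε : ℝ, 0 < ε →
      ∫ ω, (‖f ω‖ ^ 2) ^ q * ‖g ω‖ ^ 2 ∂P ≤ (F + ε) ^ q * (G + ε) := by
    intro ε hε
    have hF : 0 < F + ε := by linarith [hf.nonneg]
    have hG : 0 < G + ε := by linarith [hg.nonneg]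
    have hle : ∀ ω, (‖f ω‖ ^ 2) ^ q * ‖g ω‖ ^ 2 ≤ (F + ε) ^ q * (G + ε) / (q + 1) *
        (q / (F + ε) ^ (q + 1) * (‖f ω‖ ^ 2) ^ (q + 1) +
          1 / (G + ε) ^ (q + 1) * (‖g ω‖ ^ 2) ^ (q + 1)) := by
      intro ω
      have := pow_mul_le_weighted (u := ‖f ω‖ ^ 2 / (F + ε)) (v := ‖g ω‖ ^ 2 / (G + ε))
        (by positivity) (by positivity) q
      rw [div_pow, div_pow, div_pow] at this
      rw [div_mul_eq_mul_div, le_div_iff₀ (by positivity)]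
      have h2 := mul_le_mul_of_nonneg_left this
        (show 0 ≤ (F + ε) ^ q * (G + ε) by positivity)
      refine le_trans (le_of_eq ?_) (h2.trans (le_of_eq ?_))
      · field_simp
      · field_simp
    have hint : Integrable (fun ω => (F + ε) ^ q * (G + ε) / (q + 1) *
        (q / (F + ε) ^ (q + 1) * (‖f ω‖ ^ 2) ^ (q + 1) +
          1 / (G + ε) ^ (q + 1) * (‖g ω‖ ^ 2) ^ (q + 1))) P :=
      ((hf.integrable.const_mul _).add (hg.integrable.const_mul _)).const_mul _
    refine (integral_mono (hf.integrable_pow_mul hg) hint hle).trans ?_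
    rw [integral_const_mul, integral_add (hf.integrable.const_mul _) (hg.integrable.const_mul _),
      integral_const_mul, integral_const_mul]
    have h1 : q / (F + ε) ^ (q + 1) * ∫ ω, (‖f ω‖ ^ 2) ^ (q + 1) ∂P ≤ q := by
      have : ∫ ω, (‖f ω‖ ^ 2) ^ (q + 1) ∂P ≤ (F + ε) ^ (q + 1) :=
        hf.le.trans (pow_le_pow_left₀ hf.nonneg (by linarith) _)
      rw [div_mul_eq_mul_div, div_le_iff₀ (by positivity)]
      gcongr
    have h2 : 1 / (G + ε) ^ (q + 1) * ∫ ω, (‖g ω‖ ^ 2) ^ (q + 1) ∂P ≤ 1 := by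
      have : ∫ ω, (‖g ω‖ ^ 2) ^ (q + 1) ∂P ≤ (G + ε) ^ (q + 1) :=
        hg.le.trans (pow_le_pow_left₀ hg.nonneg (by linarith) _)
      rw [div_mul_eq_mul_div, div_le_iff₀ (by positivity)]
      linarith
    calc _ ≤ (F + ε) ^ q * (G + ε) / (q + 1) * (q + 1) := by gcongr
      _ = _ := by field_simp
  have hlim : Filter.Tendsto (fun ε : ℝ => (F + ε) ^ q * (G + ε)) (nhdsWithin 0 (Set.Ioi 0))
      (nhds ((F + 0) ^ q * (G + 0))) :=
    tendsto_nhdsWithin_of_tendsto_nhds (Continuous.tendsto (by fun_prop) 0)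
  rw [add_zero, add_zero] at hlim
  exact ge_of_tendsto hlim (by
    filter_upwards [self_mem_nhdsWithin] with ε hε using key ε hε)

lemma normSq_add_eq (x y : ℂ) :
    ‖x + y‖ ^ 2 = ‖x‖ ^ 2 + 2 * (star x * y).re + ‖y‖ ^ 2 := by
  rw [← Complex.normSq_eq_norm_sq, ← Complex.normSq_eq_norm_sq, ← Complex.normSq_eq_norm_sq,
    Complex.normSq_add]
  have : (x * (starRingEnd ℂ) y).re = (star x * y).re := by
    simp [Complex.mul_re]
  rw [this]; ring

lemma re_star_mul_sq_le (x y : ℂ) : (star x * y).re ^ 2 ≤ ‖x‖ ^ 2 * ‖y‖ ^ 2 := by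
  rw [← sq_abs, ← mul_pow]
  refine pow_le_pow_left₀ (abs_nonneg _) ((Complex.abs_re_le_norm _).trans ?_) 2
  rw [norm_mul, norm_star]

lemma MomBound.add_crude (hf : MomBound P q f F) (hg : MomBound P q g G) :
    MomBound P q (fun ω => f ω + g ω) (4 * (F + G)) := by
  have hle : ∀ ω, (‖f ω + g ω‖ ^ 2) ^ (q + 1) ≤
      4 ^ (q + 1) * ((‖f ω‖ ^ 2) ^ (q + 1) + (‖g ω‖ ^ 2) ^ (q + 1)) := by
    intro ω
    have h1 : ‖f ω + g ω‖ ^ 2 ≤ 4 * max (‖f ω‖ ^ 2) (‖g ω‖ ^ 2) := by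
      have := pow_le_pow_left₀ (norm_nonneg _) (norm_add_le (f ω) (g ω)) 2
      nlinarith [le_max_left (‖f ω‖ ^ 2) (‖g ω‖ ^ 2), le_max_right (‖f ω‖ ^ 2) (‖g ω‖ ^ 2),
        sq_nonneg (‖f ω‖ - ‖g ω‖)]
    refine (pow_le_pow_left₀ (by positivity) h1 _).trans ?_
    rw [mul_pow]
    gcongr
    rcases max_choice (‖f ω‖ ^ 2) (‖g ω‖ ^ 2) with h | h <;> rw [h]
    · exact le_add_of_nonneg_right (by positivity)
    · exact le_add_of_nonneg_left (by positivity)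
  have hint := (hf.integrable.add hg.integrable).const_mul (4 ^ (q + 1))
  have hm : Measurable fun ω => f ω + g ω := hf.meas.add hg.meas
  have hi : Integrable (fun ω => (‖f ω + g ω‖ ^ 2) ^ (q + 1)) P := by
    refine hint.mono' ((hm.norm.pow_const 2).pow_const (q + 1)).aestronglyMeasurable (ae_of_all _ fun ω => ?_)
    rw [Real.norm_of_nonneg (by positivity)]
    exact hle ω
  refine ⟨hm, by linarith [hf.nonneg, hg.nonneg], hi, ?_⟩
  refine (integral_mono hi hint hle).trans ?_
  simp only [Pi.add_apply]
  rw [integral_const_mul, integral_add hf.integrable hg.integrable, mul_pow]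
  gcongr
  exact (add_le_add hf.le hg.le).trans (pow_add_pow_le hf.nonneg hg.nonneg (by omega))

/-- A martingale increment adds a multiple of its squared norm to the squared `L^{2(q+1)}` norm. -/
lemma MomBound.add_of_orthogonal (hf : MomBound P q f F) (hg : MomBound P q g G)
    (h0 : ∫ ω, (‖f ω‖ ^ 2) ^ q * (star (f ω) * g ω).re ∂P = 0) :
    MomBound P q (fun ω => f ω + g ω) (F + 82 * (q + 1) ^ 2 * G) := by
  have hadd := hf.add_crude hg
  have hF := hf.nonneg
  have hG := hg.nonneg
  refine ⟨hadd.meas, by positivity, hadd.integrable, ?_⟩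
  have hcross : Integrable (fun ω => (‖f ω‖ ^ 2) ^ q * (star (f ω) * g ω).re) P := by
    refine (hf.integrable.add (hf.integrable_pow_mul hg)).mono' ?_ (ae_of_all _ fun ω => ?_)
    · have := hf.meas; have := hg.meas
      refine Measurable.aestronglyMeasurable ?_
      have h3 : Measurable fun ω => star (f ω) := by fun_prop
      fun_prop
    · rw [norm_mul, Real.norm_of_nonneg (by positivity), Real.norm_eq_abs, Pi.add_apply,
        pow_succ (‖f ω‖ ^ 2) q, ← mul_add]
      gcongr
      have := re_star_mul_sq_le (f ω) (g ω)
      refine abs_le_of_sq_le_sq ?_ (by positivity)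
      nlinarith [mul_nonneg (sq_nonneg ‖f ω‖) (sq_nonneg ‖g ω‖)]
  have hle : ∀ ω, (‖f ω + g ω‖ ^ 2) ^ (q + 1) ≤
      (‖f ω‖ ^ 2) ^ (q + 1) + 2 * (q + 1) * ((‖f ω‖ ^ 2) ^ q * (star (f ω) * g ω).re) +
        10 * (q + 1) ^ 2 * ((‖f ω‖ ^ 2) ^ q * ‖g ω‖ ^ 2) +
        (72 * (q + 1) ^ 2) ^ (q + 1) * (‖g ω‖ ^ 2) ^ (q + 1) := by
    intro ω
    rw [normSq_add_eq]
    refine (pow_expansion_le (by positivity) (by positivity) (re_star_mul_sq_le (f ω) (g ω))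
      q).trans (le_of_eq ?_)
    rw [mul_pow _ (‖g ω‖ ^ 2)]
    ring
  have i1 := hf.integrable
  have i2 := hcross.const_mul (2 * ((q : ℝ) + 1))
  have i3 := (hf.integrable_pow_mul hg).const_mul (10 * ((q : ℝ) + 1) ^ 2)
  have i4 := hg.integrable.const_mul ((72 * ((q : ℝ) + 1) ^ 2) ^ (q + 1))
  have i12 : Integrable (fun ω => (‖f ω‖ ^ 2) ^ (q + 1) +
      2 * (q + 1) * ((‖f ω‖ ^ 2) ^ q * (star (f ω) * g ω).re)) P := i1.add i2
  have i123 : Integrable (fun ω => (‖f ω‖ ^ 2) ^ (q + 1) +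
      2 * (q + 1) * ((‖f ω‖ ^ 2) ^ q * (star (f ω) * g ω).re) +
        10 * (q + 1) ^ 2 * ((‖f ω‖ ^ 2) ^ q * ‖g ω‖ ^ 2)) P := i12.add i3
  have i1234 : Integrable (fun ω => (‖f ω‖ ^ 2) ^ (q + 1) +
      2 * (q + 1) * ((‖f ω‖ ^ 2) ^ q * (star (f ω) * g ω).re) +
        10 * (q + 1) ^ 2 * ((‖f ω‖ ^ 2) ^ q * ‖g ω‖ ^ 2) +
        (72 * (q + 1) ^ 2) ^ (q + 1) * (‖g ω‖ ^ 2) ^ (q + 1)) P := i123.add i4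
  refine (integral_mono hadd.integrable i1234 hle).trans ?_
  rw [integral_add i123 i4, integral_add i12 i3, integral_add i1 i2,
    integral_const_mul, integral_const_mul, integral_const_mul, h0, mul_zero, add_zero]
  -- The bounds `10 Y` and `72 Y` of the two error terms add up to `82 Y` inside the power.
  set Y := ((q : ℝ) + 1) ^ 2 * G with hY
  have hY0 : 0 ≤ Y := by positivity
  calc _ ≤ F ^ (q + 1) + 10 * ((q : ℝ) + 1) ^ 2 * (F ^ q * G) +
        (72 * ((q : ℝ) + 1) ^ 2) ^ (q + 1) * G ^ (q + 1) := by
        gcongr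
        · exact hf.le
        · exact hf.integral_pow_mul_le hg
        · exact hg.le
    _ = F ^ q * F + F ^ q * (10 * Y) + (72 * Y) ^ q * (72 * Y) := by
        rw [hY, ← mul_pow]; ring
    _ ≤ (F + 82 * Y) ^ q * F + (F + 82 * Y) ^ q * (10 * Y) + (F + 82 * Y) ^ q * (72 * Y) := by
        gcongr <;> linarith
    _ = (F + 82 * ((q : ℝ) + 1) ^ 2 * G) ^ (q + 1) := by rw [hY]; ring

end Moments


/-! ### Moments of linear and quadratic forms in independent variables -/

section Chaos

variable {Ω : Type*} [MeasurableSpace Ω] {P : Measure Ω}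
variable {q : ℕ} {f g L X : Ω → ℂ} {F G : ℝ}

lemma MomBound.zero : MomBound P q (fun _ => 0) 0 :=
  ⟨measurable_const, le_rfl, by simp, by simp⟩

lemma MomBound.const [IsProbabilityMeasure P] (c : ℂ) : MomBound P q (fun _ => c) (‖c‖ ^ 2) :=
  ⟨measurable_const, by positivity, integrable_const _, by simp⟩

lemma MomBound.star_bound (hf : MomBound P q f F) : MomBound P q (fun ω => star (f ω)) F := by
  have hm := hf.meas
  refine ⟨by fun_prop, hf.nonneg, ?_, ?_⟩
  · simpa only [norm_star] using hf.integrable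
  · simpa only [norm_star] using hf.le

lemma MomBound.const_mul (c : ℂ) (hf : MomBound P q f F) :
    MomBound P q (fun ω => c * f ω) (‖c‖ ^ 2 * F) := by
  have e : ∀ ω, (‖c * f ω‖ ^ 2) ^ (q + 1) = (‖c‖ ^ 2) ^ (q + 1) * (‖f ω‖ ^ 2) ^ (q + 1) := by
    intro ω; rw [norm_mul, mul_pow, mul_pow]
  refine ⟨hf.meas.const_mul c, mul_nonneg (by positivity) hf.nonneg, ?_, ?_⟩
  · simp only [e]; exact hf.integrable.const_mul _
  · simp only [e]
    rw [integral_const_mul, mul_pow]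
    have := hf.le
    gcongr

lemma MomBound.mul_indep (hf : MomBound P q f F) (hg : MomBound P q g G) (h : IndepFun f g P) :
    MomBound P q (fun ω => f ω * g ω) (F * G) := by
  have e : ∀ ω, (‖f ω * g ω‖ ^ 2) ^ (q + 1) = (‖f ω‖ ^ 2) ^ (q + 1) * (‖g ω‖ ^ 2) ^ (q + 1) := by
    intro ω; rw [norm_mul, mul_pow, mul_pow]
  have hφ : Measurable fun x : ℂ => (‖x‖ ^ 2) ^ (q + 1) := by fun_prop
  have hind : IndepFun (fun ω => (‖f ω‖ ^ 2) ^ (q + 1)) (fun ω => (‖g ω‖ ^ 2) ^ (q + 1)) P :=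
    h.comp hφ hφ
  refine ⟨hf.meas.mul hg.meas, mul_nonneg hf.nonneg hg.nonneg, ?_, ?_⟩
  · simp only [e]; exact hind.integrable_mul hf.integrable hg.integrable
  · simp only [e]
    rw [hind.integral_fun_mul_eq_mul_integral hf.integrable.aestronglyMeasurable
      hg.integrable.aestronglyMeasurable, mul_pow]
    exact mul_le_mul hf.le hg.le (integral_nonneg fun ω => by positivity)
      (pow_nonneg hf.nonneg _)

lemma MomBound.integrable_cross (hf : MomBound P q f F) (hg : MomBound P q g G) :
    Integrable (fun ω => (((‖f ω‖ ^ 2) ^ q : ℝ) : ℂ) * star (f ω) * g ω) P := by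
  have := hf.meas
  have := hg.meas
  have h3 : Measurable fun ω => star (f ω) := by fun_prop
  refine (hf.integrable.add (hf.integrable_pow_mul hg)).mono' ?_ (ae_of_all _ fun ω => ?_)
  · refine Measurable.aestronglyMeasurable ?_
    refine Measurable.mul (Measurable.mul ?_ h3) hg.meas
    exact Complex.measurable_ofReal.comp (by fun_prop)
  · rw [norm_mul, norm_mul, Complex.norm_real, Real.norm_of_nonneg (by positivity), norm_star,
      Pi.add_apply, pow_succ (‖f ω‖ ^ 2) q, ← mul_add, mul_assoc]
    gcongr
    nlinarith [sq_nonneg (‖f ω‖ - ‖g ω‖), sq_nonneg (‖f ω‖), sq_nonneg (‖g ω‖)]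

/-- A centred `X` independent of the pair `(f, L)` factors out of the integral. This makes `X L` an
admissible increment over `f` even though `f` and `L` are dependent. -/
lemma integral_cross_eq_zero (hf : Measurable f) (hL : Measurable L) (hX : Measurable X)
    (h0 : ∫ ω, X ω ∂P = 0) (h : IndepFun X (fun ω => (f ω, L ω)) P) :
    ∫ ω, (((‖f ω‖ ^ 2) ^ q : ℝ) : ℂ) * star (f ω) * (X ω * L ω) ∂P = 0 := by
  have hφ : Measurable fun x : ℂ × ℂ => (((‖x.1‖ ^ 2) ^ q : ℝ) : ℂ) * star x.1 * x.2 := by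
    have h3 : Measurable fun x : ℂ × ℂ => star x.1 := by fun_prop
    refine Measurable.mul (Measurable.mul ?_ h3) measurable_snd
    exact Complex.measurable_ofReal.comp (by fun_prop)
  have hind : IndepFun X (fun ω => (((‖f ω‖ ^ 2) ^ q : ℝ) : ℂ) * star (f ω) * L ω) P :=
    h.comp measurable_id hφ
  have := hind.integral_fun_mul_eq_mul_integral hX.aestronglyMeasurable
    (hφ.comp (hf.prodMk hL)).aestronglyMeasurable
  rw [h0, zero_mul] at this
  rw [← this]
  refine integral_congr_ae (ae_of_all _ fun ω => ?_)
  simp only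
  ring

lemma MomBound.add_of_cross (hf : MomBound P q f F) (hg : MomBound P q g G)
    (h0 : ∫ ω, (((‖f ω‖ ^ 2) ^ q : ℝ) : ℂ) * star (f ω) * g ω ∂P = 0) :
    MomBound P q (fun ω => f ω + g ω) (F + 82 * (q + 1) ^ 2 * G) := by
  refine hf.add_of_orthogonal hg ?_
  have h1 := congrArg Complex.re h0
  have h2 := Complex.reCLM.integral_comp_comm (hf.integrable_cross hg)
  simp only [Complex.reCLM_apply] at h2
  rw [h0] at h2
  rw [← Complex.zero_re, ← h2]
  refine integral_congr_ae (ae_of_all _ fun ω => ?_)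
  simp only
  rw [mul_assoc, Complex.re_ofReal_mul]

variable {ι : Type*} [DecidableEq ι] {Y : ι → Ω → ℂ} {β : ℝ}

omit [DecidableEq ι] in
lemma indepFun_of_notMem (hY : iIndepFun Y P) (hm : ∀ i, Measurable (Y i)) {s : Finset ι} {k : ι}
    (hk : k ∉ s) {α : Type*} [MeasurableSpace α] {Φ : (s → ℂ) → α} (hΦ : Measurable Φ) :
    IndepFun (Y k) (fun ω => Φ fun i => Y i ω) P := by
  have h := hY.indepFun_finset {k} s (by simpa using hk) hm
  exact h.comp (φ := fun v : (({k} : Finset ι) → ℂ) => v ⟨k, by simp⟩) (by fun_prop) hΦ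

/-- Moments of a linear form in independent centred variables. -/
lemma momBound_linear [IsProbabilityMeasure P] (hY : iIndepFun Y P)
    (h0 : ∀ i, ∫ ω, Y i ω ∂P = 0) (hb : ∀ i, MomBound P q (Y i) β) (a : ι → ℂ) (s : Finset ι) :
    MomBound P q (fun ω => ∑ j ∈ s, a j * Y j ω)
      (82 * (q + 1) ^ 2 * β * ∑ j ∈ s, ‖a j‖ ^ 2) := by
  induction s using Finset.induction_on with
  | empty => simpa using MomBound.zero
  | insert k s hk ih =>
    have hcross : ∫ ω, (((‖∑ j ∈ s, a j * Y j ω‖ ^ 2) ^ q : ℝ) : ℂ) *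
        star (∑ j ∈ s, a j * Y j ω) * (Y k ω * a k) ∂P = 0 := by
      refine integral_cross_eq_zero (L := fun _ => a k) ih.meas measurable_const (hb k).meas
        (h0 k) ?_
      have := indepFun_of_notMem hY (fun i => (hb i).meas) hk
        (Φ := fun v => (∑ j : s, a j * v j, a k)) (by fun_prop)
      have e : ∀ ω, ∑ j : s, a j * Y j ω = ∑ j ∈ s, a j * Y j ω := fun ω =>
        Finset.sum_coe_sort s (fun j => a j * Y j ω)
      simpa only [e] using this
    have hg := (hb k).const_mul (a k)
    simp only [mul_comm (a k)] at hg
    have := ih.add_of_cross hg hcross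
    simp only [Finset.sum_insert hk]
    convert this using 2
    · rw [add_comm, mul_comm (a k)]
    · ring

/-- Moments of an off-diagonal quadratic form in independent centred variables. -/
lemma momBound_offDiag [IsProbabilityMeasure P] (hY : iIndepFun Y P)
    (h0 : ∀ i, ∫ ω, Y i ω ∂P = 0) (hb : ∀ i, MomBound P q (Y i) β) (a : ι → ι → ℂ)
    (ha : ∀ i, a i i = 0) (s : Finset ι) :
    MomBound P q (fun ω => ∑ j ∈ s, ∑ l ∈ s, star (Y j ω) * a j l * Y l ω)
      (4 * (82 * (q + 1) ^ 2 * β) ^ 2 * ∑ j ∈ s, ∑ l ∈ s, ‖a j l‖ ^ 2) := by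
  have hstar : iIndepFun (fun i ω => star (Y i ω)) P :=
    hY.comp (fun _ => star) (fun _ => by fun_prop)
  have h0s : ∀ i, ∫ ω, star (Y i ω) ∂P = 0 := by
    intro i
    have := integral_conj (f := Y i) (μ := P)
    rw [h0 i, map_zero] at this
    exact this
  induction s using Finset.induction_on with
  | empty => simpa using MomBound.zero
  -- Adding `k` adds `Y k * L + star (Y k) * L'`, with `L` and `L'` linear forms in the earlier
  -- variables. Both summands are orthogonal to the old form, so only their norms enter.
  | insert k s hk ih =>
    set S := fun ω => ∑ j ∈ s, ∑ l ∈ s, star (Y j ω) * a j l * Y l ω with hS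
    set L := fun ω => ∑ j ∈ s, a j k * star (Y j ω) with hL
    set L' := fun ω => ∑ l ∈ s, a k l * Y l ω with hL'
    have bL : MomBound P q L (82 * (q + 1) ^ 2 * β * ∑ j ∈ s, ‖a j k‖ ^ 2) :=
      momBound_linear hstar h0s (fun i => (hb i).star_bound) (fun j => a j k) s
    have bL' : MomBound P q L' (82 * (q + 1) ^ 2 * β * ∑ l ∈ s, ‖a k l‖ ^ 2) :=
      momBound_linear hY h0 hb (fun l => a k l) s
    have hmS : Measurable fun v : s → ℂ => ∑ j : s, ∑ l : s, star (v j) * a j l * v l := by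
      refine Finset.measurable_sum _ fun j _ => Finset.measurable_sum _ fun l _ => ?_
      have : Measurable fun v : s → ℂ => star (v j) := by fun_prop
      exact (this.mul_const _).mul (by fun_prop)
    have hmL : Measurable fun v : s → ℂ => ∑ j : s, a j k * star (v j) := by
      refine Finset.measurable_sum _ fun j _ => ?_
      have : Measurable fun v : s → ℂ => star (v j) := by fun_prop
      exact this.const_mul _
    have hmL' : Measurable fun v : s → ℂ => ∑ l : s, a k l * v l := by fun_prop
    have eS : ∀ ω, ∑ j : s, ∑ l : s, star (Y j ω) * a j l * Y l ω = S ω := by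
      intro ω
      rw [hS]
      simp only
      rw [← Finset.sum_coe_sort s]
      refine Finset.sum_congr rfl fun j _ => ?_
      rw [← Finset.sum_coe_sort s]
    have eL : ∀ ω, ∑ j : s, a j k * star (Y j ω) = L ω := fun ω =>
      Finset.sum_coe_sort s (fun j => a j k * star (Y j ω))
    have eL' : ∀ ω, ∑ l : s, a k l * Y l ω = L' ω := fun ω =>
      Finset.sum_coe_sort s (fun l => a k l * Y l ω)
    have i1 : IndepFun (Y k) (fun ω => (S ω, L ω)) P := by
      have := indepFun_of_notMem hY (fun i => (hb i).meas) hk (hmS.prodMk hmL)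
      simpa only [eS, eL] using this
    have i2 : IndepFun (fun ω => star (Y k ω)) (fun ω => (S ω, L' ω)) P := by
      have := (indepFun_of_notMem hY (fun i => (hb i).meas) hk (hmS.prodMk hmL')).comp
        (φ := star) (by fun_prop) measurable_id
      simpa only [Function.comp_def, id, eS, eL'] using this
    have g1 : MomBound P q (fun ω => Y k ω * L ω) _ :=
      (hb k).mul_indep bL (i1.comp measurable_id measurable_snd)
    have g2 : MomBound P q (fun ω => star (Y k ω) * L' ω) _ :=
      (hb k).star_bound.mul_indep bL' (i2.comp measurable_id measurable_snd)
    have c1 := integral_cross_eq_zero (q := q) ih.meas bL.meas (hb k).meas (h0 k) i1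
    have c2 := integral_cross_eq_zero (q := q) ih.meas bL'.meas (hb k).star_bound.meas (h0s k) i2
    have hcross : ∫ ω, (((‖S ω‖ ^ 2) ^ q : ℝ) : ℂ) * star (S ω) *
        (Y k ω * L ω + star (Y k ω) * L' ω) ∂P = 0 := by
      simp only [mul_add]
      rw [integral_add (ih.integrable_cross g1) (ih.integrable_cross g2), c1, c2, add_zero]
    have := ih.add_of_cross (g1.add_crude g2) hcross
    have hsum : ∀ ω, ∑ j ∈ insert k s, ∑ l ∈ insert k s, star (Y j ω) * a j l * Y l ω =
        S ω + (Y k ω * L ω + star (Y k ω) * L' ω) := by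
      intro ω
      simp only [Finset.sum_insert hk, ha, mul_zero, zero_mul, zero_add, Finset.sum_add_distrib,
        hS, hL, hL', Finset.mul_sum]
      have e1 : ∀ x, star (Y x ω) * a x k * Y k ω = Y k ω * (a x k * star (Y x ω)) := fun x => by
        ring
      have e2 : ∀ x, star (Y k ω) * a k x * Y x ω = star (Y k ω) * (a k x * Y x ω) := fun x => by
        ring
      simp only [e1, e2]
      ring
    simp only [hsum]
    refine this.mono (le_of_eq ?_)
    simp only [Finset.sum_insert hk, ha, norm_zero, Finset.sum_add_distrib]
    ring

/-- Moments of a centred quadratic form in independent centred variables. -/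
lemma momBound_quadratic [IsProbabilityMeasure P] [Fintype ι] (hY : iIndepFun Y P)
    (h0 : ∀ i, ∫ ω, Y i ω ∂P = 0) (hb : ∀ i, MomBound P q (Y i) β)
    (hb' : ∀ i, MomBound P (2 * q + 1) (Y i) β) (v : ι → ℝ) (hv : ∀ i, |v i| ≤ 1)
    (hvar : ∀ i, ∫ ω, ‖Y i ω‖ ^ 2 ∂P = v i) (a : ι → ι → ℂ) :
    MomBound P q (fun ω => ∑ j, ∑ l, star (Y j ω) * a j l * Y l ω - ∑ j, a j j * v j)
      (200000 * (q + 1) ^ 4 * (β + 1) ^ 2 * ∑ j, ∑ l, ‖a j l‖ ^ 2) := by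
  have hβ : ∀ _ : ι, 0 ≤ β := fun i => (hb i).nonneg
  set a' : ι → ι → ℂ := fun j l => if j = l then 0 else a j l with ha'
  have off := momBound_offDiag hY h0 hb a' (fun i => by simp [ha']) Finset.univ
  -- After removing the off-diagonal part, what remains is a linear form in the independent centred
  -- variables `‖Y i‖² - v i`.
  have hZind : iIndepFun (fun i ω => ((‖Y i ω‖ ^ 2 - v i : ℝ) : ℂ)) P :=
    hY.comp (fun i x => ((‖x‖ ^ 2 - v i : ℝ) : ℂ))
      (fun i => Complex.measurable_ofReal.comp (by fun_prop))
  -- Index `2q + 1` stands for moment order `4 (q + 1)`, twice the order of index `q`, as needed for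
  -- squares.
  have hsq : ∀ i, MomBound P q (fun ω => ((‖Y i ω‖ ^ 2 : ℝ) : ℂ)) (β ^ 2) := by
    intro i
    have e : ∀ ω, (‖((‖Y i ω‖ ^ 2 : ℝ) : ℂ)‖ ^ 2) ^ (q + 1) =
        (‖Y i ω‖ ^ 2) ^ (2 * q + 1 + 1) := by
      intro ω
      rw [Complex.norm_real, Real.norm_of_nonneg (by positivity), ← pow_mul]
      congr 1
    refine ⟨Complex.measurable_ofReal.comp ((hb i).meas.norm.pow_const 2), by positivity, ?_, ?_⟩
    · simp only [e]; exact (hb' i).integrable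
    · simp only [e]
      refine (hb' i).le.trans (le_of_eq ?_)
      rw [← pow_mul]; congr 1
  have hZb : ∀ i, MomBound P q (fun ω => ((‖Y i ω‖ ^ 2 - v i : ℝ) : ℂ)) (4 * (β ^ 2 + 1)) := by
    intro i
    have h1 : MomBound P q (fun _ : Ω => ((-(v i) : ℝ) : ℂ)) 1 := by
      refine (MomBound.const _).mono ?_
      rw [Complex.norm_real, Real.norm_eq_abs, abs_neg]
      exact pow_le_one₀ (abs_nonneg _) (hv i)
    have := (hsq i).add_crude h1
    refine ⟨?_, this.nonneg, ?_, ?_⟩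
    · exact Complex.measurable_ofReal.comp (((hb i).meas.norm.pow_const 2).sub_const _)
    · simpa only [sub_eq_add_neg, Complex.ofReal_add] using this.integrable
    · simpa only [sub_eq_add_neg, Complex.ofReal_add] using this.le
  have hY2 : ∀ i, Integrable (fun ω => ‖Y i ω‖ ^ 2) P := by
    intro i
    refine ((hb i).integrable.add (integrable_const (1 : ℝ))).mono'
      ((hb i).meas.norm.pow_const 2).aestronglyMeasurable (ae_of_all _ fun ω => ?_)
    rw [Real.norm_of_nonneg (by positivity), Pi.add_apply]
    have h1 : 0 ≤ ‖Y i ω‖ ^ 2 := by positivity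
    rcases le_total (‖Y i ω‖ ^ 2) 1 with h | h
    · have : 0 ≤ (‖Y i ω‖ ^ 2) ^ (q + 1) := by positivity
      linarith
    · have := le_self_pow₀ h (n := q + 1) (by omega)
      linarith
  have hZ0 : ∀ i, ∫ ω, ((‖Y i ω‖ ^ 2 - v i : ℝ) : ℂ) ∂P = 0 := by
    intro i
    rw [integral_complex_ofReal, integral_sub (hY2 i) (integrable_const _), hvar i]
    simp
  have diag := momBound_linear hZind hZ0 hZb (fun j => a j j) Finset.univ
  have := off.add_crude diag
  have hsum : ∀ ω, ∑ j, ∑ l, star (Y j ω) * a j l * Y l ω - ∑ j, a j j * v j =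
      ∑ j, ∑ l, star (Y j ω) * a' j l * Y l ω +
        ∑ j, a j j * ((‖Y j ω‖ ^ 2 - v j : ℝ) : ℂ) := by
    intro ω
    rw [← Finset.sum_sub_distrib, ← Finset.sum_add_distrib]
    refine Finset.sum_congr rfl fun j _ => ?_
    rw [← Finset.add_sum_erase _ _ (Finset.mem_univ j),
      ← Finset.add_sum_erase _ (fun l => star (Y j ω) * a' j l * Y l ω) (Finset.mem_univ j)]
    have e1 : star (Y j ω) * a j j * Y j ω = a j j * ((‖Y j ω‖ ^ 2 : ℝ) : ℂ) := by
      rw [← Complex.normSq_eq_norm_sq, ← Complex.mul_conj]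
      simp only [RCLike.star_def]
      ring
    have e2 : ∑ l ∈ Finset.univ.erase j, star (Y j ω) * a' j l * Y l ω =
        ∑ l ∈ Finset.univ.erase j, star (Y j ω) * a j l * Y l ω := by
      refine Finset.sum_congr rfl fun l hl => ?_
      simp only [ha', if_neg (Finset.ne_of_mem_erase hl).symm]
    rw [e1, e2]
    simp only [ha', if_true]
    push_cast
    ring
  simp only [hsum]
  refine this.mono ?_
  set Φ := ∑ j, ∑ l, ‖a j l‖ ^ 2 with hΦ
  rcases isEmpty_or_nonempty ι with he | ⟨⟨i₀⟩⟩
  · simp [hΦ]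
  have hβ0 := hβ i₀
  have hΦ0 : 0 ≤ Φ := by positivity
  have o1 : ∑ j, ∑ l, ‖a' j l‖ ^ 2 ≤ Φ := by
    refine Finset.sum_le_sum fun j _ => Finset.sum_le_sum fun l _ => ?_
    simp only [ha']
    split_ifs
    · simp
    · exact le_rfl
  have o2 : ∑ j, ‖a j j‖ ^ 2 ≤ Φ :=
    Finset.sum_le_sum fun j _ => Finset.single_le_sum (f := fun l => ‖a j l‖ ^ 2)
      (fun l _ => by positivity) (Finset.mem_univ j)
  set w := ((q : ℝ) + 1) ^ 2 with hw
  have hw1 : 1 ≤ w := by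
    have : (0 : ℝ) ≤ q := Nat.cast_nonneg q
    rw [hw]; nlinarith
  have hw4 : ((q : ℝ) + 1) ^ 4 = w ^ 2 := by rw [hw]; ring
  calc 4 * (4 * (82 * w * β) ^ 2 * ∑ j, ∑ l, ‖a' j l‖ ^ 2 +
        82 * w * (4 * (β ^ 2 + 1)) * ∑ j, ‖a j j‖ ^ 2)
      ≤ 4 * (4 * (82 * w * β) ^ 2 * Φ + 82 * w * (4 * (β ^ 2 + 1)) * Φ) := by gcongr
    _ = (16 * 82 ^ 2 * w ^ 2 * β ^ 2 + 16 * 82 * w * (β ^ 2 + 1)) * Φ := by ring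
    _ ≤ (200000 * w ^ 2 * (β + 1) ^ 2) * Φ := by
        gcongr
        have h1 : w * (β ^ 2 + 1) ≤ w ^ 2 * (β + 1) ^ 2 := by
          have : w ≤ w ^ 2 := by nlinarith
          have : β ^ 2 + 1 ≤ (β + 1) ^ 2 := by nlinarith
          gcongr
        have h2 : w ^ 2 * β ^ 2 ≤ w ^ 2 * (β + 1) ^ 2 := by gcongr; linarith
        nlinarith
    _ = _ := by rw [hw4]

end Chaos


/-! ### From tails to moments and back to concentration -/

section Tails

variable {Ω : Type*} [MeasurableSpace Ω] {P : Measure Ω}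

/-- Half of the exponential pays for the power through `x^k / k! ≤ exp x` at `x = (j+1)/2`; the
other half remains as a summable geometric factor. -/
lemma pow_mul_exp_neg_le (k j : ℕ) :
    ((j : ℝ) + 1) ^ k * Real.exp (-j) ≤
      2 * (2 * k) ^ k * (Real.exp (-(1 / 2))) ^ j := by
  have h1 := Real.pow_div_factorial_le_exp (((j : ℝ) + 1) / 2) (by positivity) k
  rw [div_le_iff₀ (by positivity), div_pow, div_le_iff₀ (by positivity)] at h1
  have h2 : (k.factorial : ℝ) ≤ (k : ℝ) ^ k := by exact_mod_cast Nat.factorial_le_pow k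
  have h3 : Real.exp (1 / 2) ≤ 2 := by
    have h4 : Real.exp (1 / 2) ^ 2 ≤ 2 ^ 2 := by
      rw [← Real.exp_nat_mul]
      have := Real.exp_one_lt_d9
      norm_num at this ⊢
      linarith
    nlinarith [Real.exp_pos (1 / 2 : ℝ)]
  calc ((j : ℝ) + 1) ^ k * Real.exp (-j)
      ≤ (Real.exp (((j : ℝ) + 1) / 2) * k ^ k * 2 ^ k) * Real.exp (-j) := by
        gcongr; exact h1.trans (by gcongr)
    _ = Real.exp (1 / 2) * (2 * k) ^ k * (Real.exp (-(1 / 2))) ^ j := by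
        have e : Real.exp (((j : ℝ) + 1) / 2) * Real.exp (-j) =
            Real.exp (1 / 2) * (Real.exp (-(1 / 2))) ^ j := by
          rw [← Real.exp_add, ← Real.exp_nat_mul, ← Real.exp_add]; congr 1; ring
        rw [mul_pow]; linear_combination ((k : ℝ) ^ k * 2 ^ k) * e
    _ ≤ _ := by gcongr

lemma tsum_geom_bound : ∑' j : ℕ, (Real.exp (-(1 / 2))) ^ j ≤ 3 := by
  have h1 : Real.exp (-(1 / 2)) ≤ 2 / 3 := by
    rw [Real.exp_neg, inv_le_comm₀ (Real.exp_pos _) (by norm_num)]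
    have := Real.add_one_le_exp (1 / 2 : ℝ)
    norm_num at this ⊢; linarith
  rw [tsum_geometric_of_lt_one (Real.exp_pos _).le (by linarith)]
  rw [inv_le_comm₀ (by linarith) (by norm_num)]
  norm_num at h1 ⊢; linarith

/-- Moments of a variable with stretched exponential tails. -/
lemma moment_of_tail [IsProbabilityMeasure P] {X : Ω → ℂ} (hX : Measurable X) {D t₀ : ℕ}
    (hD : 1 ≤ D) (ht : ∀ j : ℕ, t₀ ≤ j → P.real {ω | (j : ℝ) ^ D ≤ ‖X ω‖} ≤ Real.exp (-j))
    {N : ℕ} (hN : 1 ≤ N) :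
    Integrable (fun ω => ‖X ω‖ ^ N) P ∧
      ∫ ω, ‖X ω‖ ^ N ∂P ≤ (((t₀ : ℝ) + 12 * D) * N) ^ (D * N) := by
  set k := D * N with hk
  have hk1 : 1 ≤ k := Nat.mul_pos hD hN
  -- If `j₀ > t₀` is the least integer with `‖X‖ < j₀^D`, then `‖X‖^N ≤ j₀^(D N)` is charged to the
  -- layer `j = j₀ - 1`, on which `j^D ≤ ‖X‖`.
  have hpt : ∀ ω, ENNReal.ofReal (‖X ω‖ ^ N) ≤ ENNReal.ofReal ((t₀ : ℝ) ^ k) +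
      ∑' j : ℕ, Set.indicator {ω | t₀ ≤ j ∧ (j : ℝ) ^ D ≤ ‖X ω‖}
        (fun _ => ENNReal.ofReal (((j : ℝ) + 1) ^ k)) ω := by
    intro ω
    by_cases h : ‖X ω‖ < (t₀ : ℝ) ^ D
    · refine le_add_of_le_left (ENNReal.ofReal_le_ofReal ?_)
      rw [hk, pow_mul]
      gcongr
    · push Not at h
      have hex : ∃ j : ℕ, ‖X ω‖ < (j : ℝ) ^ D := by
        obtain ⟨j, hj⟩ := exists_nat_gt (max ‖X ω‖ 1)
        refine ⟨j, (le_max_left _ _).trans_lt (hj.trans_le ?_)⟩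
        exact le_self_pow₀ ((le_max_right _ _).trans hj.le) (by omega)
      classical
      set j₀ := Nat.find hex with hj₀
      have h1 := Nat.find_spec hex
      have hpos : t₀ < j₀ := by
        by_contra! hle
        have : ((j₀ : ℕ) : ℝ) ^ D ≤ (t₀ : ℝ) ^ D := by gcongr
        linarith
      have h2 : ((j₀ - 1 : ℕ) : ℝ) ^ D ≤ ‖X ω‖ := by
        have := Nat.find_min hex (m := j₀ - 1) (by omega)
        push Not at this; exact this
      refine le_add_of_le_right (le_trans ?_ (ENNReal.le_tsum (j₀ - 1)))
      rw [Set.indicator_of_mem (show ω ∈ {ω | t₀ ≤ j₀ - 1 ∧ ((j₀ - 1 : ℕ) : ℝ) ^ D ≤ ‖X ω‖} from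
        ⟨by omega, h2⟩)]
      refine ENNReal.ofReal_le_ofReal ?_
      have e : ((j₀ - 1 : ℕ) : ℝ) + 1 = j₀ := by
        exact_mod_cast Nat.sub_add_cancel (show 1 ≤ j₀ by omega)
      rw [e, hk, pow_mul]
      gcongr
  have hmeas : ∀ j : ℕ, MeasurableSet {ω | t₀ ≤ j ∧ (j : ℝ) ^ D ≤ ‖X ω‖} := by
    intro j
    exact (MeasurableSet.const _).inter (measurableSet_le measurable_const hX.norm)
  have hterm : ∀ j : ℕ, ∫⁻ ω, Set.indicator {ω | t₀ ≤ j ∧ (j : ℝ) ^ D ≤ ‖X ω‖}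
        (fun _ => ENNReal.ofReal (((j : ℝ) + 1) ^ k)) ω ∂P ≤
      ENNReal.ofReal (2 * (2 * k) ^ k * (Real.exp (-(1 / 2))) ^ j) := by
    intro j
    rw [lintegral_indicator_const (hmeas j)]
    by_cases hj : t₀ ≤ j
    · have e : {ω | t₀ ≤ j ∧ (j : ℝ) ^ D ≤ ‖X ω‖} = {ω | (j : ℝ) ^ D ≤ ‖X ω‖} := by
        ext ω; simp [hj]
      rw [e, ← ofReal_measureReal, ← ENNReal.ofReal_mul (by positivity)]
      refine ENNReal.ofReal_le_ofReal ((mul_le_mul_of_nonneg_left (ht j hj)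
        (by positivity)).trans (pow_mul_exp_neg_le k j))
    · have e : {ω | t₀ ≤ j ∧ (j : ℝ) ^ D ≤ ‖X ω‖} = ∅ := by
        ext ω; simp [hj]
      rw [e]; simp
  have hsummable : Summable fun j : ℕ => 2 * (2 * (k : ℝ)) ^ k * (Real.exp (-(1 / 2))) ^ j :=
    (summable_geometric_of_lt_one (Real.exp_pos _).le (by
      rw [Real.exp_lt_one_iff]; norm_num)).mul_left _
  have hbound : ∫⁻ ω, ENNReal.ofReal (‖X ω‖ ^ N) ∂P ≤
      ENNReal.ofReal ((((t₀ : ℝ) + 12 * D) * N) ^ k) := by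
    calc ∫⁻ ω, ENNReal.ofReal (‖X ω‖ ^ N) ∂P
        ≤ ∫⁻ ω, (ENNReal.ofReal ((t₀ : ℝ) ^ k) +
            ∑' j : ℕ, Set.indicator {ω | t₀ ≤ j ∧ (j : ℝ) ^ D ≤ ‖X ω‖}
              (fun _ => ENNReal.ofReal (((j : ℝ) + 1) ^ k)) ω) ∂P := lintegral_mono hpt
      _ ≤ ENNReal.ofReal ((t₀ : ℝ) ^ k) +
            ∑' j : ℕ, ENNReal.ofReal (2 * (2 * k) ^ k * (Real.exp (-(1 / 2))) ^ j) := by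
          rw [lintegral_add_left measurable_const, lintegral_const, measure_univ, mul_one,
            lintegral_tsum fun j => (measurable_const.indicator (hmeas j)).aemeasurable]
          gcongr with j
          exact hterm j
      _ = ENNReal.ofReal ((t₀ : ℝ) ^ k + 2 * (2 * k) ^ k * ∑' j : ℕ, (Real.exp (-(1 / 2))) ^ j) := by
          rw [← ENNReal.ofReal_tsum_of_nonneg (fun j => by positivity) hsummable,
            ← ENNReal.ofReal_add (by positivity) (tsum_nonneg fun j => by positivity),
            tsum_mul_left]
      _ ≤ _ := by
          refine ENNReal.ofReal_le_ofReal ?_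
          calc (t₀ : ℝ) ^ k + 2 * (2 * k) ^ k * ∑' j : ℕ, (Real.exp (-(1 / 2))) ^ j
              ≤ (t₀ : ℝ) ^ k + 2 * (2 * k) ^ k * 3 := by gcongr; exact tsum_geom_bound
            _ = (t₀ : ℝ) ^ k + 6 * (2 * k) ^ k := by ring
            _ ≤ ((t₀ : ℝ) * N) ^ k + 6 ^ k * (2 * k) ^ k := by
                gcongr
                · exact le_mul_of_one_le_right (by positivity) (by exact_mod_cast hN)
                · exact le_self_pow₀ (by norm_num) (by omega)
            _ = ((t₀ : ℝ) * N) ^ k + (12 * D * N) ^ k := by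
                rw [← mul_pow, hk]; push_cast; ring
            _ ≤ ((t₀ : ℝ) * N + 12 * D * N) ^ k :=
                pow_add_pow_le (by positivity) (by positivity) (by omega)
            _ = _ := by ring
  have hint : Integrable (fun ω => ‖X ω‖ ^ N) P := by
    refine ⟨(hX.norm.pow_const N).aestronglyMeasurable, ?_⟩
    rw [hasFiniteIntegral_iff_ofReal (ae_of_all _ fun ω => by positivity)]
    exact hbound.trans_lt ENNReal.ofReal_lt_top
  refine ⟨hint, ?_⟩
  rw [integral_eq_lintegral_of_nonneg_ae (ae_of_all _ fun ω => by positivity)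
    hint.aestronglyMeasurable]
  exact ENNReal.toReal_le_of_le_ofReal (by positivity) hbound

/-- The tail condition on a single entry. -/
def EntryDecay (P : Measure Ω) (C C' : ℝ) (X : Ω → ℂ) : Prop :=
  ∀ t : ℝ, C' ≤ t → P.real {ω | t ^ C ≤ ‖X ω‖} ≤ Real.exp (-t)

/-- Rounding `C` up to an integer exponent is allowed because `j ≥ 1`, which is why the threshold is
`⌈C'⌉₊ + 1`. -/
lemma EntryDecay.nat_tail [IsProbabilityMeasure P] {C C' : ℝ} {X : Ω → ℂ} (h : EntryDecay P C C' X)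
    (j : ℕ) (hj : ⌈C'⌉₊ + 1 ≤ j) :
    P.real {ω | (j : ℝ) ^ (⌈C⌉₊ + 1) ≤ ‖X ω‖} ≤ Real.exp (-j) := by
  have h1 : C' ≤ j := (Nat.le_ceil C').trans (by exact_mod_cast (by omega : ⌈C'⌉₊ ≤ j))
  have hj1 : (1 : ℝ) ≤ j := by exact_mod_cast (by omega : 1 ≤ j)
  refine le_trans (measureReal_mono ?_) (h j h1)
  intro ω hω
  simp only [Set.mem_ofPred_eq] at hω ⊢
  refine le_trans ?_ hω
  rw [← Real.rpow_natCast]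
  refine Real.rpow_le_rpow_of_exponent_le hj1 ((Nat.le_ceil C).trans ?_)
  push_cast; linarith

/-- The bound for `L^{2(q+1)}` norms squared of the entries. -/
def entryBound (C C' : ℝ) (q : ℕ) : ℝ :=
  (4 * ((⌈C'⌉₊ : ℝ) + 1 + 12 * (⌈C⌉₊ + 1)) * (q + 1)) ^ (2 * (⌈C⌉₊ + 1))

lemma one_le_entryBound (C C' : ℝ) (q : ℕ) : 1 ≤ entryBound C C' q := by
  refine one_le_pow₀ ?_
  have h1 : (0 : ℝ) ≤ (⌈C'⌉₊ : ℝ) := by positivity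
  have h2 : (0 : ℝ) ≤ (⌈C⌉₊ : ℝ) := by positivity
  have h3 : (0 : ℝ) ≤ (q : ℝ) := by positivity
  nlinarith

lemma EntryDecay.momBound [IsProbabilityMeasure P] {C C' : ℝ} {X : Ω → ℂ} (h : EntryDecay P C C' X)
    (hX : Measurable X) (q : ℕ) :
    MomBound P q X (entryBound C C' q) ∧ MomBound P (2 * q + 1) X (entryBound C C' q) := by
  have key : ∀ p : ℕ, p ≤ 2 * q + 1 → MomBound P p X (entryBound C C' q) := by
    intro p hp
    obtain ⟨h1, h2⟩ := moment_of_tail hX (D := ⌈C⌉₊ + 1) (t₀ := ⌈C'⌉₊ + 1) (by omega)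
      h.nat_tail (N := 2 * (p + 1)) (by omega)
    have e : ∀ ω, (‖X ω‖ ^ 2) ^ (p + 1) = ‖X ω‖ ^ (2 * (p + 1)) := fun ω => by rw [← pow_mul]
    refine ⟨hX, zero_le_one.trans (one_le_entryBound C C' q), ?_, ?_⟩
    · simpa only [e] using h1
    · simp only [e]
      refine h2.trans ?_
      rw [entryBound, ← pow_mul]
      have e2 : (⌈C⌉₊ + 1) * (2 * (p + 1)) = 2 * (⌈C⌉₊ + 1) * (p + 1) := by ring
      rw [e2]
      refine pow_le_pow_left₀ (by positivity) ?_ _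
      have hp' : (p : ℝ) + 1 ≤ 2 * ((q : ℝ) + 1) := by
        have : (p : ℝ) ≤ 2 * q + 1 := by exact_mod_cast hp
        linarith
      push_cast
      calc ((⌈C'⌉₊ : ℝ) + 1 + 12 * (⌈C⌉₊ + 1)) * (2 * (p + 1))
          ≤ ((⌈C'⌉₊ : ℝ) + 1 + 12 * (⌈C⌉₊ + 1)) * (2 * (2 * (q + 1))) := by gcongr
        _ = _ := by ring
  exact ⟨key q (by omega), key _ le_rfl⟩

/-- Markov's inequality for high moments. -/
lemma MomBound.tail [IsProbabilityMeasure P] {q : ℕ} {Z : Ω → ℂ} {τ S lam : ℝ}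
    (hZ : MomBound P q Z (τ * S)) (hτ : 0 ≤ τ) (hS : 0 ≤ S) (hlam : 0 < lam) :
    P.real {ω | lam * S < ‖Z ω‖ ^ 2} ≤ (τ / lam) ^ (q + 1) := by
  rcases hS.eq_or_lt with h0 | hpos
  -- For `S = 0` the moment bound makes `Z` vanish almost surely, so the strict inequality has
  -- probability zero.
  · rw [← h0, mul_zero]
    have hle := hZ.le
    rw [← h0, mul_zero, zero_pow (by omega)] at hle
    have hae := (integral_eq_zero_iff_of_nonneg (fun ω => by positivity) hZ.integrable).1
      (le_antisymm hle (integral_nonneg fun ω => by positivity))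
    have : P.real {ω | 0 < ‖Z ω‖ ^ 2} = 0 := by
      rw [measureReal_eq_zero_iff]
      have h2 : ∀ᵐ ω ∂P, ω ∉ {ω | 0 < ‖Z ω‖ ^ 2} := by
        filter_upwards [hae] with ω hω
        simp only [Pi.zero_apply] at hω
        have := pow_eq_zero_iff (by omega) |>.1 hω
        simp [this]
      exact measure_eq_zero_iff_ae_notMem.2 h2
    rw [this]
    positivity
  · have hmarkov := mul_meas_ge_le_integral_of_nonneg (μ := P)
      (f := fun ω => (‖Z ω‖ ^ 2) ^ (q + 1)) (ae_of_all _ fun ω => by positivity) hZ.integrable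
      ((lam * S) ^ (q + 1))
    have hsub : P.real {ω | lam * S < ‖Z ω‖ ^ 2} ≤
        P.real {ω | (lam * S) ^ (q + 1) ≤ (‖Z ω‖ ^ 2) ^ (q + 1)} := by
      refine measureReal_mono fun ω hω => ?_
      simp only [Set.mem_ofPred_eq] at hω ⊢
      gcongr
    have h1 := hmarkov.trans hZ.le
    rw [div_pow, le_div_iff₀ (by positivity), mul_comm]
    have h2 : (lam * S) ^ (q + 1) * P.real {ω | lam * S < ‖Z ω‖ ^ 2} ≤ (τ * S) ^ (q + 1) :=
      (mul_le_mul_of_nonneg_left hsub (by positivity)).trans h1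
    rw [mul_pow, mul_pow] at h2
    have h3 : 0 < S ^ (q + 1) := by positivity
    refine le_of_mul_le_mul_right ?_ h3
    linarith

/-- Polynomially growing moment constants give stretched exponential concentration. -/
lemma exists_tail_of_momBound (Γ : ℝ) (hΓ : 0 ≤ Γ) (γ : ℕ) :
    ∃ c : ℝ, 0 < c ∧ ∃ N₀ : ℕ, ∀ n : ℕ, N₀ ≤ n → ∀ {Ω : Type*} [MeasurableSpace Ω] (P : Measure Ω)
      [IsProbabilityMeasure P] (Z : Ω → ℂ) (S : ℝ), 0 ≤ S →
      (∀ q, MomBound P q Z (Γ * (q + 1) ^ γ * S)) →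
      P.real {ω | (n : ℝ) ^ (1 / 6 : ℝ) * S < ‖Z ω‖ ^ 2} ≤ Real.exp (-(n : ℝ) ^ c) := by
  -- With `q = ⌈n^c⌉` this gives `(n^c)^γ ≤ n^(1/12)`. A further `n^(1/12)` absorbs the constants
  -- and a factor `e`, so the Markov ratio is at most `1/e`, raised to a power exceeding `n^c`.
  set c : ℝ := 1 / (12 * (γ + 1)) with hc
  have hcpos : 0 < c := by positivity
  have hev : ∀ᶠ n : ℕ in Filter.atTop, Γ * 3 ^ γ * Real.exp 1 ≤ (n : ℝ) ^ (1 / 12 : ℝ) :=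
    ((tendsto_rpow_atTop (by norm_num : (0 : ℝ) < 1 / 12)).comp
      tendsto_natCast_atTop_atTop).eventually_ge_atTop _
  obtain ⟨N₀, hN₀⟩ := Filter.eventually_atTop.1 (hev.and (Filter.eventually_ge_atTop 1))
  refine ⟨c, hcpos, N₀, fun n hn {Ω} _ P _ Z S hS hZ => ?_⟩
  obtain ⟨hn1, hn2⟩ := hN₀ n hn
  have hnr : (1 : ℝ) ≤ n := by exact_mod_cast hn2
  have hn0 : (0 : ℝ) < n := by linarith
  set q := ⌈(n : ℝ) ^ c⌉₊ with hq
  have hnc : 1 ≤ (n : ℝ) ^ c := Real.one_le_rpow hnr hcpos.le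
  have hq1 : (n : ℝ) ^ c ≤ q := Nat.le_ceil _
  have hq2 : (q : ℝ) + 1 ≤ 3 * (n : ℝ) ^ c := by
    have := Nat.ceil_lt_add_one (show 0 ≤ (n : ℝ) ^ c by positivity)
    linarith
  have h16 : (0 : ℝ) < (n : ℝ) ^ (1 / 6 : ℝ) := by positivity
  refine ((hZ q).tail (by positivity) hS h16).trans ?_
  have hbase : Γ * (q + 1) ^ γ / (n : ℝ) ^ (1 / 6 : ℝ) ≤ Real.exp (-1) := by
    rw [div_le_iff₀ h16]
    have e1 : ((n : ℝ) ^ c) ^ γ ≤ (n : ℝ) ^ (1 / 12 : ℝ) := by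
      rw [← Real.rpow_natCast, ← Real.rpow_mul hn0.le]
      refine Real.rpow_le_rpow_of_exponent_le hnr ?_
      rw [hc, div_mul_eq_mul_div, div_le_div_iff₀ (by positivity) (by norm_num)]
      linarith
    have e2 : (n : ℝ) ^ (1 / 6 : ℝ) = (n : ℝ) ^ (1 / 12 : ℝ) * (n : ℝ) ^ (1 / 12 : ℝ) := by
      rw [← Real.rpow_add hn0]; norm_num
    calc Γ * ((q : ℝ) + 1) ^ γ ≤ Γ * (3 * (n : ℝ) ^ c) ^ γ := by gcongr
      _ = Γ * 3 ^ γ * ((n : ℝ) ^ c) ^ γ := by rw [mul_pow]; ring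
      _ ≤ Γ * 3 ^ γ * (n : ℝ) ^ (1 / 12 : ℝ) := by gcongr
      _ = Real.exp (-1) * ((Γ * 3 ^ γ * Real.exp 1) * (n : ℝ) ^ (1 / 12 : ℝ)) := by
          have : Real.exp (-1) * Real.exp 1 = 1 := by rw [← Real.exp_add]; simp
          linear_combination (-(Γ * 3 ^ γ * (n : ℝ) ^ (1 / 12 : ℝ))) * this
      _ ≤ Real.exp (-1) * ((n : ℝ) ^ (1 / 12 : ℝ) * (n : ℝ) ^ (1 / 12 : ℝ)) := by gcongr
      _ = _ := by rw [e2]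
  calc (Γ * (q + 1) ^ γ / (n : ℝ) ^ (1 / 6 : ℝ)) ^ (q + 1) ≤ (Real.exp (-1)) ^ (q + 1) := by
        gcongr
    _ = Real.exp (-((q : ℝ) + 1)) := by rw [← Real.exp_nat_mul]; push_cast; ring_nf
    _ ≤ _ := by
        rw [Real.exp_le_exp]; linarith

/-- Concentration of linear and quadratic forms of independent centred variables with stretched
exponential tails. -/
lemma exists_chaos_tail (C C' : ℝ) :
    ∃ c : ℝ, 0 < c ∧ ∃ N₀ : ℕ, ∀ n : ℕ, N₀ ≤ n → ∀ {Ω : Type*} [MeasurableSpace Ω] (P : Measure Ω)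
      [IsProbabilityMeasure P] (X : Fin n → Ω → ℂ), iIndepFun X P → (∀ i, Measurable (X i)) →
      (∀ i, ∫ ω, X i ω ∂P = 0) → (∀ i, EntryDecay P C C' (X i)) →
      (∀ a : Fin n → ℂ, P.real {ω | (n : ℝ) ^ (1 / 6 : ℝ) * ∑ j, ‖a j‖ ^ 2 <
        ‖∑ j, a j * X j ω‖ ^ 2} ≤ Real.exp (-(n : ℝ) ^ c)) ∧
      ∀ v : Fin n → ℝ, (∀ i, |v i| ≤ 1) → (∀ i, ∫ ω, ‖X i ω‖ ^ 2 ∂P = v i) →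
        ∀ a : Matrix (Fin n) (Fin n) ℂ, P.real {ω | (n : ℝ) ^ (1 / 6 : ℝ) * frobSq a <
          ‖∑ j, ∑ l, star (X j ω) * a j l * X l ω - ∑ j, a j j * v j‖ ^ 2} ≤
            Real.exp (-(n : ℝ) ^ c) := by
  set κ : ℝ := 4 * ((⌈C'⌉₊ : ℝ) + 1 + 12 * (⌈C⌉₊ + 1)) with hκ
  set d : ℕ := 2 * (⌈C⌉₊ + 1) with hd
  have hκ1 : 1 ≤ κ := by
    have h1 : (0 : ℝ) ≤ (⌈C'⌉₊ : ℝ) := by positivity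
    have h2 : (0 : ℝ) ≤ (⌈C⌉₊ : ℝ) := by positivity
    rw [hκ]; linarith
  have hb : ∀ q : ℕ, entryBound C C' q = κ ^ d * ((q : ℝ) + 1) ^ d := fun q => by
    rw [entryBound, mul_pow]
  obtain ⟨c, hc, N₀, h⟩ := exists_tail_of_momBound (800000 * (κ ^ d) ^ 2) (by positivity) (4 + 2 * d)
  refine ⟨c, hc, N₀, fun n hn {Ω} _ P _ X hX hm h0 hdec => ⟨fun a => ?_, fun v hv hvar a => ?_⟩⟩
  · refine h n hn P _ _ (by positivity) fun q => ?_
    refine (momBound_linear hX h0 (fun i => ((hdec i).momBound (hm i) q).1) a Finset.univ).mono ?_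
    refine mul_le_mul_of_nonneg_right ?_ (by positivity)
    rw [hb]
    have h1 : (1 : ℝ) ≤ (q : ℝ) + 1 := by linarith [(Nat.cast_nonneg q : (0 : ℝ) ≤ q)]
    have h2 : 1 ≤ κ ^ d := one_le_pow₀ hκ1
    calc 82 * ((q : ℝ) + 1) ^ 2 * (κ ^ d * ((q : ℝ) + 1) ^ d)
        = 82 * κ ^ d * ((q : ℝ) + 1) ^ (2 + d) := by ring
      _ ≤ 800000 * (κ ^ d) ^ 2 * ((q : ℝ) + 1) ^ (4 + 2 * d) := by
          refine mul_le_mul (mul_le_mul (by norm_num) (le_self_pow₀ h2 (by norm_num))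
            (by positivity) (by norm_num)) (pow_le_pow_right₀ h1 (by omega)) (by positivity)
            (by positivity)
  · refine h n hn P _ _ (Finset.sum_nonneg fun _ _ => Finset.sum_nonneg fun _ _ => by positivity)
      fun q => ?_
    refine (momBound_quadratic hX h0 (fun i => ((hdec i).momBound (hm i) q).1)
      (fun i => ((hdec i).momBound (hm i) q).2) v hv hvar a).mono ?_
    have h3 : (0 : ℝ) ≤ frobSq a :=
      Finset.sum_nonneg fun _ _ => Finset.sum_nonneg fun _ _ => by positivity
    have h4 : 200000 * ((q : ℝ) + 1) ^ 4 * (entryBound C C' q + 1) ^ 2 ≤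
        800000 * (κ ^ d) ^ 2 * ((q : ℝ) + 1) ^ (4 + 2 * d) := by
      have h5 := one_le_entryBound C C' q
      calc 200000 * ((q : ℝ) + 1) ^ 4 * (entryBound C C' q + 1) ^ 2
          ≤ 200000 * ((q : ℝ) + 1) ^ 4 * (2 * entryBound C C' q) ^ 2 := by
            gcongr; linarith
        _ = _ := by rw [hb]; ring
    exact mul_le_mul_of_nonneg_right h4 h3

end Tails


/-! ### Independence of a column and its minor -/

section Independence

variable {Ω : Type*} [MeasurableSpace Ω] {P : Measure Ω} {n : ℕ}

/-- Cramer's rule: the adjugate and the determinant are continuous in `A`, and inversion of scalars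
is measurable also at zero. -/
lemma measurable_green_entry (r : ℂ) (z : ℂ) (k l : Fin n) :
    Measurable fun A : Fin n → Fin n → ℂ => green (r • Matrix.of A) z k l := by
  have hB : Continuous fun A : Fin n → Fin n → ℂ =>
      (r • Matrix.of A - z • (1 : Matrix (Fin n) (Fin n) ℂ)) := by
    have h1 : Continuous fun A : Fin n → Fin n → ℂ => Matrix.of A :=
      continuous_id
    exact (h1.const_smul r).sub continuous_const
  have hdet := hB.matrix_det.measurable
  have hadj : Continuous fun A : Fin n → Fin n → ℂ =>
      (r • Matrix.of A - z • (1 : Matrix (Fin n) (Fin n) ℂ)).adjugate k l :=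
    hB.matrix_adjugate.matrix_elem k l
  simp only [green, Matrix.inv_def, Matrix.smul_apply, Ring.inverse_eq_inv', smul_eq_mul]
  exact hdet.inv.mul hadj.measurable

/-- Fubini: a bound uniform over frozen values of `Y` survives integration over `Y`. It lets
concentration with deterministic coefficients apply to coefficients built from the minor. -/
lemma prob_le_of_indep [IsProbabilityMeasure P] {α β : Type*} [MeasurableSpace α]
    [MeasurableSpace β] {X : Ω → α} {Y : Ω → β} (hX : Measurable X) (hY : Measurable Y)
    (h : IndepFun X Y P) {S : Set (α × β)} (hS : MeasurableSet S) {ε : ℝ}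
    (hε : ∀ b, P.real {ω | (X ω, b) ∈ S} ≤ ε) : P.real {ω | (X ω, Y ω) ∈ S} ≤ ε := by
  have hε0 : 0 ≤ ε := by
    obtain ⟨ω⟩ : Nonempty Ω := nonempty_of_isProbabilityMeasure P
    exact measureReal_nonneg.trans (hε (Y ω))
  have h1 : P {ω | (X ω, Y ω) ∈ S} ≤ ENNReal.ofReal ε := by
    have e1 : P {ω | (X ω, Y ω) ∈ S} = (P.map fun ω => (X ω, Y ω)) S := by
      rw [Measure.map_apply (hX.prodMk hY) hS]; rfl
    have : IsProbabilityMeasure (P.map X) := Measure.isProbabilityMeasure_map hX.aemeasurable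
    have : IsProbabilityMeasure (P.map Y) := Measure.isProbabilityMeasure_map hY.aemeasurable
    rw [e1, (indepFun_iff_map_prod_eq_prod_map_map hX.aemeasurable hY.aemeasurable).1 h,
      Measure.prod_apply_symm hS]
    calc ∫⁻ b, (P.map X) ((fun a => (a, b)) ⁻¹' S) ∂(P.map Y)
        ≤ ∫⁻ _, ENNReal.ofReal ε ∂(P.map Y) := by
          refine lintegral_mono fun b => ?_
          rw [Measure.map_apply hX (measurable_prodMk_right hS)]
          have := hε b
          rw [← ofReal_measureReal]
          exact ENNReal.ofReal_le_ofReal this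
      _ = ENNReal.ofReal ε := by simp
  rw [measureReal_def]
  exact ENNReal.toReal_le_of_le_ofReal hε0 h1

variable {M : Ω → Matrix (Fin n) (Fin n) ℂ}

lemma IsWigner.conj_entry (hM : IsWigner P M) (ω : Ω) (i j : Fin n) :
    M ω i j = star (M ω j i) := by
  rw [← Matrix.conjTranspose_apply, (hM.isHermitian ω).eq]

lemma IsWigner.isProbabilityMeasure (hM : IsWigner P M) : IsProbabilityMeasure P :=
  hM.indep_entries.isProbabilityMeasure

/-- The position above the diagonal of the entry `(j, i)`. -/
def upperPos (i j : Fin n) : {p : Fin n × Fin n // p.1 ≤ p.2} :=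
  ⟨(min i j, max i j), min_le_max⟩

/-- Recovers an entry of the `i`-th off-diagonal column from the entry above the diagonal. -/
def colFun (i j : Fin n) (x : ℂ) : ℂ := if j = i then 0 else if j ≤ i then x else star x

lemma measurable_colFun (i j : Fin n) : Measurable (colFun i j) := by
  unfold colFun
  split_ifs <;> fun_prop

lemma IsWigner.offCol_eq (hM : IsWigner P M) (i j : Fin n) (ω : Ω) :
    offCol (M ω) i j = colFun i j (M ω (upperPos i j).1.1 (upperPos i j).1.2) := by
  simp only [offCol, colFun, upperPos]
  split_ifs with h1 h2
  · rfl
  · rw [min_eq_right h2, max_eq_left h2]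
  · rw [min_eq_left (le_of_not_ge h2), max_eq_right (le_of_not_ge h2)]
    exact hM.conj_entry ω j i

lemma IsWigner.measurable_offCol (hM : IsWigner P M) (i j : Fin n) :
    Measurable fun ω => offCol (M ω) i j := by
  simp only [hM.offCol_eq]
  exact (measurable_colFun i j).comp (hM.measurable_entry _ _)

lemma upperPos_injective (i : Fin n) : Function.Injective (upperPos i) := by
  intro j k h
  simp only [upperPos, Subtype.mk.injEq, Prod.mk.injEq] at h
  obtain ⟨h1, h2⟩ := h
  rcases le_total i j with hj | hj <;> rcases le_total i k with hk | hk <;>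
    simp_all <;> exact le_antisymm ‹_› ‹_›

lemma IsWigner.iIndepFun_offCol (hM : IsWigner P M) (i : Fin n) :
    iIndepFun (fun j ω => offCol (M ω) i j) P := by
  have h := (hM.indep_entries.precomp (upperPos_injective i)).comp (fun j => colFun i j)
    (fun j => measurable_colFun i j)
  convert h using 2 with j
  funext ω
  exact hM.offCol_eq i j ω

/-- The column depends only on the upper-triangular positions meeting `i`, the minor only on those
avoiding `i`; these are disjoint sets of independent entries. -/
lemma IsWigner.indepFun_offCol_zeroed (hM : IsWigner P M) (i : Fin n) :
    IndepFun (fun ω => (offCol (M ω) i : Fin n → ℂ))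
      (fun ω k l => zeroed (M ω) i k l) P := by
  classical
  set S : Finset {p : Fin n × Fin n // p.1 ≤ p.2} :=
    Finset.univ.filter fun p => p.1.1 = i ∨ p.1.2 = i with hS
  set T : Finset {p : Fin n × Fin n // p.1 ≤ p.2} :=
    Finset.univ.filter fun p => ¬ (p.1.1 = i ∨ p.1.2 = i) with hT
  have h := hM.indep_entries.indepFun_finset S T
    (Finset.disjoint_filter_filter_not _ _ _) (fun p => hM.measurable_entry _ _)
  have hSmem : ∀ j, upperPos i j ∈ S := by
    intro j
    simp only [hS, Finset.mem_filter, Finset.mem_univ, true_and, upperPos]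
    rcases le_total i j with hj | hj
    · left; exact min_eq_left hj
    · right; exact max_eq_left hj
  have hTmem : ∀ p : {p : Fin n × Fin n // p.1 ≤ p.2}, ¬ (p.1.1 = i ∨ p.1.2 = i) → p ∈ T := by
    intro p hp
    simp only [hT, Finset.mem_filter, Finset.mem_univ, true_and]
    exact hp
  let φ : (S → ℂ) → (Fin n → ℂ) := fun v j => colFun i j (v ⟨upperPos i j, hSmem j⟩)
  let ψ : (T → ℂ) → (Fin n → Fin n → ℂ) := fun w k l =>
    if hkl : k = i ∨ l = i then 0 else
      if hle : k ≤ l then w ⟨⟨(k, l), hle⟩, hTmem _ hkl⟩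
      else star (w ⟨⟨(l, k), le_of_not_ge hle⟩, hTmem _ (fun h => hkl h.symm)⟩)
  have hφ : Measurable φ := by
    refine measurable_pi_lambda _ fun j => ?_
    exact (measurable_colFun i j).comp (measurable_pi_apply _)
  have hψ : Measurable ψ := by
    refine measurable_pi_lambda _ fun k => measurable_pi_lambda _ fun l => ?_
    simp only [ψ]
    split_ifs <;> fun_prop
  have h2 := h.comp hφ hψ
  have e1 : (fun ω => (offCol (M ω) i : Fin n → ℂ)) =
      φ ∘ fun ω (p : S) => M ω p.1.1.1 p.1.1.2 := by
    funext ω j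
    exact hM.offCol_eq i j ω
  have e2 : (fun ω k l => zeroed (M ω) i k l) =
      ψ ∘ fun ω (p : T) => M ω p.1.1.1 p.1.1.2 := by
    funext ω k l
    simp only [zeroed, ψ, Function.comp_apply]
    split_ifs with h1 h2
    · rfl
    · rfl
    · exact hM.conj_entry ω k l
  rw [e1, e2]
  exact h2

lemma IsWigner.integral_offCol (hM : IsWigner P M) (i j : Fin n) :
    ∫ ω, offCol (M ω) i j ∂P = 0 := by
  simp only [offCol]
  split_ifs
  · simp
  · exact hM.mean_eq_zero j i

lemma IsWigner.integral_sq_offCol (hM : IsWigner P M) (i j : Fin n) :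
    ∫ ω, ‖offCol (M ω) i j‖ ^ 2 ∂P = if j = i then 0 else 1 := by
  simp only [offCol]
  split_ifs with h
  · simp
  · rcases lt_or_gt_of_ne h with h1 | h1
    · exact hM.variance_off_diag j i h1
    · rw [← hM.variance_off_diag i j h1]
      refine integral_congr_ae (ae_of_all _ fun ω => ?_)
      simp only
      rw [hM.conj_entry ω j i, norm_star]

lemma entryDecay_offCol {C C' : ℝ} (hC' : 0 < C') (h : ExpDecay P C C' M) (i j : Fin n) :
    EntryDecay P C C' fun ω => offCol (M ω) i j := by
  intro t ht
  simp only [offCol]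
  split_ifs
  · have : (0 : ℝ) < t ^ C := Real.rpow_pos_of_pos (hC'.trans_le ht) C
    have e : {ω : Ω | t ^ C ≤ ‖(0 : ℂ)‖} = ∅ := by
      ext ω; simp [this]
    rw [e]; simp [Real.exp_nonneg]
  · exact h j i t ht

end Independence

/-! ### Effect of the normalization on columns and minors -/

section LocalLaw

variable {n : ℕ}

lemma offCol_normalized (A : Matrix (Fin n) (Fin n) ℂ) (i : Fin n) (k : Fin n) :
    offCol (normalized A) i k = (((Real.sqrt n)⁻¹ : ℝ) : ℂ) * offCol A i k := by
  simp only [offCol, normalized, Matrix.smul_apply, smul_eq_mul]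
  split_ifs <;> simp

lemma zeroed_normalized (A : Matrix (Fin n) (Fin n) ℂ) (i : Fin n) :
    zeroed (normalized A) i = normalized (zeroed A i) := by
  ext k l
  simp only [zeroed, normalized, Matrix.smul_apply, smul_eq_mul]
  split_ifs <;> simp

lemma normalized_isHermitian {A : Matrix (Fin n) (Fin n) ℂ} (hA : A.IsHermitian) :
    (normalized A).IsHermitian := by
  unfold normalized
  ext i j
  simp only [Matrix.conjTranspose_apply, Matrix.smul_apply, smul_eq_mul, star_mul',
    RCLike.star_def, Complex.conj_ofReal]
  congr 1
  exact congrFun (congrFun hA i) j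

/-- The weights are the variances of `offCol A i` for a Wigner matrix, zero at `i`. Adding `z⁻¹` to
the trace removes exactly the `(i, i)` entry `-z⁻¹` of the minor's resolvent, so the subtracted term
is the conditional mean. -/
lemma schurDev_normalized {A : Matrix (Fin n) (Fin n) ℂ} (hA : A.IsHermitian) {z : ℂ}
    (hz : 0 < z.im) (hn : 0 < n) (i : Fin n) :
    schurDev (normalized A) z i = (1 / (n : ℂ)) *
      (∑ k, ∑ l, star (offCol A i k) * green (normalized (zeroed A i)) z k l * offCol A i l -
        ∑ k, green (normalized (zeroed A i)) z k k *
          (((if k = i then 0 else 1 : ℝ)) : ℂ)) := by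
  have hH := normalized_isHermitian hA
  have hn0 : (n : ℂ) ≠ 0 := by exact_mod_cast hn.ne'
  have hs : (((Real.sqrt n)⁻¹ : ℝ) : ℂ) * (((Real.sqrt n)⁻¹ : ℝ) : ℂ) = 1 / (n : ℂ) := by
    rw [← Complex.ofReal_mul, ← mul_inv, Real.mul_self_sqrt (by positivity)]
    push_cast; rw [one_div]
  have hii : green (zeroed (normalized A) i) z i i = -z⁻¹ := by
    rw [green_zeroed hH hz]
    have := green_diag_ne_zero hH hz i
    simp only [and_self, if_true]
    field_simp
    ring
  have htr : (green (zeroed (normalized A) i) z).trace + z⁻¹ =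
      ∑ k, green (zeroed (normalized A) i) z k k * (((if k = i then 0 else 1 : ℝ)) : ℂ) := by
    rw [Matrix.trace, ← Finset.add_sum_erase _ _ (Finset.mem_univ i),
      ← Finset.add_sum_erase (Finset.univ) (fun k => green (zeroed (normalized A) i) z k k *
        (((if k = i then 0 else 1 : ℝ)) : ℂ)) (Finset.mem_univ i)]
    simp only [Matrix.diag_apply, hii, if_true, Complex.ofReal_zero, mul_zero, zero_add]
    rw [add_comm, ← add_assoc, add_neg_cancel, zero_add]
    refine Finset.sum_congr rfl fun k hk => ?_
    simp [Finset.ne_of_mem_erase hk]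
  rw [schurDev, htr, Fintype.card_fin, ← zeroed_normalized]
  simp only [offCol_normalized]
  rw [mul_sub, div_eq_mul_one_div, mul_comm _ (1 / (n : ℂ))]
  congr 1
  rw [Finset.mul_sum]
  refine Finset.sum_congr rfl fun k _ => ?_
  rw [Finset.mul_sum]
  refine Finset.sum_congr rfl fun l _ => ?_
  rw [← hs, star_mul']
  simp only [RCLike.star_def, Complex.conj_ofReal]
  ring

end LocalLaw


/-! ### Concentration of the forms in Schur's formula -/

section RowConcentration

lemma measurable_frobSq_green {n : ℕ} (r z : ℂ) :
    Measurable fun A : Fin n → Fin n → ℂ => frobSq (green (r • Matrix.of A) z) := by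
  unfold frobSq
  exact Finset.measurable_sum _ fun k _ => Finset.measurable_sum _ fun l _ =>
    (measurable_green_entry r z k l).norm.pow_const 2

/-- Given the minor, the three quantities are a quadratic form and two linear forms in the
independent column. Squaring the normalization gives `n^(-2)` for the former and `n^(-1)` for the
latter. -/
lemma exists_row_tail (C C' : ℝ) (hC' : 0 < C') :
    ∃ c : ℝ, 0 < c ∧ ∃ N₀ : ℕ, ∀ n : ℕ, N₀ ≤ n → ∀ {Ω : Type*} [MeasurableSpace Ω] (P : Measure Ω)
      (M : Ω → Matrix (Fin n) (Fin n) ℂ), IsWigner P M → ExpDecay P C C' M →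
      ∀ z : ℂ, 0 < z.im → ∀ i : Fin n,
      P.real {ω | (n : ℝ) ^ (1 / 6 : ℝ) / (n : ℝ) ^ 2 *
        frobSq (green (zeroed (normalized (M ω)) i) z) < ‖schurDev (normalized (M ω)) z i‖ ^ 2} ≤
          Real.exp (-(n : ℝ) ^ c) ∧
      ∀ b : Fin n,
      P.real {ω | (n : ℝ) ^ (1 / 6 : ℝ) / n *
        ∑ l, ‖green (zeroed (normalized (M ω)) i) z b l‖ ^ 2 <
        ‖∑ l, green (zeroed (normalized (M ω)) i) z b l * offCol (normalized (M ω)) i l‖ ^ 2} ≤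
          Real.exp (-(n : ℝ) ^ c) ∧
      P.real {ω | (n : ℝ) ^ (1 / 6 : ℝ) / n *
        ∑ l, ‖green (zeroed (normalized (M ω)) i) z l b‖ ^ 2 <
        ‖∑ l, green (zeroed (normalized (M ω)) i) z l b * star (offCol (normalized (M ω)) i l)‖ ^ 2} ≤
          Real.exp (-(n : ℝ) ^ c) := by
  obtain ⟨c, hc, N₀, h⟩ := exists_chaos_tail C C'
  refine ⟨c, hc, N₀, fun n hn {Ω} _ P M hM hdec z hz i => ?_⟩
  have hP := hM.isProbabilityMeasure
  have hn0 : 0 < n := lt_of_le_of_lt (Nat.zero_le _) i.2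
  have hnr : (0 : ℝ) < n := by exact_mod_cast hn0
  obtain ⟨hlin, hquad⟩ := h n hn P (fun j ω => offCol (M ω) i j) (hM.iIndepFun_offCol i)
    (hM.measurable_offCol i) (hM.integral_offCol i) (entryDecay_offCol hC' hdec i)
  have hXm : Measurable fun ω => (offCol (M ω) i : Fin n → ℂ) :=
    measurable_pi_lambda _ fun j => hM.measurable_offCol i j
  have hYm : Measurable fun ω (k l : Fin n) => zeroed (M ω) i k l := by
    refine measurable_pi_lambda _ fun k => measurable_pi_lambda _ fun l => ?_
    simp only [zeroed]
    split_ifs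
    · exact measurable_const
    · exact hM.measurable_entry k l
  set r : ℂ := (((Real.sqrt n)⁻¹ : ℝ) : ℂ) with hr
  have hr2 : ‖r‖ ^ 2 = 1 / (n : ℝ) := by
    rw [hr, Complex.norm_real, Real.norm_of_nonneg (by positivity), inv_pow,
      Real.sq_sqrt hnr.le, one_div]
  have hg1 : ∀ k l, Measurable fun x : (Fin n → ℂ) × (Fin n → Fin n → ℂ) =>
      green (r • Matrix.of x.2) z k l := fun k l =>
    (measurable_green_entry r z k l).comp measurable_snd
  have hx1 : ∀ k, Measurable fun x : (Fin n → ℂ) × (Fin n → Fin n → ℂ) => x.1 k := fun k =>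
    (measurable_pi_apply k).comp measurable_fst
  have hx2 : ∀ k, Measurable fun x : (Fin n → ℂ) × (Fin n → Fin n → ℂ) => star (x.1 k) :=
    fun k => (by fun_prop : Measurable (star : ℂ → ℂ)).comp (hx1 k)
  have hG : ∀ ω, green (zeroed (normalized (M ω)) i) z =
      green (r • Matrix.of fun k l => zeroed (M ω) i k l) z := fun ω => by
    rw [zeroed_normalized]; rfl
  refine ⟨?_, fun b => ⟨?_, ?_⟩⟩
  · set v : Fin n → ℝ := fun k => if k = i then 0 else 1 with hv
    set S : Set ((Fin n → ℂ) × (Fin n → Fin n → ℂ)) :=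
      {x | (n : ℝ) ^ (1 / 6 : ℝ) * frobSq (green (r • Matrix.of x.2) z) <
        ‖∑ j, ∑ l, star (x.1 j) * green (r • Matrix.of x.2) z j l * x.1 l -
          ∑ j, green (r • Matrix.of x.2) z j j * (v j : ℂ)‖ ^ 2} with hS
    have hSm : MeasurableSet S := by
      refine measurableSet_lt ?_ ?_
      · exact ((measurable_frobSq_green r z).comp measurable_snd).const_mul _
      · refine (Measurable.norm (Measurable.sub ?_ ?_)).pow_const 2
        · exact Finset.measurable_sum _ fun j _ => Finset.measurable_sum _ fun l _ =>
            ((hx2 j).mul (hg1 j l)).mul (hx1 l)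
        · exact Finset.measurable_sum _ fun j _ => (hg1 j j).mul_const _
    have hmain := prob_le_of_indep hXm hYm (hM.indepFun_offCol_zeroed i) hSm (fun A =>
      hquad v (fun k => by simp only [hv]; split_ifs <;> simp) (hM.integral_sq_offCol i)
        (green (r • Matrix.of A) z))
    refine (measureReal_mono ?_).trans hmain
    intro ω hω
    simp only [Set.mem_ofPred_eq] at hω
    simp only [hS, Set.mem_ofPred_eq]
    rw [schurDev_normalized (hM.isHermitian ω) hz hn0, norm_mul, mul_pow, ← zeroed_normalized,
      hG ω] at hω
    have e : ‖1 / (n : ℂ)‖ ^ 2 = 1 / (n : ℝ) ^ 2 := by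
      rw [norm_div, norm_one, Complex.norm_natCast]; field_simp
    rw [e, div_mul_eq_mul_div, div_lt_iff₀ (by positivity), mul_comm (1 / (n : ℝ) ^ 2), mul_assoc,
      one_div_mul_cancel (by positivity), mul_one] at hω
    exact hω
  · set S : Set ((Fin n → ℂ) × (Fin n → Fin n → ℂ)) :=
      {x | (n : ℝ) ^ (1 / 6 : ℝ) * ∑ l, ‖green (r • Matrix.of x.2) z b l‖ ^ 2 <
        ‖∑ l, green (r • Matrix.of x.2) z b l * x.1 l‖ ^ 2} with hS
    have hSm : MeasurableSet S := by
      refine measurableSet_lt ?_ ?_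
      · exact (Finset.measurable_sum _ fun l _ => (hg1 b l).norm.pow_const 2).const_mul _
      · exact (Finset.measurable_sum _ fun l _ => (hg1 b l).mul (hx1 l)).norm.pow_const 2
    have hmain := prob_le_of_indep hXm hYm (hM.indepFun_offCol_zeroed i) hSm (fun A =>
      hlin fun l => green (r • Matrix.of A) z b l)
    refine (measureReal_mono ?_).trans hmain
    intro ω hω
    simp only [Set.mem_ofPred_eq] at hω
    simp only [hS, Set.mem_ofPred_eq]
    have e : ∑ l, green (zeroed (normalized (M ω)) i) z b l * offCol (normalized (M ω)) i l =
        r * ∑ l, green (zeroed (normalized (M ω)) i) z b l * offCol (M ω) i l := by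
      rw [Finset.mul_sum]
      refine Finset.sum_congr rfl fun l _ => ?_
      rw [offCol_normalized]; ring
    rw [e, norm_mul, mul_pow, hr2, hG ω, div_mul_eq_mul_div, div_mul_eq_mul_div, one_mul,
      div_lt_div_iff_of_pos_right hnr] at hω
    exact hω
  · set S : Set ((Fin n → ℂ) × (Fin n → Fin n → ℂ)) :=
      {x | (n : ℝ) ^ (1 / 6 : ℝ) * ∑ l, ‖green (r • Matrix.of x.2) z l b‖ ^ 2 <
        ‖∑ l, green (r • Matrix.of x.2) z l b * star (x.1 l)‖ ^ 2} with hS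
    have hSm : MeasurableSet S := by
      refine measurableSet_lt ?_ ?_
      · exact (Finset.measurable_sum _ fun l _ => (hg1 l b).norm.pow_const 2).const_mul _
      · exact (Finset.measurable_sum _ fun l _ => (hg1 l b).mul (hx2 l)).norm.pow_const 2
    have hmain := prob_le_of_indep hXm hYm (hM.indepFun_offCol_zeroed i) hSm (ε :=
      Real.exp (-(n : ℝ) ^ c)) (fun A => by
        -- The row form is the complex conjugate of a linear form with conjugated coefficients.
        refine le_trans (le_of_eq ?_) (hlin fun l => star (green (r • Matrix.of A) z l b))
        congr 1
        ext ω
        have e : ∑ l, star (green (r • Matrix.of A) z l b) * offCol (M ω) i l =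
            star (∑ l, green (r • Matrix.of A) z l b * star (offCol (M ω) i l)) := by
          rw [star_sum]
          refine Finset.sum_congr rfl fun l _ => ?_
          rw [star_mul', star_star]
        simp only [hS, Set.mem_ofPred_eq, norm_star, e])
    refine (measureReal_mono ?_).trans hmain
    intro ω hω
    simp only [Set.mem_ofPred_eq] at hω
    simp only [hS, Set.mem_ofPred_eq]
    have e : ∑ l, green (zeroed (normalized (M ω)) i) z l b * star (offCol (normalized (M ω)) i l) =
        r * ∑ l, green (zeroed (normalized (M ω)) i) z l b * star (offCol (M ω) i l) := by
      rw [Finset.mul_sum]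
      refine Finset.sum_congr rfl fun l _ => ?_
      rw [offCol_normalized, star_mul', hr]
      simp only [RCLike.star_def, Complex.conj_ofReal]
      ring
    rw [e, norm_mul, mul_pow, hr2, hG ω, div_mul_eq_mul_div, div_mul_eq_mul_div, one_mul,
      div_lt_div_iff_of_pos_right hnr] at hω
    exact hω

end RowConcentration

/-! ### The local law on the good event -/

section LocalLaw

/-- The deterministic part of the local law: on the event that all fluctuations are small, the
entries of the resolvent are bounded. -/
lemma norm_green_le_of_good {n : ℕ} (hn : 1 ≤ n)
    (hlarge : (7000 : ℝ) ≤ (n : ℝ) ^ (1 / 12 : ℝ)) {H : Matrix (Fin n) (Fin n) ℂ}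
    (hH : H.IsHermitian) {E : ℝ} (hE : |E| ≤ 3) {N : ℕ} (hN : 40 / (edgeScale n) ^ 2 ≤ N)
    (hdiag : ∀ i, ‖H i i‖ ≤ (n : ℝ) ^ (-(1 / 6) : ℝ))
    (hdev : ∀ l ≤ N, ∀ i,
      ‖schurDev H ⟨E, 1 - (1 - edgeScale n) * (l / N)⟩ i‖ ^ 2 ≤
        (n : ℝ) ^ (1 / 6 : ℝ) / (n : ℝ) ^ 2 *
          frobSq (green (zeroed H i) ⟨E, 1 - (1 - edgeScale n) * (l / N)⟩)) {a b : Fin n}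
    (hcol : ‖∑ l, green (zeroed H a) ⟨E, edgeScale n⟩ b l * offCol H a l‖ ^ 2 ≤
      (n : ℝ) ^ (1 / 6 : ℝ) / n * ∑ l, ‖green (zeroed H a) ⟨E, edgeScale n⟩ b l‖ ^ 2)
    (hrow : ‖∑ l, green (zeroed H a) ⟨E, edgeScale n⟩ l b * star (offCol H a l)‖ ^ 2 ≤
      (n : ℝ) ^ (1 / 6 : ℝ) / n * ∑ l, ‖green (zeroed H a) ⟨E, edgeScale n⟩ l b‖ ^ 2) :
    (∀ i, ‖green H ⟨E, edgeScale n⟩ i i‖ ≤ 11) ∧ ‖green H ⟨E, edgeScale n⟩ a b‖ ≤ 11 ∧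
      ‖green H ⟨E, edgeScale n⟩ b a‖ ≤ 11 := by
  have hne : Nonempty (Fin n) := ⟨⟨0, hn⟩⟩
  have hnr : (1 : ℝ) ≤ n := by exact_mod_cast hn
  have hn0 : (0 : ℝ) < n := by linarith
  set η := edgeScale n with hη
  have hηpos : 0 < η := by rw [hη, edgeScale]; positivity
  have hη1 : η ≤ 1 := by
    rw [hη, edgeScale]; exact Real.rpow_le_one_of_one_le_of_nonpos hnr (by norm_num)
  have hNpos : (0 : ℝ) < N := lt_of_lt_of_le (by positivity) hN
  set θ : ℝ := (n : ℝ) ^ (-(1 / 6) : ℝ) with hθ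
  have hθ0 : 0 ≤ θ := by positivity
  have hθ1 : θ ≤ 1 := Real.rpow_le_one_of_one_le_of_nonpos hnr (by norm_num)
  -- In exponents, `1/6 - 1 = -1/6 - 2/3`: the fluctuation allowance `n^(1/6)` still leaves a gain
  -- `θ = n^(-1/6)` at scale `η`.
  have hηθ : (n : ℝ) ^ (1 / 6 : ℝ) / n = θ * η := by
    rw [hθ, hη, edgeScale, ← Real.rpow_add hn0, div_eq_mul_inv, ← Real.rpow_neg_one,
      ← Real.rpow_add hn0]
    norm_num
  -- Makes `7 √θ ≤ 1/1000`, the accuracy required by `norm_gap`.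
  have hsqrt : Real.sqrt θ ≤ 1 / 7000 := by
    rw [Real.sqrt_eq_rpow, hθ, ← Real.rpow_mul hn0.le]
    have e : (-(1 / 6) * (1 / 2) : ℝ) = -(1 / 12) := by norm_num
    rw [e, Real.rpow_neg hn0.le]
    exact (inv_anti₀ (by norm_num) hlarge).trans (by norm_num)
  have hθs : θ ≤ 1 / 10000 := by
    have h1 := Real.sq_sqrt hθ0
    nlinarith [Real.sqrt_nonneg θ]
  have hself : ∀ l ≤ N, ∀ i,
      ‖(green H ⟨E, 1 - (1 - η) * (l / N)⟩ i i)⁻¹ -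
        (-(⟨E, 1 - (1 - η) * (l / N)⟩ + meanTrace H ⟨E, 1 - (1 - η) * (l / N)⟩))‖ ≤
      1 / 1000 * (1 + ‖-((⟨E, 1 - (1 - η) * (l / N)⟩ : ℂ) +
        meanTrace H ⟨E, 1 - (1 - η) * (l / N)⟩)‖) := by
    intro l hl i
    have hdevl := hdev l hl i
    have hy0 : η ≤ 1 - (1 - η) * ((l : ℝ) / N) := by
      have h1 : (l : ℝ) / N ≤ 1 := by
        rw [div_le_one hNpos]; exact_mod_cast hl
      have h2 : (1 - η) * ((l : ℝ) / N) ≤ (1 - η) * 1 :=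
        mul_le_mul_of_nonneg_left h1 (by linarith)
      linarith
    have hy1 : 1 - (1 - η) * ((l : ℝ) / N) ≤ 1 := by
      have : 0 ≤ (1 - η) * ((l : ℝ) / N) := mul_nonneg (by linarith) (by positivity)
      linarith
    set y : ℝ := 1 - (1 - η) * ((l : ℝ) / N) with hy
    have hypos : 0 < y := hηpos.trans_le hy0
    have hz1 : ‖(⟨E, y⟩ : ℂ)‖ ≤ 4 := by
      refine (Complex.norm_le_abs_re_add_abs_im _).trans ?_
      simp only
      rw [abs_of_pos hypos]; linarith
    have h2 : 1 / ((Fintype.card (Fin n) : ℝ) * (⟨E, y⟩ : ℂ).im) ≤ θ := by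
      rw [Fintype.card_fin]
      simp only
      have h3 : 1 / ((n : ℝ) * y) ≤ 1 / (n * η) := by gcongr
      refine h3.trans ?_
      rw [div_le_iff₀ (by positivity)]
      have h4 : θ * (n * η) = (n : ℝ) ^ (1 / 6 : ℝ) := by
        have h5 : (n : ℝ) ^ (1 / 6 : ℝ) = θ * η * n := by
          rw [← hηθ, div_mul_cancel₀ _ hn0.ne']
        rw [h5]; ring
      rw [h4]
      exact Real.one_le_rpow hnr (by norm_num)
    have h3 : ‖schurDev H ⟨E, y⟩ i‖ ^ 2 ≤
        θ * (⟨E, y⟩ : ℂ).im / Fintype.card (Fin n) * frobSq (green (zeroed H i) ⟨E, y⟩) := by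
      refine hdevl.trans ?_
      have hfr : 0 ≤ frobSq (green (zeroed H i) ⟨E, y⟩) :=
        Finset.sum_nonneg fun _ _ => Finset.sum_nonneg fun _ _ => by positivity
      refine mul_le_mul_of_nonneg_right ?_ hfr
      rw [Fintype.card_fin]
      have : (n : ℝ) ^ (1 / 6 : ℝ) / (n : ℝ) ^ 2 = θ * η / n := by
        rw [← hηθ]; field_simp
      rw [this]
      simp only
      gcongr
    refine (norm_inv_green_diag_sub_le hH hypos hz1 i hθ1 (hdiag i) h2 h3).trans ?_
    gcongr
    linarith
  obtain ⟨hd, hu⟩ := norm_lower_of_grid hH hE hηpos hη1 hN hself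
  refine ⟨hd, ?_⟩
  by_cases hab : b = a
  · subst hab; exact ⟨hd b, hd b⟩
  · have hlast := hself N le_rfl a
    have hζN : (⟨E, 1 - (1 - η) * ((N : ℝ) / N)⟩ : ℂ) = ⟨E, η⟩ := by
      rw [div_self hNpos.ne']; congr 1; ring
    rw [hζN] at hlast
    have hinv : ‖(green H ⟨E, η⟩ a a)⁻¹‖ ≤ 17 := by
      have := norm_add_le ((green H ⟨E, η⟩ a a)⁻¹ - (-(⟨E, η⟩ + meanTrace H ⟨E, η⟩)))
        (-((⟨E, η⟩ : ℂ) + meanTrace H ⟨E, η⟩))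
      rw [sub_add_cancel] at this
      linarith
    rw [hηθ] at hcol hrow
    obtain ⟨h1, h2⟩ := norm_green_offDiag_le hH (z := ⟨E, η⟩) hηpos hab hθs hθ0 hd hinv hcol hrow
    exact ⟨by linarith, by linarith⟩

end LocalLaw


/-! ### The local law with overwhelming probability -/

section LocalLaw

/-- Halving the exponent absorbs any polynomial prefactor, such as the number of events in a union
bound. -/
lemma eventually_mul_pow_exp_le (K : ℝ) (k : ℕ) {c : ℝ} (hc : 0 < c) :
    ∀ᶠ n : ℕ in Filter.atTop,
      K * (n : ℝ) ^ k * Real.exp (-(n : ℝ) ^ c) ≤ Real.exp (-(n : ℝ) ^ (c / 2)) := by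
  have h1 : Filter.Tendsto (fun x : ℝ => K * (x ^ (2 * k / c) * Real.exp (-1 * x))) Filter.atTop
      (nhds (K * 0)) := (tendsto_rpow_mul_exp_neg_mul_atTop_nhds_zero _ 1 one_pos).const_mul K
  rw [mul_zero] at h1
  have h2 : ∀ᶠ x : ℝ in Filter.atTop, K * (x ^ (2 * k / c) * Real.exp (-1 * x)) ≤ 1 :=
    h1.eventually_le_const one_pos
  have h3 : Filter.Tendsto (fun n : ℕ => (n : ℝ) ^ (c / 2)) Filter.atTop Filter.atTop :=
    (tendsto_rpow_atTop (by positivity)).comp tendsto_natCast_atTop_atTop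
  filter_upwards [h3.eventually h2, h3.eventually_ge_atTop 2, Filter.eventually_ge_atTop 1]
    with n hn1 hn2 hn3
  have hn0 : (0 : ℝ) < n := by exact_mod_cast hn3
  set x := (n : ℝ) ^ (c / 2) with hx
  have e1 : x ^ (2 * k / c) = (n : ℝ) ^ k := by
    rw [hx, ← Real.rpow_mul hn0.le, ← Real.rpow_natCast]
    congr 1; field_simp
  have e2 : (n : ℝ) ^ c = x ^ 2 := by
    rw [hx, ← Real.rpow_natCast, ← Real.rpow_mul hn0.le]
    congr 1; push_cast; ring
  rw [e1] at hn1
  rw [e2]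
  calc K * (n : ℝ) ^ k * Real.exp (-x ^ 2)
      = (K * ((n : ℝ) ^ k * Real.exp (-1 * x))) * Real.exp (x - x ^ 2) := by
        have : Real.exp (-x ^ 2) = Real.exp (-1 * x) * Real.exp (x - x ^ 2) := by
          rw [← Real.exp_add]; ring_nf
        rw [this]; ring
    _ ≤ 1 * Real.exp (x - x ^ 2) := by gcongr
    _ ≤ Real.exp (-x) := by
        rw [one_mul, Real.exp_le_exp]; nlinarith

lemma ExpDecay.eventually_tail (C C' : ℝ) (hC : 0 < C) {s : ℝ} (hs : 0 < s) :
    ∀ᶠ n : ℕ in Filter.atTop, ∀ {Ω : Type*} [MeasurableSpace Ω] (P : Measure Ω)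
      [IsProbabilityMeasure P] (M : Ω → Matrix (Fin n) (Fin n) ℂ), ExpDecay P C C' M →
      ∀ i j, P.real {ω | (n : ℝ) ^ s < ‖M ω i j‖} ≤ Real.exp (-(n : ℝ) ^ (s / C)) := by
  have h3 : Filter.Tendsto (fun n : ℕ => (n : ℝ) ^ (s / C)) Filter.atTop Filter.atTop :=
    (tendsto_rpow_atTop (by positivity)).comp tendsto_natCast_atTop_atTop
  filter_upwards [h3.eventually_ge_atTop C'] with n hn Ω _ P _ M hM i j
  refine le_trans (measureReal_mono fun ω hω => ?_) (hM i j _ hn)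
  simp only [Set.mem_ofPred_eq] at hω ⊢
  rw [← Real.rpow_mul (by positivity), div_mul_cancel₀ _ hC.ne']
  exact hω.le

/-- A local law: with overwhelming probability the diagonal entries, and a given off-diagonal entry,
of the resolvent at the edge scale are bounded. -/
theorem exists_local_law (C C' : ℝ) (hC : 0 < C) (hC' : 0 < C') :
    ∃ c : ℝ, 0 < c ∧ ∃ N₀ : ℕ, ∀ n : ℕ, N₀ ≤ n → ∀ {Ω : Type*} [MeasurableSpace Ω] (P : Measure Ω)
      (M : Ω → Matrix (Fin n) (Fin n) ℂ), IsWigner P M → ExpDecay P C C' M →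
      ∀ E : ℝ, |E| ≤ 3 → ∀ a b : Fin n,
      P.real {ω | ¬ ((∀ i, ‖green (normalized (M ω)) ⟨E, edgeScale n⟩ i i‖ ≤ 11) ∧
        ‖green (normalized (M ω)) ⟨E, edgeScale n⟩ a b‖ ≤ 11 ∧
        ‖green (normalized (M ω)) ⟨E, edgeScale n⟩ b a‖ ≤ 11)} ≤ Real.exp (-(n : ℝ) ^ c) := by
  obtain ⟨c₀, hc₀, N₁, hrows⟩ := exists_row_tail C C' hC'
  set c₂ : ℝ := min c₀ (1 / 3 / C) with hc₂
  have hc₂pos : 0 < c₂ := lt_min hc₀ (by positivity)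
  have hev1 : ∀ᶠ n : ℕ in Filter.atTop, (7000 : ℝ) ≤ (n : ℝ) ^ (1 / 12 : ℝ) :=
    ((tendsto_rpow_atTop (by norm_num)).comp tendsto_natCast_atTop_atTop).eventually_ge_atTop _
  obtain ⟨N₀, hN₀⟩ := Filter.eventually_atTop.1 ((((hev1.and
    (eventually_mul_pow_exp_le 45 3 hc₂pos)).and (ExpDecay.eventually_tail C C' hC
      (s := 1 / 3) (by norm_num))).and (Filter.eventually_ge_atTop N₁)).and
      (Filter.eventually_ge_atTop 1))
  refine ⟨c₂ / 2, by positivity, N₀, fun n hn {Ω} _ P M hM hdec E hE a b => ?_⟩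
  obtain ⟨⟨⟨⟨h7000, hfin⟩, hent⟩, hnN₁⟩, hn1⟩ := hN₀ n hn
  have hP := hM.isProbabilityMeasure
  have hnr : (1 : ℝ) ≤ n := by exact_mod_cast hn1
  have hn0 : (0 : ℝ) < n := by linarith
  have hrow := hrows n hnN₁ P M hM hdec
  have hent' := hent P M hdec
  set η := edgeScale n with hη
  have hηpos : 0 < η := by rw [hη, edgeScale]; positivity
  have hη1 : η ≤ 1 := by
    rw [hη, edgeScale]; exact Real.rpow_le_one_of_one_le_of_nonpos hnr (by norm_num)
  set N : ℕ := ⌈40 / η ^ 2⌉₊ with hN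
  have hN1 : 40 / η ^ 2 ≤ N := Nat.le_ceil _
  have hη2 : 1 / η ^ 2 ≤ (n : ℝ) ^ 2 := by
    have : 1 / η ^ 2 = (n : ℝ) ^ (4 / 3 : ℝ) := by
      rw [hη, edgeScale, ← Real.rpow_natCast, ← Real.rpow_mul hn0.le, one_div,
        ← Real.rpow_neg hn0.le]
      norm_num
    rw [this, ← Real.rpow_natCast]
    exact Real.rpow_le_rpow_of_exponent_le hnr (by norm_num)
  have hN2 : (N : ℝ) + 1 ≤ 42 * (n : ℝ) ^ 2 := by
    have h1 := Nat.ceil_lt_add_one (show 0 ≤ 40 / η ^ 2 by positivity)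
    have h2 : 40 / η ^ 2 = 40 * (1 / η ^ 2) := by ring
    have h3 : (1 : ℝ) ≤ (n : ℝ) ^ 2 := one_le_pow₀ hnr
    have h4 : (N : ℝ) < 40 / η ^ 2 + 1 := h1
    linarith
  set ζ : ℕ → ℂ := fun l => ⟨E, 1 - (1 - η) * (l / N)⟩ with hζ
  set Bdev : ℕ → Fin n → Set Ω := fun l i => {ω | (n : ℝ) ^ (1 / 6 : ℝ) / (n : ℝ) ^ 2 *
        frobSq (green (zeroed (normalized (M ω)) i) (ζ l)) <
          ‖schurDev (normalized (M ω)) (ζ l) i‖ ^ 2} with hBdev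
  set Bdiag : Fin n → Set Ω := fun i => {ω | (n : ℝ) ^ (1 / 3 : ℝ) < ‖M ω i i‖} with hBdiag
  set Bcol : Set Ω := {ω | (n : ℝ) ^ (1 / 6 : ℝ) / n *
        ∑ l, ‖green (zeroed (normalized (M ω)) a) ⟨E, η⟩ b l‖ ^ 2 <
        ‖∑ l, green (zeroed (normalized (M ω)) a) ⟨E, η⟩ b l *
          offCol (normalized (M ω)) a l‖ ^ 2} with hBcol
  set Brow : Set Ω := {ω | (n : ℝ) ^ (1 / 6 : ℝ) / n *
        ∑ l, ‖green (zeroed (normalized (M ω)) a) ⟨E, η⟩ l b‖ ^ 2 <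
        ‖∑ l, green (zeroed (normalized (M ω)) a) ⟨E, η⟩ l b *
          star (offCol (normalized (M ω)) a l)‖ ^ 2} with hBrow
  -- Union over at most `42 n²` grid points and `n` indices, the `n` diagonal entries and the two
  -- linear forms: at most `45 n³` events in all.
  have hsub : {ω | ¬ ((∀ i, ‖green (normalized (M ω)) ⟨E, η⟩ i i‖ ≤ 11) ∧
        ‖green (normalized (M ω)) ⟨E, η⟩ a b‖ ≤ 11 ∧
        ‖green (normalized (M ω)) ⟨E, η⟩ b a‖ ≤ 11)} ⊆
      ((⋃ l ∈ Finset.range (N + 1), ⋃ i ∈ (Finset.univ : Finset (Fin n)), Bdev l i) ∪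
        ⋃ i ∈ (Finset.univ : Finset (Fin n)), Bdiag i) ∪ (Bcol ∪ Brow) := by
    intro ω hω
    by_contra hnot
    simp only [Set.mem_union, Set.mem_iUnion, Finset.mem_range, Finset.mem_univ, not_or, not_exists,
      exists_prop, true_and, not_and] at hnot
    obtain ⟨⟨hn1', hn2'⟩, hn3, hn4⟩ := hnot
    apply hω
    refine norm_green_le_of_good hn1 h7000 (normalized_isHermitian (hM.isHermitian ω)) hE hN1
      (fun i => ?_) (fun l hl i => ?_) ?_ ?_
    · have h1 : ‖M ω i i‖ ≤ (n : ℝ) ^ (1 / 3 : ℝ) := not_lt.1 (hn2' i)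
      rw [normalized, Matrix.smul_apply, smul_eq_mul, norm_mul, Complex.norm_real,
        Real.norm_of_nonneg (by positivity), Real.sqrt_eq_rpow, ← Real.rpow_neg hn0.le]
      calc (n : ℝ) ^ (-(1 / 2) : ℝ) * ‖M ω i i‖
          ≤ (n : ℝ) ^ (-(1 / 2) : ℝ) * (n : ℝ) ^ (1 / 3 : ℝ) := by gcongr
        _ = (n : ℝ) ^ (-(1 / 6) : ℝ) := by rw [← Real.rpow_add hn0]; norm_num
    · exact not_lt.1 (hn1' l (by omega) i)
    · exact not_lt.1 hn3
    · exact not_lt.1 hn4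
  have hε : ∀ e : ℝ, c₂ ≤ e → Real.exp (-(n : ℝ) ^ e) ≤ Real.exp (-(n : ℝ) ^ c₂) := by
    intro e he
    rw [Real.exp_le_exp, neg_le_neg_iff]
    exact Real.rpow_le_rpow_of_exponent_le hnr he
  set ε := Real.exp (-(n : ℝ) ^ c₂) with hεdef
  have hε0 : 0 ≤ ε := Real.exp_nonneg _
  have hζim : ∀ l ∈ Finset.range (N + 1), 0 < (ζ l).im := by
    intro l hl
    have hl' : l ≤ N := by simpa [Nat.lt_succ_iff] using hl
    have hNpos : (0 : ℝ) < N := lt_of_lt_of_le (by positivity) hN1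
    have h1 : (l : ℝ) / N ≤ 1 := by
      rw [div_le_one hNpos]; exact_mod_cast hl'
    have h2 : (1 - η) * ((l : ℝ) / N) ≤ (1 - η) * 1 :=
      mul_le_mul_of_nonneg_left h1 (by linarith)
    simp only [hζ]; linarith
  refine (measureReal_mono hsub).trans ?_
  calc _ ≤ (∑ _l ∈ Finset.range (N + 1), ∑ _i ∈ (Finset.univ : Finset (Fin n)), ε +
          ∑ _i ∈ (Finset.univ : Finset (Fin n)), ε) + (ε + ε) := by
        refine (measureReal_union_le _ _).trans (add_le_add ?_ ?_)
        · refine (measureReal_union_le _ _).trans (add_le_add ?_ ?_)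
          · refine (measureReal_biUnion_finset_le _ _).trans (Finset.sum_le_sum fun l hl => ?_)
            refine (measureReal_biUnion_finset_le _ _).trans (Finset.sum_le_sum fun i _ => ?_)
            exact ((hrow (ζ l) (hζim l hl) i).1).trans (hε _ (min_le_left _ _))
          · refine (measureReal_biUnion_finset_le _ _).trans (Finset.sum_le_sum fun i _ => ?_)
            exact (hent' i i).trans (hε _ (min_le_right _ _))
        · refine (measureReal_union_le _ _).trans (add_le_add ?_ ?_)
          · exact (((hrow ⟨E, η⟩ hηpos a).2 b).1).trans (hε _ (min_le_left _ _))
          · exact (((hrow ⟨E, η⟩ hηpos a).2 b).2).trans (hε _ (min_le_left _ _))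
    _ = (((N : ℝ) + 1) * n + n + 2) * ε := by
        simp only [Finset.sum_const, Finset.card_range, Finset.card_univ, Fintype.card_fin,
          nsmul_eq_mul]
        push_cast; ring
    _ ≤ 45 * (n : ℝ) ^ 3 * ε := by
        refine mul_le_mul_of_nonneg_right ?_ hε0
        have h1 : ((N : ℝ) + 1) * n ≤ 42 * (n : ℝ) ^ 2 * n := by gcongr
        have h2 : (n : ℝ) ≤ (n : ℝ) ^ 3 := le_self_pow₀ hnr (by norm_num)
        have h3 : (1 : ℝ) ≤ (n : ℝ) ^ 3 := one_le_pow₀ hnr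
        nlinarith
    _ ≤ _ := hfin

end LocalLaw


/-! ### Resolvent expansion along a perturbation of one entry -/

section Expansion

open Matrix

variable {ι : Type*} [Fintype ι] [DecidableEq ι]

/-- `V` is supported on `T × T`. -/
def SupportedOn (T : Finset ι) (V : Matrix ι ι ℂ) : Prop := ∀ i j, (i ∉ T ∨ j ∉ T) → V i j = 0

variable {T : Finset ι} {A V R : Matrix ι ι ℂ} {z : ℂ} {L : ℝ}

omit [DecidableEq ι] in
lemma norm_sum_supported_le {f : ι → ℂ} {c : ℝ} (hT : T.card ≤ 2) (hf : ∀ i ∉ T, f i = 0)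
    (hc : 0 ≤ c) (h : ∀ i ∈ T, ‖f i‖ ≤ c) : ‖∑ i, f i‖ ≤ 2 * c := by
  rw [← Finset.sum_subset (Finset.subset_univ T) fun i _ hi => hf i hi]
  refine (norm_sum_le _ _).trans ((Finset.sum_le_sum h).trans ?_)
  rw [Finset.sum_const, nsmul_eq_mul]
  gcongr
  exact_mod_cast hT

omit [DecidableEq ι] in
lemma SupportedOn.mul_mul {U : Matrix ι ι ℂ} (hU : SupportedOn T U) (hV : SupportedOn T V) :
    SupportedOn T (U * R * V) := by
  intro i j hij
  rw [mul_apply]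
  refine Finset.sum_eq_zero fun k _ => ?_
  rcases hij with hi | hj
  · rw [mul_apply, Finset.sum_eq_zero fun l _ => by rw [hU i l (Or.inl hi), zero_mul], zero_mul]
  · rw [hV k j (Or.inr hj), mul_zero]

-- Sums over the support have at most two terms, so multiplying by `R` and then by `V` costs `2L ·
-- 2`, whatever the dimension.
omit [DecidableEq ι] in
lemma norm_mul_mul_supported_le {U : Matrix ι ι ℂ} (hT : T.card ≤ 2) (hU : SupportedOn T U)
    (hV : SupportedOn T V) {u : ℝ} (hu0 : 0 ≤ u) (hL : 0 ≤ L)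
    (hu : ∀ i ∈ T, ∀ j ∈ T, ‖U i j‖ ≤ u) (hV1 : ∀ i j, ‖V i j‖ ≤ 1)
    (hR : ∀ i ∈ T, ∀ j ∈ T, ‖R i j‖ ≤ L) :
    ∀ i ∈ T, ∀ j ∈ T, ‖(U * R * V) i j‖ ≤ u * (4 * L) := by
  intro i hi j hj
  have h1 : ∀ k ∈ T, ‖(U * R) i k‖ ≤ 2 * (u * L) := by
    intro k hk
    rw [mul_apply]
    refine norm_sum_supported_le hT (fun l hl => by rw [hU i l (Or.inr hl), zero_mul])
      (by positivity) fun l hl => ?_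
    rw [norm_mul]
    exact mul_le_mul (hu i hi l hl) (hR l hl k hk) (norm_nonneg _) hu0
  rw [mul_apply]
  refine (norm_sum_supported_le (c := 2 * (u * L)) hT
    (fun k hk => by rw [hV k j (Or.inl hk), mul_zero]) (by positivity) fun k hk => ?_).trans
    (le_of_eq (by ring))
  rw [norm_mul]
  calc _ ≤ 2 * (u * L) * 1 := mul_le_mul (h1 k hk) (hV1 k j) (norm_nonneg _) (by positivity)
    _ = _ := mul_one _

omit [DecidableEq ι] in
lemma norm_trace_mul_supported_le {U W : Matrix ι ι ℂ} (hT : T.card ≤ 2) (hU : SupportedOn T U)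
    {u w : ℝ} (hu0 : 0 ≤ u) (hw0 : 0 ≤ w) (hu : ∀ i ∈ T, ∀ j ∈ T, ‖U i j‖ ≤ u)
    (hW : ∀ i ∈ T, ∀ j ∈ T, ‖W i j‖ ≤ w) : ‖(U * W).trace‖ ≤ 4 * (u * w) := by
  rw [trace]
  refine (norm_sum_supported_le (c := 2 * (u * w)) hT (fun i hi => ?_) (by positivity)
    fun i hi => ?_).trans (le_of_eq (by ring))
  · rw [diag_apply, mul_apply]
    exact Finset.sum_eq_zero fun l _ => by rw [hU i l (Or.inl hi), zero_mul]
  · rw [diag_apply, mul_apply]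
    refine norm_sum_supported_le hT (fun l hl => by rw [hU i l (Or.inr hl), zero_mul])
      (by positivity) fun l hl => ?_
    rw [norm_mul]
    exact mul_le_mul (hu i hi l hl) (hW l hl i hi) (norm_nonneg _) hu0

/-- The matrices `V (R V) ^ j` of the resolvent expansion. -/
def bornTerm (V R : Matrix ι ι ℂ) : ℕ → Matrix ι ι ℂ
  | 0 => V
  | j + 1 => bornTerm V R j * R * V

omit [DecidableEq ι] in
lemma bornTerm_supportedOn (hV : SupportedOn T V) (j : ℕ) : SupportedOn T (bornTerm V R j) := by
  induction j with
  | zero => exact hV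
  | succ j ih => exact ih.mul_mul hV

omit [DecidableEq ι] in
lemma norm_bornTerm_le (hT : T.card ≤ 2) (hV : SupportedOn T V) (hV1 : ∀ i j, ‖V i j‖ ≤ 1)
    (hL : 0 ≤ L) (hR : ∀ i ∈ T, ∀ j ∈ T, ‖R i j‖ ≤ L) (j : ℕ) :
    ∀ k ∈ T, ∀ l ∈ T, ‖bornTerm V R j k l‖ ≤ (4 * L) ^ j := by
  induction j with
  | zero => intro k _ l _; simpa [bornTerm] using hV1 k l
  | succ j ih =>
    rw [pow_succ]
    exact norm_mul_mul_supported_le hT (bornTerm_supportedOn hV j) hV (by positivity) hL ih hV1 hR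

omit [Fintype ι] [DecidableEq ι] in
lemma add_smul_isHermitian (hA : A.IsHermitian) (hV : V.IsHermitian) (s : ℝ) :
    (A + (s : ℂ) • V).IsHermitian := by
  refine hA.add ?_
  ext i j
  simp only [conjTranspose_apply, Matrix.smul_apply, smul_eq_mul, star_mul', RCLike.star_def,
    Complex.conj_ofReal]
  congr 1
  exact congrFun (congrFun hV i) j

lemma green_add_smul (hA : A.IsHermitian) (hV : V.IsHermitian) (hz : 0 < z.im) (s : ℝ) :
    green (A + (s : ℂ) • V) z =
      green A z - (s : ℂ) • (green A z * V * green (A + (s : ℂ) • V) z) := by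
  have h := green_sub_green hA (add_smul_isHermitian hA hV s) hz.ne' hz.ne'
  simp only [sub_self, zero_smul, add_zero, add_sub_cancel_left] at h
  rw [mul_smul_comm, smul_mul_assoc] at h
  rw [← h]; abel

lemma mul_green_add_smul (hA : A.IsHermitian) (hV : V.IsHermitian) (hz : 0 < z.im) (s : ℝ) (J : ℕ) :
    V * green (A + (s : ℂ) • V) z =
      ∑ j ∈ Finset.range J, (-(s : ℂ)) ^ j • (bornTerm V (green A z) j * green A z) +
        (-(s : ℂ)) ^ J • (bornTerm V (green A z) J * green (A + (s : ℂ) • V) z) := by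
  induction J with
  | zero => simp [bornTerm]
  | succ J ih =>
    rw [ih, Finset.sum_range_succ, add_assoc]
    congr 1
    conv_lhs => rw [green_add_smul hA hV hz s]
    rw [mul_sub, smul_sub, mul_smul_comm, smul_smul, bornTerm, pow_succ, ← mul_assoc, ← mul_assoc,
      sub_eq_add_neg, ← neg_smul]
    congr 2
    ring

/-- Cyclicity of the trace brings the two outer resolvents together. Every other factor lives on the
block, and the only sum over all indices is inside the product of two resolvents. -/
lemma trace_green_add_smul (hA : A.IsHermitian) (hV : V.IsHermitian) (hz : 0 < z.im) (s : ℝ)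
    (J : ℕ) :
    (green (A + (s : ℂ) • V) z).trace - (green A z).trace =
      ∑ j ∈ Finset.range J, (-(s : ℂ)) ^ (j + 1) *
        (bornTerm V (green A z) j * (green A z * green A z)).trace +
        (-(s : ℂ)) ^ (J + 1) *
          (bornTerm V (green A z) J * (green (A + (s : ℂ) • V) z * green A z)).trace := by
  have h1 : (green (A + (s : ℂ) • V) z).trace - (green A z).trace =
      -(s : ℂ) * (V * green (A + (s : ℂ) • V) z * green A z).trace := by
    conv_lhs => rw [green_add_smul hA hV hz s]
    rw [trace_sub, trace_smul, mul_assoc, trace_mul_comm, smul_eq_mul]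
    ring
  rw [h1, mul_green_add_smul hA hV hz s J, add_mul, trace_add, mul_add, Finset.sum_mul, trace_sum,
    Finset.mul_sum]
  congr 1
  · refine Finset.sum_congr rfl fun j _ => ?_
    rw [smul_mul_assoc, trace_smul, smul_eq_mul, mul_assoc (bornTerm V (green A z) j)]
    ring
  · rw [smul_mul_assoc, trace_smul, smul_eq_mul, mul_assoc (bornTerm V (green A z) J)]
    ring

/-- The Ward identity bounds a sum over all indices by two diagonal entries at the cost of `1 / Im
z`, which the prefactor `η` of `B` later cancels. -/
lemma norm_green_mul_green_le {B : Matrix ι ι ℂ} (hA : A.IsHermitian) (hB : B.IsHermitian)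
    (hz : 0 < z.im) {k : ℝ} {i j : ι} (hi : ‖green A z i i‖ ≤ k) (hj : ‖green B z j j‖ ≤ k) :
    ‖(green A z * green B z) i j‖ ≤ k / z.im := by
  rw [mul_apply]
  refine (norm_sum_le _ _).trans ?_
  simp only [norm_mul]
  refine (sum_norm_mul_norm_le hA hB hz hz i j).trans ?_
  have h1 : (green A z i i).im ≤ k := ((le_abs_self _).trans (Complex.abs_im_le_norm _)).trans hi
  have h2 : (green B z j j).im ≤ k := ((le_abs_self _).trans (Complex.abs_im_le_norm _)).trans hj
  have h3 : (green A z i i).im / z.im ≤ k / z.im := by gcongr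
  have h4 : (green B z j j).im / z.im ≤ k / z.im := by gcongr
  linarith

/-- The trace of the resolvent is analytic along a perturbation supported on a block where the
entries of the resolvent are bounded. -/
lemma exists_trace_expansion (hT : T.card ≤ 2) (hA : A.IsHermitian) (hVh : V.IsHermitian)
    (hV : SupportedOn T V) (hV1 : ∀ i j, ‖V i j‖ ≤ 1) (hz : 0 < z.im) (hL : 0 ≤ L)
    (hR : ∀ i ∈ T, ∀ j ∈ T, ‖green A z i j‖ ≤ L) :
    ∃ c : ℕ → ℝ, c 0 = z.im * (green A z).trace.im ∧ (∀ j, |c (j + 1)| ≤ (4 * L) ^ (j + 1)) ∧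
      ∀ s : ℝ, 4 * L * |s| < 1 →
        HasSum (fun j => c j * s ^ j) (z.im * (green (A + (s : ℂ) • V) z).trace.im) := by
  set w : ℕ → ℂ := fun j => (bornTerm V (green A z) j * (green A z * green A z)).trace with hw
  set c : ℕ → ℝ := fun j => Nat.casesOn j (z.im * (green A z).trace.im)
    (fun j => z.im * ((-1) ^ (j + 1) * (w j).im)) with hc
  have hc1 : ∀ j, c (j + 1) = z.im * ((-1) ^ (j + 1) * (w j).im) := fun j => rfl
  have hb : ∀ j, |c (j + 1)| ≤ (4 * L) ^ (j + 1) := by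
    intro j
    have h1 : ‖w j‖ ≤ 4 * ((4 * L) ^ j * (L / z.im)) :=
      norm_trace_mul_supported_le hT (bornTerm_supportedOn hV j) (by positivity) (by positivity)
        (norm_bornTerm_le hT hV hV1 hL hR j)
        (fun k hk l hl => norm_green_mul_green_le hA hA hz (hR k hk k hk) (hR l hl l hl))
    rw [hc1, abs_mul, abs_mul, abs_pow, abs_neg, abs_one, one_pow, one_mul, abs_of_pos hz]
    calc z.im * |(w j).im| ≤ z.im * (4 * ((4 * L) ^ j * (L / z.im))) := by
          gcongr; exact (Complex.abs_im_le_norm _).trans h1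
      _ = _ := by field_simp; ring
  refine ⟨c, rfl, hb, fun s hs => ?_⟩
  have hx0 : 0 ≤ 4 * L * |s| := by positivity
  have hsum1 : Summable fun j => c (j + 1) * s ^ (j + 1) := by
    refine Summable.of_norm_bounded
      (g := fun j => (4 * L * |s|) ^ (j + 1)) ?_ fun j => ?_
    · exact (summable_nat_add_iff 1).2 (summable_geometric_of_lt_one hx0 hs)
    · rw [Real.norm_eq_abs, abs_mul, abs_pow, mul_pow]
      gcongr
      exact hb j
  have hs0 : Summable fun j => c j * s ^ j :=
    (summable_nat_add_iff 1 (f := fun j => c j * s ^ j)).1 hsum1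
  rw [hs0.hasSum_iff_tendsto_nat, ← Filter.tendsto_add_atTop_iff_nat 1]
  have hpart : ∀ J, ∑ j ∈ Finset.range (J + 1), c j * s ^ j =
      z.im * (green (A + (s : ℂ) • V) z).trace.im - z.im * ((-(s : ℂ)) ^ (J + 1) *
          (bornTerm V (green A z) J * (green (A + (s : ℂ) • V) z * green A z)).trace).im := by
    intro J
    have h := congrArg Complex.im (trace_green_add_smul hA hVh hz s J)
    rw [Complex.sub_im, Complex.add_im, Complex.im_sum] at h
    rw [Finset.sum_range_succ']
    have e : ∀ j, c (j + 1) * s ^ (j + 1) = z.im * ((-(s : ℂ)) ^ (j + 1) * w j).im := by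
      intro j
      have : (-(s : ℂ)) ^ (j + 1) = (((-1) ^ (j + 1) * s ^ (j + 1) : ℝ) : ℂ) := by
        push_cast; rw [← mul_pow, neg_one_mul]
      rw [hc1, this, Complex.im_ofReal_mul]; ring
    simp only [e, pow_zero, mul_one]
    rw [← Finset.mul_sum]
    have e0 : c 0 = z.im * (green A z).trace.im := rfl
    rw [e0]
    linear_combination (-z.im) * h
  simp only [hpart]
  -- The remainder contains the perturbed resolvent, for which the trivial bound `1 / Im z` is used;
  -- it does not depend on `J`, so the geometric factor wins.
  have hrem : Filter.Tendsto (fun J : ℕ => z.im * ((-(s : ℂ)) ^ (J + 1) *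
      (bornTerm V (green A z) J * (green (A + (s : ℂ) • V) z * green A z)).trace).im)
      Filter.atTop (nhds 0) := by
    refine squeeze_zero_norm (a := fun J : ℕ => (z.im * |s| * (4 * (1 / z.im / z.im))) *
      (4 * L * |s|) ^ J) (fun J => ?_) ?_
    · have h1 : ‖(bornTerm V (green A z) J * (green (A + (s : ℂ) • V) z * green A z)).trace‖ ≤
          4 * ((4 * L) ^ J * (1 / z.im / z.im)) :=
        norm_trace_mul_supported_le hT (bornTerm_supportedOn hV J) (by positivity) (by positivity)
          (norm_bornTerm_le hT hV hV1 hL hR J)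
          (fun k hk l hl => norm_green_mul_green_le (add_smul_isHermitian hA hVh s) hA hz
            (norm_green_diag_le (add_smul_isHermitian hA hVh s) hz k) (norm_green_diag_le hA hz l))
      rw [norm_mul, Real.norm_of_nonneg hz.le, Real.norm_eq_abs]
      calc _ ≤ z.im * (|s| ^ (J + 1) * (4 * ((4 * L) ^ J * (1 / z.im / z.im)))) := by
            gcongr
            refine (Complex.abs_im_le_norm _).trans ?_
            rw [norm_mul, norm_pow, norm_neg, Complex.norm_real, Real.norm_eq_abs]
            gcongr
        _ = _ := by rw [mul_pow (4 * L)]; ring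
    · have := (tendsto_pow_atTop_nhds_zero_of_lt_one hx0 hs).const_mul
        (z.im * |s| * (4 * (1 / z.im / z.im)))
      rwa [mul_zero] at this
  simpa using hrem.const_sub (z.im * (green (A + (s : ℂ) • V) z).trace.im)

end Expansion

/-! ### Powers of power series -/

section PowerSeries

/-- Powers of a power series with finite weighted `ℓ¹` norm. -/
lemma exists_pow_expansion {c : ℕ → ℝ} {f : ℝ → ℝ} {ρ S : ℝ} (hρ : 0 ≤ ρ)
    (hc : Summable fun j => |c j| * ρ ^ j) (hS : ∑' j, |c j| * ρ ^ j ≤ S)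
    (hf : ∀ s, |s| ≤ ρ → HasSum (fun j => c j * s ^ j) (f s)) (k : ℕ) :
    ∃ d : ℕ → ℝ, (Summable fun j => |d j| * ρ ^ j) ∧ ∑' j, |d j| * ρ ^ j ≤ S ^ k ∧
      ∀ s, |s| ≤ ρ → HasSum (fun j => d j * s ^ j) (f s ^ k) := by
  have hS0 : 0 ≤ S := (tsum_nonneg fun j => by positivity).trans hS
  induction k with
  | zero =>
    refine ⟨fun j => if j = 0 then 1 else 0, ?_, ?_, fun s _ => ?_⟩
    · refine summable_of_ne_finset_zero (s := {0}) fun j hj => ?_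
      simp only [Finset.mem_singleton] at hj
      simp [hj]
    · rw [tsum_eq_single 0 fun j hj => by simp [hj]]
      simp
    · have := hasSum_single (f := fun j : ℕ => (if j = 0 then (1 : ℝ) else 0) * s ^ j) 0
        fun j hj => by simp [hj]
      simpa using this
  | succ k ih =>
    obtain ⟨d, hd1, hd2, hd3⟩ := ih
    have habs : ∀ x : ℕ → ℝ, (Summable fun j => |x j| * ρ ^ j) →
        ∀ s, |s| ≤ ρ → Summable fun j => ‖x j * s ^ j‖ := by
      intro x hx s hs
      refine Summable.of_nonneg_of_le (fun j => norm_nonneg _) (fun j => ?_) hx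
      rw [Real.norm_eq_abs, abs_mul, abs_pow]
      gcongr
    -- Cauchy product with the previous power: the weighted `ℓ¹` norm is submultiplicative.
    have hprod := (summable_norm_sum_mul_antidiagonal_of_summable_norm
      (f := fun j => |d j| * ρ ^ j) (g := fun j => |c j| * ρ ^ j) hd1.norm hc.norm).of_norm
    have htsum := tsum_mul_tsum_eq_tsum_sum_antidiagonal_of_summable_norm
      (f := fun j => |d j| * ρ ^ j) (g := fun j => |c j| * ρ ^ j) hd1.norm hc.norm
    have hle : ∀ m : ℕ, |∑ p ∈ Finset.HasAntidiagonal.antidiagonal m, d p.1 * c p.2| * ρ ^ m ≤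
        ∑ p ∈ Finset.HasAntidiagonal.antidiagonal m, (|d p.1| * ρ ^ p.1) * (|c p.2| * ρ ^ p.2) := by
      intro m
      calc _ ≤ (∑ p ∈ Finset.HasAntidiagonal.antidiagonal m, |d p.1 * c p.2|) * ρ ^ m := by
            gcongr; exact Finset.abs_sum_le_sum_abs _ _
        _ = _ := by
            rw [Finset.sum_mul]
            refine Finset.sum_congr rfl fun p hp => ?_
            rw [← Finset.HasAntidiagonal.mem_antidiagonal.1 hp, pow_add, abs_mul]; ring
    have hsummable : Summable fun m : ℕ => |∑ p ∈ Finset.HasAntidiagonal.antidiagonal m, d p.1 * c p.2| * ρ ^ m :=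
      Summable.of_nonneg_of_le (fun m => by positivity) hle hprod
    refine ⟨fun m : ℕ => ∑ p ∈ Finset.HasAntidiagonal.antidiagonal m, d p.1 * c p.2, hsummable, ?_, fun s hs => ?_⟩
    · refine (hsummable.tsum_le_tsum hle hprod).trans ?_
      rw [← htsum, pow_succ]
      exact mul_le_mul hd2 hS (tsum_nonneg fun j => by positivity) (by positivity)
    · have h1 := habs d hd1 s hs
      have h2 := habs c hc s hs
      have h3 := (summable_norm_sum_mul_antidiagonal_of_summable_norm h1 h2).of_norm.hasSum
      rw [← tsum_mul_tsum_eq_tsum_sum_antidiagonal_of_summable_norm h1 h2, (hd3 s hs).tsum_eq,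
        (hf s hs).tsum_eq, ← pow_succ] at h3
      have e : ∀ m : ℕ, (∑ p ∈ Finset.HasAntidiagonal.antidiagonal m, d p.1 * c p.2) * s ^ m =
          ∑ p ∈ Finset.HasAntidiagonal.antidiagonal m, (d p.1 * s ^ p.1) * (c p.2 * s ^ p.2) := by
        intro m
        rw [Finset.sum_mul]
        refine Finset.sum_congr rfl fun p hp => ?_
        rw [← Finset.HasAntidiagonal.mem_antidiagonal.1 hp, pow_add]; ring
      simp only [e]
      exact h3

end PowerSeries


/-! ### Comparing two laws with matching moments -/

section Compare

lemma integrable_pow_of_le {μ : Measure ℝ} [IsProbabilityMeasure μ] {N : ℕ}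
    (h : Integrable (fun t => |t| ^ N) μ) {j : ℕ} (hj : j ≤ N) :
    Integrable (fun t : ℝ => t ^ j) μ := by
  refine ((integrable_const (1 : ℝ)).add h).mono' (by fun_prop) (ae_of_all _ fun t => ?_)
  rw [Real.norm_eq_abs, abs_pow, Pi.add_apply]
  rcases le_total |t| 1 with h1 | h1
  · have := pow_le_one₀ (abs_nonneg t) h1 (n := j)
    have : 0 ≤ |t| ^ N := by positivity
    linarith
  · have := pow_le_pow_right₀ h1 hj
    linarith

lemma measurableSet_abs_le (τ : ℝ) : MeasurableSet {t : ℝ | |t| ≤ τ} :=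
  measurableSet_le (by fun_prop) measurable_const

variable {φ : ℝ → ℝ} {d : ℕ → ℝ} {τ D : ℝ}

/-- A factor `(|t| / τ)^(m+1)` comes out of each term of the tail; what is left is part of the
weighted norm. -/
lemma abs_sub_taylor_le (hτ : 0 < τ) (hd : Summable fun j => |d j| * τ ^ j)
    (hD : ∑' j, |d j| * τ ^ j ≤ D) {t x : ℝ} (ht : |t| ≤ τ) (hx : HasSum (fun j => d j * t ^ j) x)
    (m : ℕ) : |x - ∑ j ∈ Finset.range (m + 1), d j * t ^ j| ≤ D / τ ^ (m + 1) * |t| ^ (m + 1) := by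
  have h1 := (hasSum_nat_add_iff' (m + 1)).2 hx
  have h2 := (summable_nat_add_iff (m + 1)).2 hd
  have hb : ∀ j, ‖d (j + (m + 1)) * t ^ (j + (m + 1))‖ ≤
      |t| ^ (m + 1) / τ ^ (m + 1) * (|d (j + (m + 1))| * τ ^ (j + (m + 1))) := by
    intro j
    rw [Real.norm_eq_abs, abs_mul, abs_pow, pow_add |t| j, pow_add τ j, div_mul_eq_mul_div,
      le_div_iff₀ (by positivity)]
    have : |t| ^ j ≤ τ ^ j := by gcongr
    calc |d (j + (m + 1))| * (|t| ^ j * |t| ^ (m + 1)) * τ ^ (m + 1)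
        ≤ |d (j + (m + 1))| * (τ ^ j * |t| ^ (m + 1)) * τ ^ (m + 1) := by gcongr
      _ = _ := by ring
  rw [← h1.tsum_eq, ← Real.norm_eq_abs]
  refine (tsum_of_norm_bounded (h2.mul_left _).hasSum hb).trans ?_
  rw [tsum_mul_left]
  have h3 : ∑' j, |d (j + (m + 1))| * τ ^ (j + (m + 1)) ≤ D := by
    refine le_trans ?_ hD
    rw [← hd.sum_add_tsum_nat_add (m + 1)]
    exact le_add_of_nonneg_left (Finset.sum_nonneg fun j _ => by positivity)
  calc _ ≤ |t| ^ (m + 1) / τ ^ (m + 1) * D := by gcongr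
    _ = _ := by ring

/-- On `|t| ≤ τ` the function is replaced by its Taylor polynomial, whose integral is then extended
to the whole line so that only moments enter. The remainder costs the first error, the extension the
second. -/
lemma abs_setIntegral_sub_moments_le {μ : Measure ℝ} [IsProbabilityMeasure μ] (hφ : Measurable φ)
    {Φ : ℝ} (h0 : ∀ t, 0 ≤ φ t) (hΦ : ∀ t, φ t ≤ Φ)
    (hτ : 1 ≤ τ) (hd : Summable fun j => |d j| * τ ^ j)
    (hD : ∑' j, |d j| * τ ^ j ≤ D) (hexp : ∀ t, |t| ≤ τ → HasSum (fun j => d j * t ^ j) (φ t))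
    {m : ℕ} {K₁ δ : ℝ} (hint : Integrable (fun t => |t| ^ (m + 1)) μ)
    (hK : ∫ t, |t| ^ (m + 1) ∂μ ≤ K₁)
    (hδ : ∀ j ≤ m, ∫ t in {t : ℝ | |t| ≤ τ}ᶜ, |t| ^ j ∂μ ≤ δ) :
    |∫ t in {t : ℝ | |t| ≤ τ}, φ t ∂μ - ∑ j ∈ Finset.range (m + 1), d j * ∫ t, t ^ j ∂μ| ≤
      D * K₁ / τ ^ (m + 1) + D * δ := by
  set I : Set ℝ := {t : ℝ | |t| ≤ τ} with hI
  have hIm : MeasurableSet I := measurableSet_abs_le τ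
  have hτ0 : 0 < τ := by linarith
  have hD0 : 0 ≤ D := (tsum_nonneg fun j => by positivity).trans hD
  have hpow : ∀ j ≤ m, Integrable (fun t : ℝ => t ^ j) μ := fun j hj =>
    integrable_pow_of_le hint (by omega)
  have hδ0 : 0 ≤ δ := (integral_nonneg fun t => by positivity).trans (hδ 0 (Nat.zero_le _))
  have hφint : Integrable φ μ := (integrable_const Φ).mono' hφ.aestronglyMeasurable
    (ae_of_all _ fun t => by rw [Real.norm_of_nonneg (h0 t)]; exact hΦ t)
  have hpint : Integrable (fun t : ℝ => ∑ j ∈ Finset.range (m + 1), d j * t ^ j) μ :=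
    integrable_finsetSum _ fun j hj => (hpow j (by simpa [Nat.lt_succ_iff] using hj)).const_mul _
  have h1 : |∫ t in I, φ t ∂μ - ∫ t in I, ∑ j ∈ Finset.range (m + 1), d j * t ^ j ∂μ| ≤
      D * K₁ / τ ^ (m + 1) := by
    rw [← integral_sub hφint.integrableOn hpint.integrableOn, ← Real.norm_eq_abs]
    refine (norm_integral_le_integral_norm _).trans ?_
    calc ∫ t in I, ‖φ t - ∑ j ∈ Finset.range (m + 1), d j * t ^ j‖ ∂μ
        ≤ ∫ t in I, D / τ ^ (m + 1) * |t| ^ (m + 1) ∂μ := by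
          refine setIntegral_mono_on (hφint.sub hpint).norm.integrableOn
            (hint.const_mul _).integrableOn hIm fun t ht => ?_
          exact abs_sub_taylor_le hτ0 hd hD ht (hexp t ht) m
      _ ≤ ∫ t, D / τ ^ (m + 1) * |t| ^ (m + 1) ∂μ :=
          setIntegral_le_integral (hint.const_mul _) (ae_of_all _ fun t => by positivity)
      _ ≤ _ := by
          rw [integral_const_mul, mul_div_right_comm]; gcongr
  have h2 : ∫ t in I, ∑ j ∈ Finset.range (m + 1), d j * t ^ j ∂μ =
      ∑ j ∈ Finset.range (m + 1), d j * ∫ t, t ^ j ∂μ -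
        ∑ j ∈ Finset.range (m + 1), d j * ∫ t in Iᶜ, t ^ j ∂μ := by
    rw [integral_finsetSum _ fun j hj =>
      ((hpow j (by simpa [Nat.lt_succ_iff] using hj)).const_mul _).integrableOn,
      ← Finset.sum_sub_distrib]
    refine Finset.sum_congr rfl fun j hj => ?_
    rw [integral_const_mul, ← mul_sub,
      ← integral_add_compl hIm (hpow j (by simpa [Nat.lt_succ_iff] using hj)), add_sub_cancel_right]
  have h3 : |∑ j ∈ Finset.range (m + 1), d j * ∫ t in Iᶜ, t ^ j ∂μ| ≤ D * δ := by
    refine (Finset.abs_sum_le_sum_abs _ _).trans ?_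
    calc _ ≤ ∑ j ∈ Finset.range (m + 1), |d j| * τ ^ j * δ := by
          refine Finset.sum_le_sum fun j hj => ?_
          rw [abs_mul]
          have h4 : |∫ t in Iᶜ, t ^ j ∂μ| ≤ δ := by
            rw [← Real.norm_eq_abs]
            refine (norm_integral_le_integral_norm _).trans (le_trans (le_of_eq ?_)
              (hδ j (by simpa [Nat.lt_succ_iff] using hj)))
            simp only [Real.norm_eq_abs, abs_pow]
          have h5 : |d j| ≤ |d j| * τ ^ j :=
            le_mul_of_one_le_right (abs_nonneg _) (one_le_pow₀ hτ)
          exact mul_le_mul h5 h4 (abs_nonneg _) (by positivity)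
      _ = (∑ j ∈ Finset.range (m + 1), |d j| * τ ^ j) * δ := by rw [Finset.sum_mul]
      _ ≤ _ := by
          gcongr
          exact (hd.sum_le_tsum _ fun j _ => by positivity).trans hD
  have e : ∫ t in I, φ t ∂μ - ∑ j ∈ Finset.range (m + 1), d j * ∫ t, t ^ j ∂μ =
      (∫ t in I, φ t ∂μ - ∫ t in I, ∑ j ∈ Finset.range (m + 1), d j * t ^ j ∂μ) -
        ∑ j ∈ Finset.range (m + 1), d j * ∫ t in Iᶜ, t ^ j ∂μ := by
    rw [h2]; ring
  rw [e]
  exact (abs_sub _ _).trans (add_le_add h1 h3)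

/-- A probability measure on the line with bounded moments of order `m + 1` and small tails. -/
structure TailControl (μ : Measure ℝ) (m : ℕ) (K₁ τ δ : ℝ) : Prop where
  integrable : Integrable (fun t => |t| ^ (m + 1)) μ
  moment : ∫ t, |t| ^ (m + 1) ∂μ ≤ K₁
  tail : ∀ j ≤ m, ∫ t in {t : ℝ | |t| ≤ τ}ᶜ, |t| ^ j ∂μ ≤ δ

lemma TailControl.measure_compl_le {μ : Measure ℝ} [IsProbabilityMeasure μ] {m : ℕ} {K₁ δ : ℝ}
    (h : TailControl μ m K₁ τ δ) : μ.real {t : ℝ | |t| ≤ τ}ᶜ ≤ δ := by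
  simpa using h.tail 0 (Nat.zero_le _)

lemma integral_le_of_le_on {μ : Measure ℝ} [IsProbabilityMeasure μ] (hφ : Measurable φ)
    {Φ : ℝ} (h0 : ∀ t, 0 ≤ φ t) (hΦ : ∀ t, φ t ≤ Φ) {m : ℕ} {K₁ δ : ℝ}
    (h : TailControl μ m K₁ τ δ) :
    ∫ t, φ t ∂μ ≤ ∫ t in {t : ℝ | |t| ≤ τ}, φ t ∂μ + Φ * δ := by
  have hφint : Integrable φ μ := (integrable_const Φ).mono' hφ.aestronglyMeasurable
    (ae_of_all _ fun t => by rw [Real.norm_of_nonneg (h0 t)]; exact hΦ t)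
  have hΦ0 : 0 ≤ Φ := (h0 0).trans (hΦ 0)
  rw [← integral_add_compl (measurableSet_abs_le τ) hφint]
  gcongr
  calc ∫ t in {t : ℝ | |t| ≤ τ}ᶜ, φ t ∂μ ≤ ∫ _t in {t : ℝ | |t| ≤ τ}ᶜ, Φ ∂μ :=
        setIntegral_mono hφint.integrableOn (integrable_const _).integrableOn hΦ
    _ = Φ * μ.real {t : ℝ | |t| ≤ τ}ᶜ := by
        rw [setIntegral_const, smul_eq_mul, mul_comm]
    _ ≤ _ := by gcongr; exact h.measure_compl_le

/-- Two laws with matching moments integrate a function with a good power series expansion to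
almost the same value. -/
lemma integral_compare {μ μ' : Measure ℝ} [IsProbabilityMeasure μ] [IsProbabilityMeasure μ']
    (hφ : Measurable φ) {Φ : ℝ} (h0 : ∀ t, 0 ≤ φ t) (hΦ : ∀ t, φ t ≤ Φ) (hτ : 1 ≤ τ)
    (hd : Summable fun j => |d j| * τ ^ j) (hD : ∑' j, |d j| * τ ^ j ≤ D)
    (hexp : ∀ t, |t| ≤ τ → HasSum (fun j => d j * t ^ j) (φ t))
    (hlow : ∀ t, |t| ≤ τ → D ≤ 4 * φ t) {m : ℕ} {K₁ δ : ℝ} (h : TailControl μ m K₁ τ δ)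
    (h' : TailControl μ' m K₁ τ δ) (hδ : δ ≤ 1 / 2)
    (hmatch : ∀ j ≤ m, ∫ t, t ^ j ∂μ = ∫ t, t ^ j ∂μ') :
    ∫ t, φ t ∂μ ≤ (1 + 16 * K₁ / τ ^ (m + 1)) * ∫ t, φ t ∂μ' + Φ * (9 * δ) := by
  set I : Set ℝ := {t : ℝ | |t| ≤ τ} with hI
  have hIm : MeasurableSet I := measurableSet_abs_le τ
  have hτ0 : 0 < τ := by linarith
  have hδ0 : 0 ≤ δ := measureReal_nonneg.trans h.measure_compl_le
  have hK0 : 0 ≤ K₁ := (integral_nonneg fun t => by positivity).trans h.moment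
  have a1 := abs_setIntegral_sub_moments_le hφ h0 hΦ hτ hd hD hexp h.integrable h.moment h.tail
  have a2 := abs_setIntegral_sub_moments_le hφ h0 hΦ hτ hd hD hexp h'.integrable h'.moment h'.tail
  have hsum : ∑ j ∈ Finset.range (m + 1), d j * ∫ t, t ^ j ∂μ =
      ∑ j ∈ Finset.range (m + 1), d j * ∫ t, t ^ j ∂μ' :=
    Finset.sum_congr rfl fun j hj => by rw [hmatch j (by simpa [Nat.lt_succ_iff] using hj)]
  rw [hsum] at a1
  have hφint : Integrable φ μ' := (integrable_const Φ).mono' hφ.aestronglyMeasurable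
    (ae_of_all _ fun t => by rw [Real.norm_of_nonneg (h0 t)]; exact hΦ t)
  -- `μ'` has mass at least `1/2` on the region where `φ ≥ D / 4`. This turns the Taylor error,
  -- proportional to `D`, into a relative one.
  have hDlow : D ≤ 8 * ∫ t, φ t ∂μ' := by
    have hhalf : 1 / 2 ≤ μ'.real I := by
      have := probReal_compl_eq_one_sub (μ := μ') hIm
      have := h'.measure_compl_le
      linarith
    have hD0 : 0 ≤ D := (tsum_nonneg fun j => by positivity).trans hD
    calc D ≤ 2 * (μ'.real I * D) := by nlinarith
      _ = 2 * ∫ _t in I, D ∂μ' := by rw [setIntegral_const, smul_eq_mul]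
      _ ≤ 2 * ∫ t in I, 4 * φ t ∂μ' :=
          mul_le_mul_of_nonneg_left (setIntegral_mono_on (integrable_const _).integrableOn
            (hφint.const_mul _).integrableOn hIm hlow) (by norm_num)
      _ = 8 * ∫ t in I, φ t ∂μ' := by rw [integral_const_mul]; ring
      _ ≤ 8 * ∫ t, φ t ∂μ' := mul_le_mul_of_nonneg_left
          (setIntegral_le_integral hφint (ae_of_all _ h0)) (by norm_num)
  have hDΦ : D ≤ 4 * Φ := (hlow 0 (by simpa using hτ0.le)).trans (by linarith [hΦ 0])
  have hI' : ∫ t in I, φ t ∂μ' ≤ ∫ t, φ t ∂μ' := setIntegral_le_integral hφint (ae_of_all _ h0)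
  have b1 := integral_le_of_le_on hφ h0 hΦ h
  have b2 := (abs_le.1 a1).2
  have b3 := (abs_le.1 a2).1
  have b4 : D * K₁ / τ ^ (m + 1) ≤ 8 * K₁ / τ ^ (m + 1) * ∫ t, φ t ∂μ' := by
    calc D * K₁ / τ ^ (m + 1) ≤ (8 * ∫ t, φ t ∂μ') * K₁ / τ ^ (m + 1) := by gcongr
      _ = _ := by ring
  have b5 : D * δ ≤ 4 * Φ * δ := by gcongr
  have e : (1 + 16 * K₁ / τ ^ (m + 1)) * ∫ t, φ t ∂μ' =
      ∫ t, φ t ∂μ' + 2 * (8 * K₁ / τ ^ (m + 1) * ∫ t, φ t ∂μ') := by ring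
  rw [e]
  linarith

end Compare

/-! ### Comparison for `B` with all but one variable frozen -/

section EdgeB

variable {n : ℕ}

lemma edgeB_eq (hn : 1 ≤ n) (E : ℝ) (W : Matrix (Fin n) (Fin n) ℂ) :
    edgeB E W = edgeScale n * (green W ⟨E, edgeScale n⟩).trace.im := by
  have hn0 : (n : ℝ) ≠ 0 := by positivity
  have hz : ((E : ℂ) + Complex.I * (edgeScale n : ℂ)) = ⟨E, edgeScale n⟩ := by
    apply Complex.ext <;> simp
  rw [edgeB, stieltjes, hz]
  have e : (1 / (n : ℂ)) = ((1 / (n : ℝ) : ℝ) : ℂ) := by push_cast; rfl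
  rw [e, Complex.im_ofReal_mul, green]
  field_simp

lemma edgeScale_pos (hn : 1 ≤ n) : 0 < edgeScale n := by
  have : (0 : ℝ) < n := by exact_mod_cast hn
  rw [edgeScale]; positivity

lemma edgeB_nonneg (hn : 1 ≤ n) (E : ℝ) {W : Matrix (Fin n) (Fin n) ℂ} (hW : W.IsHermitian) :
    0 ≤ edgeB E W := by
  have hη := edgeScale_pos hn
  rw [edgeB_eq hn, Matrix.trace, Complex.im_sum]
  exact mul_nonneg hη.le (Finset.sum_nonneg fun i _ =>
    (im_green_pos hW (z := ⟨E, edgeScale n⟩) hη i).le)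

lemma edgeB_le (hn : 1 ≤ n) (E : ℝ) {W : Matrix (Fin n) (Fin n) ℂ} (hW : W.IsHermitian) :
    edgeB E W ≤ n := by
  have hη := edgeScale_pos hn
  rw [edgeB_eq hn, Matrix.trace, Complex.im_sum]
  calc edgeScale n * ∑ i, (green W ⟨E, edgeScale n⟩ i i).im
      ≤ edgeScale n * ∑ _i : Fin n, 1 / edgeScale n := by
        gcongr with i
        exact ((le_abs_self _).trans (Complex.abs_im_le_norm _)).trans
          (norm_green_diag_le hW (z := ⟨E, edgeScale n⟩) hη i)
    _ = n := by simp; field_simp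

lemma normalized_add_smul (A V : Matrix (Fin n) (Fin n) ℂ) (t : ℝ) :
    normalized (A + (t : ℂ) • V) = normalized A + ((t / Real.sqrt n : ℝ) : ℂ) • V := by
  unfold normalized
  rw [smul_add, smul_smul]
  congr 2
  push_cast
  rw [div_eq_inv_mul]

lemma measurable_edgeB (hn : 1 ≤ n) (E : ℝ) :
    Measurable fun A : Fin n → Fin n → ℂ => edgeB E (normalized (Matrix.of A)) := by
  simp only [edgeB_eq hn, Matrix.trace]
  refine Measurable.const_mul (Complex.measurable_im.comp ?_) _
  exact Finset.measurable_sum _ fun k _ => measurable_green_entry _ _ k k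

/-- Replacing the law of one entry by a law with matching moments, the rest of the matrix being
fixed. -/
lemma integral_edgeB_compare (hn : 1 ≤ n) (E : ℝ) {A V : Matrix (Fin n) (Fin n) ℂ}
    (hA : A.IsHermitian) (hVh : V.IsHermitian) {T : Finset (Fin n)} (hT : T.card ≤ 2)
    (hV : SupportedOn T V) (hV1 : ∀ i j, ‖V i j‖ ≤ 1) {L : ℝ} (hL : 0 < L)
    (hR : ∀ i ∈ T, ∀ j ∈ T, ‖green (normalized A) ⟨E, edgeScale n⟩ i j‖ ≤ L) {k : ℕ} (hk : 1 ≤ k)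
    (hτ : 1 ≤ Real.sqrt n / (3200 * L * k)) {m : ℕ} {K₁ δ : ℝ} (hδ : δ ≤ 1 / 2)
    {μ μ' : Measure ℝ} [IsProbabilityMeasure μ] [IsProbabilityMeasure μ']
    (h : TailControl μ m K₁ (Real.sqrt n / (3200 * L * k)) δ)
    (h' : TailControl μ' m K₁ (Real.sqrt n / (3200 * L * k)) δ)
    (hmatch : ∀ j ≤ m, ∫ t, t ^ j ∂μ = ∫ t, t ^ j ∂μ') :
    ∫ t : ℝ, edgeB E (normalized (A + (t : ℂ) • V)) ^ k ∂μ ≤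
      (1 + 16 * K₁ * (3200 * L) ^ (m + 1) * (k / Real.sqrt n) ^ (m + 1)) *
        ∫ t : ℝ, edgeB E (normalized (A + (t : ℂ) • V)) ^ k ∂μ' +
        (1 / 100) ^ k + (n : ℝ) ^ k * (9 * δ) := by
  have hη := edgeScale_pos hn
  have hn0 : (0 : ℝ) < n := by exact_mod_cast hn
  have hk0 : (0 : ℝ) < k := by exact_mod_cast hk
  have hk1 : (1 : ℝ) ≤ k := by exact_mod_cast hk
  have hsn : 0 < Real.sqrt n := Real.sqrt_pos.2 hn0
  set τ := Real.sqrt n / (3200 * L * k) with hτdef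
  have hτ0 : 0 < τ := by linarith
  have hH : ∀ t : ℝ, (normalized (A + (t : ℂ) • V)).IsHermitian := fun t =>
    normalized_isHermitian (add_smul_isHermitian hA hVh t)
  set β : ℝ → ℝ := fun t => edgeB E (normalized (A + (t : ℂ) • V)) with hβ
  have hβ0 : ∀ t, 0 ≤ β t := fun t => edgeB_nonneg hn E (hH t)
  have hβn : ∀ t, β t ≤ n := fun t => edgeB_le hn E (hH t)
  have hβm : Measurable β := by
    have h1 : Measurable fun (t : ℝ) (i j : Fin n) => A i j + (t : ℂ) * V i j := by
      refine measurable_pi_lambda _ fun i => measurable_pi_lambda _ fun j => ?_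
      exact (Complex.measurable_ofReal.mul_const _).const_add _
    exact (measurable_edgeB hn E).comp h1
  obtain ⟨c₀, hc00, hc0b, hc0s⟩ := exists_trace_expansion (z := ⟨E, edgeScale n⟩) hT
    (normalized_isHermitian hA) hVh hV hV1 hη hL.le hR
  simp only at hc00 hc0s
  set c : ℕ → ℝ := fun j => c₀ j / (Real.sqrt n) ^ j with hc
  -- The choice of `3200` in `τ`: the non-constant part of the series is geometric with ratio `1 /
  -- (800 k)`, hence at most `1 / (400 k)`.
  have hx : 4 * L * (τ / Real.sqrt n) = 1 / (800 * k) := by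
    rw [hτdef]; field_simp; norm_num
  have hcβ : c 0 = β 0 := by
    simp only [hc, hβ, pow_zero, div_one, hc00, Complex.ofReal_zero, zero_smul, add_zero]
    rw [edgeB_eq hn]
  have hcb : ∀ j, |c (j + 1)| * τ ^ (j + 1) ≤ (1 / (800 * k)) ^ (j + 1) := by
    intro j
    have e : |c (j + 1)| * τ ^ (j + 1) = |c₀ (j + 1)| * (τ / Real.sqrt n) ^ (j + 1) := by
      simp only [hc, abs_div, abs_pow, abs_of_pos hsn]
      rw [div_pow τ, div_mul_eq_mul_div, mul_div_assoc]
    rw [← hx, mul_pow, e]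
    exact mul_le_mul_of_nonneg_right (hc0b j) (by positivity)
  have hy1 : 1 / (800 * (k : ℝ)) < 1 := by
    rw [div_lt_one (by positivity)]; linarith
  have hgeo := (summable_nat_add_iff 1).2 (summable_geometric_of_lt_one
    (by positivity : 0 ≤ 1 / (800 * (k : ℝ))) hy1)
  have hcs1 : Summable fun j => |c (j + 1)| * τ ^ (j + 1) :=
    Summable.of_nonneg_of_le (fun j => by positivity) hcb hgeo
  have hcs : Summable fun j => |c j| * τ ^ j :=
    (summable_nat_add_iff 1 (f := fun j => |c j| * τ ^ j)).1 hcs1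
  have htail : ∑' j, |c (j + 1)| * τ ^ (j + 1) ≤ 1 / (400 * k) := by
    refine (hcs1.tsum_le_tsum hcb hgeo).trans ?_
    simp only [pow_succ]
    rw [tsum_mul_right, tsum_geometric_of_lt_one (by positivity) hy1, ← div_eq_inv_mul,
      div_le_div_iff₀ (by linarith) (by positivity)]
    have : 1 / (800 * (k : ℝ)) ≤ 1 / 800 := by
      rw [div_le_div_iff₀ (by positivity) (by norm_num)]; linarith
    have e : 1 / (800 * (k : ℝ)) * (400 * k) = 1 / 2 := by field_simp; norm_num
    linarith
  have hfs : ∀ t, |t| ≤ τ → HasSum (fun j => c j * t ^ j) (β t) := by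
    intro t ht
    have h1 : 4 * L * |t / Real.sqrt n| < 1 := by
      rw [abs_div, abs_of_pos hsn]
      refine lt_of_le_of_lt ?_ hy1
      rw [← hx]; gcongr
    have h2 := hc0s _ h1
    rw [← normalized_add_smul] at h2
    have e : ∀ j, c j * t ^ j = c₀ j * (t / Real.sqrt n) ^ j := fun j => by
      simp only [hc]; rw [div_pow t, div_mul_eq_mul_div, mul_div_assoc]
    simp only [hβ, edgeB_eq hn, e]
    exact h2
  have hdev : ∀ t, |t| ≤ τ → |β t - β 0| ≤ 1 / (400 * k) := by
    intro t ht
    have h1 := (hasSum_nat_add_iff' 1).2 (hfs t ht)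
    simp only [Finset.range_one, Finset.sum_singleton, pow_zero, mul_one, hcβ] at h1
    rw [← h1.tsum_eq, ← Real.norm_eq_abs]
    refine (tsum_of_norm_bounded hcs1.hasSum fun j => ?_).trans htail
    rw [Real.norm_eq_abs, abs_mul, abs_pow]
    gcongr
  have hφm : Measurable fun t => β t ^ k := hβm.pow_const k
  have hφ0 : ∀ t, 0 ≤ β t ^ k := fun t => pow_nonneg (hβ0 t) k
  have hφn : ∀ t, β t ^ k ≤ (n : ℝ) ^ k := fun t => pow_le_pow_left₀ (hβ0 t) (hβn t) k
  have hδ0 : 0 ≤ δ := measureReal_nonneg.trans h.measure_compl_le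
  have hK0 : 0 ≤ K₁ := (integral_nonneg fun t => by positivity).trans h.moment
  have hk400 : 1 / (400 * (k : ℝ)) ≤ 1 / 400 := by
    rw [div_le_div_iff₀ (by positivity) (by norm_num)]; linarith
  -- If `β 0 < 1/200`, then `β ≤ 1/200 + 1/400 < 1/100` on `|t| ≤ τ`. Otherwise the variation `1 /
  -- (400 k)` is at most `β 0 / (2k)`, so `k`-th powers stay within a factor two of `β 0 ^ k`.
  rcases lt_or_ge (β 0) (1 / 200) with hs | hs
  · have hI' : 0 ≤ ∫ t, β t ^ k ∂μ' := integral_nonneg hφ0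
    have b1 := integral_le_of_le_on hφm hφ0 hφn h
    have b2 : ∫ t in {t : ℝ | |t| ≤ τ}, β t ^ k ∂μ ≤ (1 / 100) ^ k := by
      have hφint : Integrable (fun t => β t ^ k) μ :=
        (integrable_const ((n : ℝ) ^ k)).mono' hφm.aestronglyMeasurable
          (ae_of_all _ fun t => by rw [Real.norm_of_nonneg (hφ0 t)]; exact hφn t)
      calc _ ≤ ∫ _t in {t : ℝ | |t| ≤ τ}, (1 / 100 : ℝ) ^ k ∂μ := by
            refine setIntegral_mono_on hφint.integrableOn (integrable_const _).integrableOn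
              (measurableSet_abs_le τ) fun t ht => ?_
            have := (abs_le.1 (hdev t ht)).2
            exact pow_le_pow_left₀ (hβ0 t) (by linarith) k
        _ = μ.real {t : ℝ | |t| ≤ τ} * (1 / 100 : ℝ) ^ k := by
            rw [setIntegral_const, smul_eq_mul]
        _ ≤ _ := mul_le_of_le_one_left (by positivity) measureReal_le_one
    have b3 : 0 ≤ (1 + 16 * K₁ * (3200 * L) ^ (m + 1) * (k / Real.sqrt n) ^ (m + 1)) *
        ∫ t, β t ^ k ∂μ' := mul_nonneg (by positivity) hI'
    have b4 : 0 ≤ (n : ℝ) ^ k * δ := by positivity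
    linarith
  · have hb0 : 0 < β 0 := by linarith
    have hrel : 1 / (400 * (k : ℝ)) ≤ β 0 * (1 / (2 * k)) := by
      calc 1 / (400 * (k : ℝ)) = 1 / 200 * (1 / (2 * k)) := by field_simp; norm_num
        _ ≤ _ := by gcongr
    have hcS : ∑' j, |c j| * τ ^ j ≤ β 0 * (1 + 1 / (2 * k)) := by
      rw [← hcs.sum_add_tsum_nat_add 1]
      simp only [Finset.range_one, Finset.sum_singleton, pow_zero, mul_one, hcβ, abs_of_pos hb0]
      linarith
    obtain ⟨d, hd1, hd2, hd3⟩ := exists_pow_expansion hτ0.le hcs hcS hfs k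
    have hk2 : 1 / (2 * (k : ℝ)) ≤ 1 / 2 := by
      rw [div_le_div_iff₀ (by positivity) (by norm_num)]; linarith
    have ek : (k : ℝ) * (1 / (2 * k)) = 1 / 2 := by field_simp
    have hup : (β 0 * (1 + 1 / (2 * k))) ^ k ≤ 2 * β 0 ^ k := by
      have h1 : (1 + 1 / (2 * (k : ℝ))) ^ k ≤ 2 := by
        have h2 : 1 + 1 / (2 * (k : ℝ)) ≤ Real.exp (1 / (2 * k)) := by
          rw [add_comm]; exact Real.add_one_le_exp _
        calc (1 + 1 / (2 * (k : ℝ))) ^ k ≤ Real.exp (1 / (2 * k)) ^ k :=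
              pow_le_pow_left₀ (by positivity) h2 k
          _ = Real.exp (1 / 2) := by rw [← Real.exp_nat_mul, ek]
          _ ≤ 2 := by
            have h3 : Real.exp (1 / 2) ^ 2 ≤ 2 ^ 2 := by
              rw [← Real.exp_nat_mul]
              norm_num
              linarith [Real.exp_one_lt_d9]
            exact le_of_sq_le_sq h3 (by norm_num)
      rw [mul_pow, mul_comm]
      gcongr
    have hlow : ∀ t, |t| ≤ τ → 2 * β 0 ^ k ≤ 4 * β t ^ k := by
      intro t ht
      have h1 := (abs_le.1 (hdev t ht)).1
      have h2 : β 0 * (1 - 1 / (2 * k)) ≤ β t := by linarith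
      have h3 : 1 / 2 ≤ (1 - 1 / (2 * (k : ℝ))) ^ k := by
        have := one_add_mul_le_pow (a := -(1 / (2 * (k : ℝ)))) (by linarith) k
        rw [← sub_eq_add_neg] at this
        refine le_trans ?_ this
        linarith
      have h4 := pow_le_pow_left₀ (mul_nonneg hb0.le (by linarith)) h2 k
      rw [mul_pow] at h4
      nlinarith [pow_pos hb0 k]
    have key := integral_compare hφm hφ0 hφn hτ hd1 (hd2.trans hup) hd3 hlow h h' hδ hmatch
    have e : 16 * K₁ / τ ^ (m + 1) =
        16 * K₁ * (3200 * L) ^ (m + 1) * (k / Real.sqrt n) ^ (m + 1) := by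
      have e1 : 1 / τ = 3200 * L * (k / Real.sqrt n) := by rw [hτdef]; field_simp
      rw [mul_assoc, ← mul_pow, ← e1, one_div, inv_pow, div_eq_mul_inv]
    rw [e] at key
    have : (0 : ℝ) ≤ (1 / 100) ^ k := by positivity
    linarith

end EdgeB


/-! ### Isolating the real or imaginary part of one entry -/

section Slot

variable {n : ℕ}

/-- The matrix whose real multiples change the real (`w = 1`) or the imaginary (`w = I`) part of the
entry at `(a, b)`, keeping the matrix Hermitian. -/
def slotDir (a b : Fin n) (w : ℂ) : Matrix (Fin n) (Fin n) ℂ := fun i j =>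
  if i = a ∧ j = b then if a = b then (w.re : ℂ) else w
  else if i = b ∧ j = a then star w else 0

/-- The real or imaginary part of the entry at `(a, b)`. -/
def slotVal (a b : Fin n) (w : ℂ) (A : Matrix (Fin n) (Fin n) ℂ) : ℝ := (A a b * star w).re

/-- The part of the matrix that does not change with `slotVal`. -/
def slotRest (a b : Fin n) (w : ℂ) (A : Matrix (Fin n) (Fin n) ℂ) : Matrix (Fin n) (Fin n) ℂ :=
  A - (slotVal a b w A : ℂ) • slotDir a b w

variable {a b : Fin n} {w : ℂ} {A : Matrix (Fin n) (Fin n) ℂ}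

lemma slotRest_add (a b : Fin n) (w : ℂ) (A : Matrix (Fin n) (Fin n) ℂ) :
    slotRest a b w A + (slotVal a b w A : ℂ) • slotDir a b w = A := sub_add_cancel _ _

lemma slotDir_isHermitian (a b : Fin n) (w : ℂ) : (slotDir a b w).IsHermitian := by
  ext i j
  simp only [Matrix.conjTranspose_apply, slotDir]
  by_cases hab : a = b
  · subst hab
    by_cases h : i = a <;> by_cases h' : j = a <;> simp [h, h']
  · by_cases h1 : i = a
    · subst h1
      by_cases h2 : j = b
      · subst h2; simp [hab, Ne.symm hab]
      · simp [h2, hab]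
    · by_cases h2 : i = b
      · subst h2
        by_cases h3 : j = a
        · subst h3; simp [hab]
        · simp [h3, h1]
      · simp [h1, h2]

lemma slotDir_supportedOn (a b : Fin n) (w : ℂ) : SupportedOn {a, b} (slotDir a b w) := by
  intro i j h
  simp only [Finset.mem_insert, Finset.mem_singleton, not_or] at h
  rw [slotDir, if_neg, if_neg]
  · rintro ⟨rfl, rfl⟩; simp at h
  · rintro ⟨rfl, rfl⟩; simp at h

lemma norm_slotDir_le (hw : w = 1 ∨ w = Complex.I) (i j : Fin n) : ‖slotDir a b w i j‖ ≤ 1 := by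
  rw [slotDir]
  rcases hw with rfl | rfl <;> split_ifs <;> simp

lemma abs_slotVal_le (hw : w = 1 ∨ w = Complex.I) : |slotVal a b w A| ≤ ‖A a b‖ := by
  refine (Complex.abs_re_le_norm _).trans (le_of_eq ?_)
  rcases hw with rfl | rfl <;> simp

lemma slotRest_isHermitian (hA : A.IsHermitian) : (slotRest a b w A).IsHermitian := by
  have := add_smul_isHermitian hA (slotDir_isHermitian a b w) (-slotVal a b w A)
  simpa [slotRest, sub_eq_add_neg] using this

/-- Shows that the rest depends only on the other entries and the complementary part of `A a b`. On
the diagonal with `w = I` the direction is zero, consistently with the entry being real. -/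
lemma slotRest_apply (hA : A.IsHermitian) (hw : w = 1 ∨ w = Complex.I) (i j : Fin n) :
    slotRest a b w A i j =
      if i = a ∧ j = b then A a b - (slotVal a b w A : ℂ) * w
      else if i = b ∧ j = a then star (A a b - (slotVal a b w A : ℂ) * w) else A i j := by
  rw [slotRest, Matrix.sub_apply, Matrix.smul_apply, smul_eq_mul, slotDir]
  split_ifs with h1 h2 h3
  · obtain ⟨rfl, rfl⟩ := h1
    subst h2
    have him : (A i i).im = 0 := by
      have := congrArg Complex.im (congrFun (congrFun hA i) i)
      simp only [Matrix.conjTranspose_apply, RCLike.star_def, Complex.conj_im] at this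
      linarith
    rcases hw with rfl | rfl <;> simp [slotVal, him]
  · obtain ⟨rfl, rfl⟩ := h1; rfl
  · obtain ⟨rfl, rfl⟩ := h3
    have h4 : star (A j i) = A i j := congrFun (congrFun hA i) j
    have h5 : star ((slotVal j i w A : ℝ) : ℂ) = (slotVal j i w A : ℂ) := Complex.conj_ofReal _
    rw [star_sub, star_mul', h4, h5]
  · simp

end Slot

/-! ### Independence, adjacency and tails of the distinguished variable -/

section Prob

variable {Ω : Type*} [MeasurableSpace Ω] {P : Measure Ω} {n : ℕ}

/-- The joint law is the product of all three marginals; reassociate it. -/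
lemma indepFun_prod_of_indepFun [IsProbabilityMeasure P] {α β γ : Type*} [MeasurableSpace α]
    [MeasurableSpace β] [MeasurableSpace γ] {X : Ω → α} {Y : Ω → β} {Z : Ω → γ} (hX : Measurable X)
    (hY : Measurable Y) (hZ : Measurable Z) (h : IndepFun X (fun ω => (Y ω, Z ω)) P)
    (h' : IndepFun Y Z P) : IndepFun (fun ω => (X ω, Y ω)) Z P := by
  have hXY : IndepFun X Y P := h.comp measurable_id measurable_fst
  have := Measure.isProbabilityMeasure_map (μ := P) hX.aemeasurable
  have := Measure.isProbabilityMeasure_map (μ := P) hY.aemeasurable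
  have := Measure.isProbabilityMeasure_map (μ := P) hZ.aemeasurable
  rw [indepFun_iff_map_prod_eq_prod_map_map (hX.prodMk hY).aemeasurable hZ.aemeasurable,
    (indepFun_iff_map_prod_eq_prod_map_map hX.aemeasurable hY.aemeasurable).1 hXY]
  rw [indepFun_iff_map_prod_eq_prod_map_map hX.aemeasurable (hY.prodMk hZ).aemeasurable,
    (indepFun_iff_map_prod_eq_prod_map_map hY.aemeasurable hZ.aemeasurable).1 h',
    ← Measure.prodAssoc_prod] at h
  rw [← (MeasurableEquiv.prodAssoc (α := α) (β := β) (γ := γ)).map_measurableEquiv_injective.eq_iff,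
    ← h, Measure.map_map MeasurableEquiv.prodAssoc.measurable ((hX.prodMk hY).prodMk hZ)]
  rfl

lemma indepFun_of_const_right [IsProbabilityMeasure P] {α β : Type*} [MeasurableSpace α]
    [MeasurableSpace β] (X : Ω → α) (c : β) : IndepFun X (fun _ => c) P := by
  rw [indepFun_iff_measure_inter_preimage_eq_mul]
  intro s t _ _
  by_cases h : c ∈ t <;> simp [Set.preimage, h]

/-- Fubini for a function of two independent variables. -/
lemma integral_comp_indep [IsProbabilityMeasure P] {α : Type*} [MeasurableSpace α] {A : Ω → α}
    {t : Ω → ℝ} (hA : Measurable A) (ht : Measurable t) (h : IndepFun A t P) {f : α × ℝ → ℝ}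
    (hf : Measurable f) (hint : Integrable (fun ω => f (A ω, t ω)) P) :
    Integrable (fun ω => ∫ s, f (A ω, s) ∂(P.map t)) P ∧
      ∫ ω, f (A ω, t ω) ∂P = ∫ ω, ∫ s, f (A ω, s) ∂(P.map t) ∂P := by
  have := Measure.isProbabilityMeasure_map (μ := P) hA.aemeasurable
  have := Measure.isProbabilityMeasure_map (μ := P) ht.aemeasurable
  have hAt := hA.prodMk ht
  have hmap := (indepFun_iff_map_prod_eq_prod_map_map hA.aemeasurable ht.aemeasurable).1 h
  have h1 : Integrable f ((P.map A).prod (P.map t)) := by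
    rw [← hmap]
    exact (integrable_map_measure hf.aestronglyMeasurable hAt.aemeasurable).2 hint
  have h2 := h1.integral_prod_left
  refine ⟨(integrable_map_measure h2.aestronglyMeasurable hA.aemeasurable).1 h2, ?_⟩
  rw [← integral_map (f := f) hAt.aemeasurable hf.aestronglyMeasurable, hmap, integral_prod _ h1,
    integral_map hA.aemeasurable h2.aestronglyMeasurable]

variable {M M' : Ω → Matrix (Fin n) (Fin n) ℂ} {a b : Fin n} {w : ℂ}

lemma IsWigner.measurable_slotVal (hM : IsWigner P M) (a b : Fin n) (w : ℂ) :
    Measurable fun ω => slotVal a b w (M ω) := by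
  unfold slotVal
  exact Complex.measurable_re.comp ((hM.measurable_entry a b).mul_const _)

lemma IsWigner.measurable_slotRest (hM : IsWigner P M) (a b : Fin n) (w : ℂ) :
    Measurable fun ω (i j : Fin n) => slotRest a b w (M ω) i j := by
  refine measurable_pi_lambda _ fun i => measurable_pi_lambda _ fun j => ?_
  simp only [slotRest, Matrix.sub_apply, Matrix.smul_apply, smul_eq_mul]
  exact (hM.measurable_entry i j).sub
    ((Complex.measurable_ofReal.comp (hM.measurable_slotVal a b w)).mul_const _)

lemma IsWigner.indepFun_entry_slotVal (hM : IsWigner P M) (hab : a ≤ b)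
    (hw : w = 1 ∨ w = Complex.I) :
    IndepFun (fun ω => M ω a b - (slotVal a b w (M ω) : ℂ) * w)
      (fun ω => slotVal a b w (M ω)) P := by
  have := hM.isProbabilityMeasure
  rcases hab.eq_or_lt with rfl | hlt
  · have him : ∀ ω, (M ω a a).im = 0 := fun ω => by
      have := congrArg Complex.im (congrFun (congrFun (hM.isHermitian ω) a) a)
      simp only [Matrix.conjTranspose_apply, RCLike.star_def, Complex.conj_im] at this
      linarith
    rcases hw with rfl | rfl
    · have e : (fun ω => M ω a a - (slotVal a a 1 (M ω) : ℂ) * 1) = fun _ => 0 := by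
        funext ω
        apply Complex.ext <;> simp [slotVal, him]
      rw [e]
      exact (indepFun_of_const_right _ _).symm
    · have e : (fun ω => slotVal a a Complex.I (M ω)) = fun _ => 0 := by
        funext ω
        simp [slotVal, him]
      rw [e]
      exact indepFun_of_const_right _ _
  · have h := hM.indep_re_im a b hlt
    rcases hw with rfl | rfl
    · have h1 := h.symm.comp (φ := fun x : ℝ => (x : ℂ) * Complex.I) (ψ := fun x : ℝ => x)
        (by fun_prop) measurable_id
      convert h1 using 1
      · funext ω; apply Complex.ext <;> simp [slotVal]
      · funext ω; simp [slotVal]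
    · have h1 := h.comp (φ := fun x : ℝ => (x : ℂ)) (ψ := fun x : ℝ => x)
        (by fun_prop) measurable_id
      convert h1 using 1
      · funext ω; apply Complex.ext <;> simp [slotVal]
      · funext ω; simp [slotVal]

/-- Two independences combine: the other entries against the entry at `(a, b)`, and inside that
entry the frozen part against the varying part. -/
lemma IsWigner.indepFun_slotRest_slotVal (hM : IsWigner P M) (hab : a ≤ b)
    (hw : w = 1 ∨ w = Complex.I) :
    IndepFun (fun ω (i j : Fin n) => slotRest a b w (M ω) i j)
      (fun ω => slotVal a b w (M ω)) P := by
  classical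
  have := hM.isProbabilityMeasure
  set p₀ : {p : Fin n × Fin n // p.1 ≤ p.2} := ⟨(a, b), hab⟩ with hp₀
  set T : Finset {p : Fin n × Fin n // p.1 ≤ p.2} := {p₀}ᶜ with hT
  have h := hM.indep_entries.indepFun_finset T {p₀} disjoint_compl_left
    (fun p => hM.measurable_entry _ _)
  have hTmem : ∀ i j (hij : i ≤ j), ¬ (i = a ∧ j = b) → (⟨(i, j), hij⟩ : {p : Fin n × Fin n //
      p.1 ≤ p.2}) ∈ T := by
    intro i j hij hne
    rw [hT, Finset.mem_compl, Finset.mem_singleton, hp₀]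
    simpa using hne
  have h1 := h.comp (φ := id)
    (ψ := fun v => ((v ⟨p₀, Finset.mem_singleton_self p₀⟩ -
      (((v ⟨p₀, Finset.mem_singleton_self p₀⟩ * star w).re : ℝ) : ℂ) * w),
      (v ⟨p₀, Finset.mem_singleton_self p₀⟩ * star w).re)) measurable_id (by fun_prop)
  have h2 := indepFun_prod_of_indepFun (measurable_pi_lambda _ fun p => hM.measurable_entry _ _)
    ((hM.measurable_entry a b).sub
      ((Complex.measurable_ofReal.comp (hM.measurable_slotVal a b w)).mul_const w))
    (hM.measurable_slotVal a b w) h1 (hM.indepFun_entry_slotVal hab hw)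
  let ψ : (T → ℂ) × ℂ → Fin n → Fin n → ℂ := fun y i j =>
    if h1 : i = a ∧ j = b then y.2 else if h2 : i = b ∧ j = a then star y.2 else
      if hle : i ≤ j then y.1 ⟨⟨(i, j), hle⟩, hTmem _ _ hle h1⟩
      else star (y.1 ⟨⟨(j, i), le_of_not_ge hle⟩, hTmem _ _ _ fun h => h2 h.symm⟩)
  have hψ : Measurable ψ := by
    refine measurable_pi_lambda _ fun i => measurable_pi_lambda _ fun j => ?_
    simp only [ψ]
    split_ifs <;> fun_prop
  have h3 := h2.comp hψ measurable_id
  refine h3.congr (ae_of_all _ fun ω => ?_) (ae_of_all _ fun ω => rfl)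
  funext i j
  refine Eq.trans ?_ (slotRest_apply (hM.isHermitian ω) hw i j).symm
  simp only [ψ, Function.comp_apply]
  split_ifs
  · rfl
  · rfl
  · rfl
  · exact (hM.conj_entry ω i j).symm

/-- Equal real parts leave the imaginary part free, so `w = I`, and conversely. Hermitian symmetry
allows `a ≤ b`. -/
lemma Adjacent.exists_slot (h : Adjacent P M M') (hM : IsWigner P M) (hM' : IsWigner P M') :
    ∃ a b : Fin n, a ≤ b ∧ ∃ w : ℂ, (w = 1 ∨ w = Complex.I) ∧
      ∀ᵐ ω ∂P, slotRest a b w (M ω) = slotRest a b w (M' ω) := by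
  obtain ⟨a, b, h1, h2⟩ : ∃ a b : Fin n, (a ≤ b) ∧ (∀ i j, (i, j) ≠ (a, b) → (i, j) ≠ (b, a) →
      (fun ω => M ω i j) =ᵐ[P] fun ω => M' ω i j) ∧
    (((fun ω => (M ω a b).re) =ᵐ[P] fun ω => (M' ω a b).re) ∨
      ((fun ω => (M ω a b).im) =ᵐ[P] fun ω => (M' ω a b).im)) := by
    obtain ⟨a, b, h1, h2⟩ := h
    rcases le_total a b with hab | hab
    · exact ⟨a, b, hab, h1, h2⟩
    · refine ⟨b, a, hab, fun i j hi hj => h1 i j hj hi, h2.imp (fun h => ?_) fun h => ?_⟩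
      · filter_upwards [h] with ω hω
        rw [hM.conj_entry ω b a, hM'.conj_entry ω b a]
        simpa using hω
      · filter_upwards [h] with ω hω
        rw [hM.conj_entry ω b a, hM'.conj_entry ω b a]
        simpa using hω
  refine ⟨a, b, h1, ?_⟩
  obtain ⟨h2, h3⟩ := h2
  have h4 : ∀ᵐ ω ∂P, ∀ i j, (i, j) ≠ (a, b) → (i, j) ≠ (b, a) → M ω i j = M' ω i j := by
    rw [ae_all_iff]; intro i
    rw [ae_all_iff]; intro j
    by_cases e1 : (i, j) = (a, b)
    · exact ae_of_all _ fun ω h => absurd e1 h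
    · by_cases e2 : (i, j) = (b, a)
      · exact ae_of_all _ fun ω _ h => absurd e2 h
      · filter_upwards [h2 i j e1 e2] with ω hω _ _ using hω
  have key : ∀ w : ℂ, (w = 1 ∨ w = Complex.I) → (∀ᵐ ω ∂P, M ω a b - (slotVal a b w (M ω) : ℂ) * w =
      M' ω a b - (slotVal a b w (M' ω) : ℂ) * w) →
      ∀ᵐ ω ∂P, slotRest a b w (M ω) = slotRest a b w (M' ω) := by
    intro w hw h
    filter_upwards [h, h4] with ω h5 h6
    ext i j
    rw [slotRest_apply (hM.isHermitian ω) hw, slotRest_apply (hM'.isHermitian ω) hw, h5]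
    split_ifs with e1 e2
    · rfl
    · rfl
    · exact h6 i j (by simpa using e1) (by simpa using e2)
  rcases h3 with h3 | h3
  · refine ⟨Complex.I, Or.inr rfl, key _ (Or.inr rfl) ?_⟩
    filter_upwards [h3] with ω hω
    apply Complex.ext <;> simp [slotVal, hω]
  · refine ⟨1, Or.inl rfl, key _ (Or.inl rfl) ?_⟩
    filter_upwards [h3] with ω hω
    apply Complex.ext <;> simp [slotVal, hω]

lemma MatchingMoments.integral_slotVal {m : ℕ} (h : MatchingMoments P m M M') (hM : IsWigner P M)
    (hM' : IsWigner P M') (hw : w = 1 ∨ w = Complex.I) {j : ℕ} (hj : j ≤ m) :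
    ∫ s, s ^ j ∂(P.map fun ω => slotVal a b w (M ω)) =
      ∫ s, s ^ j ∂(P.map fun ω => slotVal a b w (M' ω)) := by
  rw [integral_map (hM.measurable_slotVal a b w).aemeasurable (by fun_prop),
    integral_map (hM'.measurable_slotVal a b w).aemeasurable (by fun_prop)]
  rcases hw with rfl | rfl
  · simpa [slotVal] using h a b j 0 (by omega)
  · simpa [slotVal] using h a b 0 j (by omega)

/-- On a set of probability `exp (-2x)`, integrate `|t|^j ≤ (exp (-x) t^(2j) + exp x) / 2`: both
terms are of order `exp (-x)`, given moments up to order `2 (m + 1)`. -/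
lemma EntryDecay.tailControl [IsProbabilityMeasure P] {C C' : ℝ} {X : Ω → ℂ}
    (h : EntryDecay P C C' X) (hX : Measurable X) {t : Ω → ℝ} (ht : Measurable t)
    (htX : ∀ ω, |t ω| ≤ ‖X ω‖) (m : ℕ) {τ x : ℝ}
    (hx : P.real {ω | τ < ‖X ω‖} ≤ Real.exp (-(2 * x))) :
    TailControl (P.map t) m (1 + entryBound C C' m ^ (m + 1)) τ
      ((1 + entryBound C C' m ^ (m + 1)) * Real.exp (-x)) := by
  have hmb := (h.momBound hX m).1
  set K := 1 + entryBound C C' m ^ (m + 1) with hK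
  have hK1 : 1 ≤ K := by
    have := one_le_entryBound C C' m
    have : 0 ≤ entryBound C C' m ^ (m + 1) := by positivity
    linarith
  set g : Ω → ℝ := fun ω => 1 + (‖X ω‖ ^ 2) ^ (m + 1) with hg
  have hgi : Integrable g P := (integrable_const 1).add hmb.integrable
  have hgK : ∫ ω, g ω ∂P ≤ K := by
    rw [hg, integral_add (integrable_const 1) hmb.integrable]
    simpa [hK] using hmb.le
  have hpow : ∀ j ≤ 2 * (m + 1), ∀ ω, |t ω| ^ j ≤ g ω := by
    intro j hj ω
    have h1 : |t ω| ^ j ≤ ‖X ω‖ ^ j := pow_le_pow_left₀ (abs_nonneg _) (htX ω) j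
    refine h1.trans ?_
    simp only [hg]
    rw [← pow_mul]
    rcases le_total ‖X ω‖ 1 with h2 | h2
    · have := pow_le_one₀ (norm_nonneg _) h2 (n := j)
      have : 0 ≤ ‖X ω‖ ^ (2 * (m + 1)) := by positivity
      linarith
    · have := pow_le_pow_right₀ h2 hj
      linarith
  have hti : ∀ j ≤ 2 * (m + 1), Integrable (fun ω => |t ω| ^ j) P := fun j hj =>
    hgi.mono' (ht.norm.pow_const j).aestronglyMeasurable (ae_of_all _ fun ω => by
      rw [Real.norm_of_nonneg (by positivity)]; exact hpow j hj ω)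
  refine ⟨(integrable_map_measure (by fun_prop) ht.aemeasurable).2 (hti (m + 1) (by omega)), ?_,
    fun j hj => ?_⟩
  · rw [integral_map ht.aemeasurable (by fun_prop)]
    exact (integral_mono (hti (m + 1) (by omega)) hgi fun ω => hpow _ (by omega) ω).trans hgK
  · rw [setIntegral_map (measurableSet_abs_le τ).compl (by fun_prop) ht.aemeasurable]
    set S : Set Ω := t ⁻¹' {s | |s| ≤ τ}ᶜ with hS
    have hSm : MeasurableSet S := ht (measurableSet_abs_le τ).compl
    have hPS : P.real S ≤ Real.exp (-(2 * x)) := by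
      refine (measureReal_mono fun ω hω => ?_).trans hx
      have h1 : τ < |t ω| := not_le.1 hω
      exact h1.trans_le (htX ω)
    have hE := Real.exp_pos (-x)
    have hE' := Real.exp_pos x
    have hEE : Real.exp x * Real.exp (-x) = 1 := by rw [← Real.exp_add]; simp
    have hpt : ∀ ω, |t ω| ^ j ≤ 1 / 2 * Real.exp (-x) * g ω + 1 / 2 * Real.exp x := by
      intro ω
      have h1 := hpow (2 * j) (by omega) ω
      rw [mul_comm, pow_mul] at h1
      set y := |t ω| ^ j
      have h2 : y ≤ 1 / 2 * Real.exp (-x) * y ^ 2 + 1 / 2 * Real.exp x := by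
        nlinarith [mul_nonneg hE'.le (sq_nonneg (Real.exp (-x) * y - 1))]
      have h3 : 1 / 2 * Real.exp (-x) * y ^ 2 ≤ 1 / 2 * Real.exp (-x) * g ω := by gcongr
      linarith
    calc ∫ ω in S, |t ω| ^ j ∂P
        ≤ ∫ ω in S, (1 / 2 * Real.exp (-x) * g ω + 1 / 2 * Real.exp x) ∂P :=
          setIntegral_mono (hti j (by omega)).integrableOn
            ((hgi.const_mul _).add (integrable_const _)).integrableOn hpt
      _ = 1 / 2 * Real.exp (-x) * ∫ ω in S, g ω ∂P + P.real S * (1 / 2 * Real.exp x) := by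
          rw [integral_add (hgi.const_mul _).integrableOn (integrable_const _).integrableOn,
            integral_const_mul, setIntegral_const, smul_eq_mul]
      _ ≤ 1 / 2 * Real.exp (-x) * K + Real.exp (-(2 * x)) * (1 / 2 * Real.exp x) := by
          have h1 : ∫ ω in S, g ω ∂P ≤ K :=
            (setIntegral_le_integral hgi (ae_of_all _ fun ω => by
              simp only [hg, Pi.zero_apply]; positivity)).trans hgK
          exact add_le_add (mul_le_mul_of_nonneg_left h1 (by positivity))
            (mul_le_mul_of_nonneg_right hPS (by positivity))
      _ ≤ K * Real.exp (-x) := by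
          have e : Real.exp (-(2 * x)) * (1 / 2 * Real.exp x) = 1 / 2 * Real.exp (-x) := by
            rw [mul_left_comm, ← Real.exp_add]; congr 2; ring
          rw [e]
          nlinarith

end Prob

/-! ### Stability of block resolvent bounds -/

section Perturb

open Matrix

variable {ι : Type*} [Fintype ι] [DecidableEq ι]

/-- The largest perturbed entry `u` on the block satisfies `u ≤ L + 4 |s| L u ≤ L + u / 2` by the
resolvent identity. -/
lemma norm_green_add_smul_le {T : Finset ι} {A V : Matrix ι ι ℂ} {z : ℂ} {L s : ℝ} (hT : T.card ≤ 2)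
    (hA : A.IsHermitian) (hVh : V.IsHermitian) (hV : SupportedOn T V) (hV1 : ∀ i j, ‖V i j‖ ≤ 1)
    (hz : 0 < z.im) (hR : ∀ i ∈ T, ∀ j ∈ T, ‖green A z i j‖ ≤ L) (hs : 8 * |s| * L ≤ 1)
    (i : ι) (hi : i ∈ T) (j : ι) (hj : j ∈ T) : ‖green (A + (s : ℂ) • V) z i j‖ ≤ 2 * L := by
  set G := green (A + (s : ℂ) • V) z with hG
  have hL : 0 ≤ L := (norm_nonneg _).trans (hR i hi j hj)
  obtain ⟨p, hp, hmax⟩ := (T ×ˢ T).exists_max_image (fun p => ‖G p.1 p.2‖)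
    ⟨(i, j), Finset.mk_mem_product hi hj⟩
  set u := ‖G p.1 p.2‖ with hu
  have hGu : ∀ k ∈ T, ∀ l ∈ T, ‖G k l‖ ≤ u := fun k hk l hl =>
    hmax (k, l) (Finset.mk_mem_product hk hl)
  have hp' := Finset.mem_product.1 hp
  have h1 : ∀ k ∈ T, ∀ l, ‖(green A z * V) k l‖ ≤ 2 * L := by
    intro k hk l
    rw [mul_apply]
    refine norm_sum_supported_le hT (fun r hr => by rw [hV r l (Or.inl hr), mul_zero]) hL
      fun r hr => ?_
    rw [norm_mul]
    exact (mul_le_of_le_one_right (norm_nonneg _) (hV1 r l)).trans (hR k hk r hr)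
  have h2 : ‖(green A z * V * G) p.1 p.2‖ ≤ 2 * (2 * L * u) := by
    rw [mul_apply]
    refine norm_sum_supported_le hT (fun r hr => ?_) (by positivity) fun r hr => ?_
    · rw [mul_apply, Finset.sum_eq_zero fun q _ => by rw [hV q r (Or.inr hr), mul_zero], zero_mul]
    · rw [norm_mul]
      exact mul_le_mul (h1 _ hp'.1 r) (hGu r hr _ hp'.2) (norm_nonneg _) (by positivity)
  have h3 : u ≤ L + |s| * (2 * (2 * L * u)) := by
    have e := congrFun (congrFun (green_add_smul hA hVh hz s) p.1) p.2
    rw [← hG, Matrix.sub_apply, Matrix.smul_apply, smul_eq_mul] at e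
    refine (congrArg norm e).trans_le ?_
    refine (norm_sub_le _ _).trans (add_le_add (hR _ hp'.1 _ hp'.2) ?_)
    rw [norm_mul, Complex.norm_real, Real.norm_eq_abs]
    exact mul_le_mul_of_nonneg_left h2 (abs_nonneg _)
  have h4 : u ≤ 2 * L := by nlinarith [norm_nonneg (G p.1 p.2)]
  exact (hGu i hi j hj).trans h4

end Perturb


/-! ### Conditioning and assembly -/

section Assembly

variable {Ω : Type*} [MeasurableSpace Ω] {P : Measure Ω} {n : ℕ}
  {M M' : Ω → Matrix (Fin n) (Fin n) ℂ} {a b : Fin n} {w : ℂ}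

lemma IsWigner.measurable_edgeB_pow (hM : IsWigner P M) (hn : 1 ≤ n) (E : ℝ) (k : ℕ) :
    Measurable fun ω => edgeB E (normalized (M ω)) ^ k := by
  have h : Measurable fun ω (i j : Fin n) => M ω i j :=
    measurable_pi_lambda _ fun i => measurable_pi_lambda _ fun j => hM.measurable_entry i j
  exact ((measurable_edgeB hn E).comp h).pow_const k

lemma edgeB_pow_nonneg (hn : 1 ≤ n) (E : ℝ) (k : ℕ) {A : Matrix (Fin n) (Fin n) ℂ}
    (hA : A.IsHermitian) : 0 ≤ edgeB E (normalized A) ^ k :=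
  pow_nonneg (edgeB_nonneg hn E (normalized_isHermitian hA)) k

lemma edgeB_pow_le (hn : 1 ≤ n) (E : ℝ) (k : ℕ) {A : Matrix (Fin n) (Fin n) ℂ}
    (hA : A.IsHermitian) : edgeB E (normalized A) ^ k ≤ (n : ℝ) ^ k :=
  pow_le_pow_left₀ (edgeB_nonneg hn E (normalized_isHermitian hA))
    (edgeB_le hn E (normalized_isHermitian hA)) k

lemma IsWigner.integrable_edgeB_pow (hM : IsWigner P M) (hn : 1 ≤ n) (E : ℝ) (k : ℕ) :
    Integrable (fun ω => edgeB E (normalized (M ω)) ^ k) P := by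
  have := hM.isProbabilityMeasure
  refine (integrable_const ((n : ℝ) ^ k)).mono'
    (hM.measurable_edgeB_pow hn E k).aestronglyMeasurable (ae_of_all _ fun ω => ?_)
  rw [Real.norm_of_nonneg (edgeB_pow_nonneg hn E k (hM.isHermitian ω))]
  exact edgeB_pow_le hn E k (hM.isHermitian ω)

lemma IsWigner.integral_edgeB_pow_le (hM : IsWigner P M) (hn : 1 ≤ n) (E : ℝ) (k : ℕ) :
    ∫ ω, edgeB E (normalized (M ω)) ^ k ∂P ≤ (n : ℝ) ^ k := by
  have := hM.isProbabilityMeasure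
  refine (integral_mono (hM.integrable_edgeB_pow hn E k) (integrable_const _)
    fun ω => edgeB_pow_le hn E k (hM.isHermitian ω)).trans (le_of_eq ?_)
  simp

/-- Conditioning on everything but the real or imaginary part of one entry. -/
lemma IsWigner.integral_edgeB_pow_eq (hM : IsWigner P M) (hn : 1 ≤ n) (hab : a ≤ b)
    (hw : w = 1 ∨ w = Complex.I) (E : ℝ) (k : ℕ) :
    Integrable (fun ω => ∫ s : ℝ, edgeB E (normalized (slotRest a b w (M ω) +
        (s : ℂ) • slotDir a b w)) ^ k ∂(P.map fun ω => slotVal a b w (M ω))) P ∧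
      ∫ ω, edgeB E (normalized (M ω)) ^ k ∂P =
        ∫ ω, ∫ s : ℝ, edgeB E (normalized (slotRest a b w (M ω) + (s : ℂ) • slotDir a b w)) ^ k
          ∂(P.map fun ω => slotVal a b w (M ω)) ∂P := by
  have := hM.isProbabilityMeasure
  let f : (Fin n → Fin n → ℂ) × ℝ → ℝ := fun y =>
    edgeB E (normalized (Matrix.of y.1 + (y.2 : ℂ) • slotDir a b w)) ^ k
  have hf : Measurable f := by
    have h1 : Measurable fun (y : (Fin n → Fin n → ℂ) × ℝ) (i j : Fin n) =>
        y.1 i j + (y.2 : ℂ) * slotDir a b w i j := by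
      refine measurable_pi_lambda _ fun i => measurable_pi_lambda _ fun j => ?_
      fun_prop
    exact ((measurable_edgeB hn E).comp h1).pow_const k
  have e : (fun ω => edgeB E (normalized (M ω)) ^ k) = fun ω =>
      f (fun i j => slotRest a b w (M ω) i j, slotVal a b w (M ω)) := by
    funext ω
    conv_lhs => rw [← slotRest_add a b w (M ω)]
    rfl
  have hint := hM.integrable_edgeB_pow hn E k
  rw [e] at hint
  have h := integral_comp_indep (hM.measurable_slotRest a b w) (hM.measurable_slotVal a b w)
    (hM.indepFun_slotRest_slotVal hab hw) hf hint
  exact ⟨h.1, (congrArg (fun g => ∫ ω, g ω ∂P) e).trans h.2⟩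

/-- The matrices whose resolvent at the edge scale is not bounded on the positions `a`, `b`. -/
def badBlock (a b : Fin n) (E : ℝ) : Set (Fin n → Fin n → ℂ) :=
  {A | ∃ i ∈ ({a, b} : Finset (Fin n)), ∃ j ∈ ({a, b} : Finset (Fin n)),
    22 < ‖green (normalized (Matrix.of A)) ⟨E, edgeScale n⟩ i j‖}

lemma measurableSet_badBlock (a b : Fin n) (E : ℝ) : MeasurableSet (badBlock a b E) := by
  have : badBlock a b E = ⋃ i ∈ ({a, b} : Finset (Fin n)), ⋃ j ∈ ({a, b} : Finset (Fin n)),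
      {A | 22 < ‖green (normalized (Matrix.of A)) ⟨E, edgeScale n⟩ i j‖} := by
    ext A; simp [badBlock]
  rw [this]
  refine Finset.measurableSet_biUnion _ fun i _ => Finset.measurableSet_biUnion _ fun j _ => ?_
  exact measurableSet_lt measurable_const (measurable_green_entry _ _ i j).norm

/-- The local law concerns the full matrix, whereas conditioning needs an event determined by the
frozen part. Removing the slot at most doubles the bound `11`; `88 = 8 · 11`. -/
lemma not_mem_badBlock_of_bounds {A : Matrix (Fin n) (Fin n) ℂ} (hn : 1 ≤ n) (hA : A.IsHermitian)
    (hw : w = 1 ∨ w = Complex.I) {E : ℝ} (hs : 88 * ‖A a b‖ ≤ Real.sqrt n)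
    (h : (∀ i, ‖green (normalized A) ⟨E, edgeScale n⟩ i i‖ ≤ 11) ∧
        ‖green (normalized A) ⟨E, edgeScale n⟩ a b‖ ≤ 11 ∧
        ‖green (normalized A) ⟨E, edgeScale n⟩ b a‖ ≤ 11) :
    (fun i j => slotRest a b w A i j) ∉ badBlock a b E := by
  have hn0 : (0 : ℝ) < n := by exact_mod_cast hn
  have hsn : 0 < Real.sqrt n := Real.sqrt_pos.2 hn0
  rintro ⟨i, hi, j, hj, hij⟩
  refine absurd hij (not_lt.2 ?_)
  have e : normalized (Matrix.of fun i j => slotRest a b w A i j) =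
      normalized A + ((-slotVal a b w A / Real.sqrt n : ℝ) : ℂ) • slotDir a b w := by
    rw [← normalized_add_smul]
    congr 1
    change slotRest a b w A = _
    rw [slotRest]
    simp [sub_eq_add_neg]
  rw [e]
  refine (norm_green_add_smul_le (L := 11) Finset.card_le_two (normalized_isHermitian hA)
    (slotDir_isHermitian a b w) (slotDir_supportedOn a b w) (norm_slotDir_le hw)
    (edgeScale_pos hn) ?_ ?_ i hi j hj).trans (by norm_num)
  · intro p hp q hq
    simp only [Finset.mem_insert, Finset.mem_singleton] at hp hq
    rcases hp with rfl | rfl <;> rcases hq with rfl | rfl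
    · exact h.1 _
    · exact h.2.1
    · exact h.2.2
    · exact h.1 _
  · rw [abs_div, abs_neg, abs_of_pos hsn]
    have h1 := abs_slotVal_le (A := A) (a := a) (b := b) hw
    rw [mul_div_assoc', div_mul_eq_mul_div, div_le_one hsn]
    linarith

/-- Comparison of the moments of two adjacent Wigner matrices, given the control of the entries and
of the resolvent. -/
lemma integral_edgeB_pow_compare (hn : 1 ≤ n) (hM : IsWigner P M) (hM' : IsWigner P M')
    (hab : a ≤ b) (hw : w = 1 ∨ w = Complex.I)
    (hrest : ∀ᵐ ω ∂P, slotRest a b w (M ω) = slotRest a b w (M' ω)) {m : ℕ}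
    (hmom : MatchingMoments P m M M') (E : ℝ) {k : ℕ} (hk : 1 ≤ k)
    (hτ : 1 ≤ Real.sqrt n / (3200 * 22 * k)) {K₁ δ ε : ℝ} (hδ : δ ≤ 1 / 2)
    (h : TailControl (P.map fun ω => slotVal a b w (M ω)) m K₁ (Real.sqrt n / (3200 * 22 * k)) δ)
    (h' : TailControl (P.map fun ω => slotVal a b w (M' ω)) m K₁
      (Real.sqrt n / (3200 * 22 * k)) δ)
    (hbad : P.real {ω | (fun i j => slotRest a b w (M ω) i j) ∈ badBlock a b E} ≤ ε) :
    ∫ ω, edgeB E (normalized (M ω)) ^ k ∂P ≤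
      (1 + 16 * K₁ * (3200 * 22) ^ (m + 1) * (k / Real.sqrt n) ^ (m + 1)) *
        ∫ ω, edgeB E (normalized (M' ω)) ^ k ∂P +
        (1 / 100) ^ k + (n : ℝ) ^ k * (9 * δ + ε) := by
  have := hM.isProbabilityMeasure
  have hμ := Measure.isProbabilityMeasure_map (μ := P) (hM.measurable_slotVal a b w).aemeasurable
  have hμ' := Measure.isProbabilityMeasure_map (μ := P) (hM'.measurable_slotVal a b w).aemeasurable
  obtain ⟨i1, e1⟩ := hM.integral_edgeB_pow_eq hn hab hw E k
  obtain ⟨i2, e2⟩ := hM'.integral_edgeB_pow_eq hn hab hw E k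
  set μ := P.map fun ω => slotVal a b w (M ω) with hμdef
  set μ' := P.map fun ω => slotVal a b w (M' ω) with hμ'def
  have hδ0 : 0 ≤ δ := measureReal_nonneg.trans h.measure_compl_le
  have hK0 : 0 ≤ K₁ := (integral_nonneg fun t => by positivity).trans h.moment
  set κ : ℝ := 16 * K₁ * (3200 * 22) ^ (m + 1) * (k / Real.sqrt n) ^ (m + 1) with hκ
  have hκ0 : 0 ≤ κ := by positivity
  set Bd : Set Ω := {ω | (fun i j => slotRest a b w (M ω) i j) ∈ badBlock a b E} with hBd
  have hBm : MeasurableSet Bd := hM.measurable_slotRest a b w (measurableSet_badBlock a b E)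
  have hpt : ∀ᵐ ω ∂P,
      ∫ s : ℝ, edgeB E (normalized (slotRest a b w (M ω) + (s : ℂ) • slotDir a b w)) ^ k ∂μ ≤
      (1 + κ) * ∫ s : ℝ, edgeB E (normalized (slotRest a b w (M' ω) +
        (s : ℂ) • slotDir a b w)) ^ k ∂μ' + ((1 / 100) ^ k + (n : ℝ) ^ k * (9 * δ)) +
        Bd.indicator (fun _ => (n : ℝ) ^ k) ω := by
    filter_upwards [hrest] with ω hω
    rw [← hω]
    have hH := slotRest_isHermitian (a := a) (b := b) (w := w) (hM.isHermitian ω)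
    have hHs : ∀ s : ℝ, (slotRest a b w (M ω) + (s : ℂ) • slotDir a b w).IsHermitian := fun s =>
      add_smul_isHermitian hH (slotDir_isHermitian a b w) s
    have h0 : 0 ≤ ∫ s : ℝ, edgeB E (normalized (slotRest a b w (M ω) +
        (s : ℂ) • slotDir a b w)) ^ k ∂μ' :=
      integral_nonneg fun s => edgeB_pow_nonneg hn E k (hHs s)
    -- On the bad event the trivial bound `B ≤ n` is enough; elsewhere the frozen comparison applies
    -- with `L = 22`.
    by_cases hB : ω ∈ Bd
    · rw [Set.indicator_of_mem hB]
      have h1 : ∫ s : ℝ, edgeB E (normalized (slotRest a b w (M ω) +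
          (s : ℂ) • slotDir a b w)) ^ k ∂μ ≤ (n : ℝ) ^ k := by
        calc _ ≤ ∫ _s : ℝ, (n : ℝ) ^ k ∂μ :=
              integral_mono_of_nonneg (ae_of_all _ fun s => edgeB_pow_nonneg hn E k (hHs s))
                (integrable_const _) (ae_of_all _ fun s => edgeB_pow_le hn E k (hHs s))
          _ = (n : ℝ) ^ k := by simp
      have h2 : 0 ≤ (1 / 100 : ℝ) ^ k + (n : ℝ) ^ k * (9 * δ) := by positivity
      have h3 := mul_nonneg (by linarith : 0 ≤ 1 + κ) h0
      linarith
    · rw [Set.indicator_of_notMem hB, add_zero, ← add_assoc]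
      refine integral_edgeB_compare hn E hH (slotDir_isHermitian a b w) Finset.card_le_two
        (slotDir_supportedOn a b w) (norm_slotDir_le hw) (by norm_num) ?_ hk hτ hδ h h'
        fun j hj => hmom.integral_slotVal hM hM' hw hj
      intro i hi j hj
      by_contra hlt
      exact hB ⟨i, hi, j, hj, not_le.1 hlt⟩
  have i3 : Integrable (Bd.indicator fun _ => (n : ℝ) ^ k) P := (integrable_const _).indicator hBm
  rw [e1, e2]
  refine (integral_mono_ae i1 (((i2.const_mul _).add (integrable_const _)).add i3) hpt).trans ?_
  rw [integral_add' ((i2.const_mul _).add (integrable_const _)) i3,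
    integral_add' (i2.const_mul _) (integrable_const _), integral_const_mul,
    integral_indicator hBm, setIntegral_const, smul_eq_mul]
  have h4 : P.real Bd * (n : ℝ) ^ k ≤ ε * (n : ℝ) ^ k := by gcongr
  simp only [integral_const, probReal_univ, one_smul]
  linarith

/-- Stability of moments with an error that is stretched exponentially small in `n`. -/
theorem exists_moment_comparison (C C' : ℝ) (hC : 0 < C) (hC' : 0 < C') (m : ℕ) :
    ∃ K c : ℝ, 0 < K ∧ 0 < c ∧ ∃ N₀ : ℕ, ∀ n : ℕ, N₀ ≤ n → ∀ {Ω : Type*} [MeasurableSpace Ω]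
      (P : Measure Ω) (M M' : Ω → Matrix (Fin n) (Fin n) ℂ), IsWigner P M → IsWigner P M' →
      ExpDecay P C C' M → ExpDecay P C C' M' → Adjacent P M M' → MatchingMoments P m M M' →
      ∀ E : ℝ, |E| ≤ 3 → ∀ k : ℕ, 1 ≤ k → (k : ℝ) ≤ (n : ℝ) ^ (0.1 : ℝ) →
      ∫ ω, edgeB E (normalized (M ω)) ^ k ∂P ≤
        (1 + K * (k / Real.sqrt n) ^ (m + 1)) * ∫ ω, edgeB E (normalized (M' ω)) ^ k ∂P +
          (1 / 100) ^ k + (n : ℝ) ^ k * Real.exp (-(n : ℝ) ^ c) := by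
  obtain ⟨c₁, hc₁, N₁, hloc⟩ := exists_local_law C C' hC hC'
  set K₁ : ℝ := 1 + entryBound C C' m ^ (m + 1) with hK₁
  have hK₁pos : 0 < K₁ := by
    have := one_le_entryBound C C' m
    positivity
  set q : ℝ := 3 / 10 / C with hq
  have hq0 : 0 < q := by positivity
  set c₀ : ℝ := min c₁ (q / 2) with hc₀
  have hc₀pos : 0 < c₀ := lt_min hc₁ (by positivity)
  have hev : ∀ (r R : ℝ), 0 < r → ∀ᶠ n : ℕ in Filter.atTop, R ≤ (n : ℝ) ^ r := fun r R hr =>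
    ((tendsto_rpow_atTop hr).comp tendsto_natCast_atTop_atTop).eventually_ge_atTop _
  obtain ⟨N₀, hN₀⟩ := Filter.eventually_atTop.1 ((((((hev (1 / 10) 70400 (by norm_num)).and
    (hev (q / 2) 2 (by positivity))).and
    (eventually_mul_pow_exp_le (9 * K₁ + 2) 0 hc₀pos)).and (ExpDecay.eventually_tail C C' hC
      (s := 3 / 10) (by norm_num))).and (Filter.eventually_ge_atTop N₁)).and
      (Filter.eventually_ge_atTop 1))
  refine ⟨16 * K₁ * (3200 * 22) ^ (m + 1), c₀ / 2, by positivity, by positivity, N₀,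
    fun n hn {Ω} _ P M M' hM hM' hd hd' hadj hmom E hE k hk hkn => ?_⟩
  obtain ⟨⟨⟨⟨⟨h70, h2⟩, hfin⟩, htail⟩, hnN₁⟩, hn1⟩ := hN₀ n hn
  have hP := hM.isProbabilityMeasure
  have hnr : (1 : ℝ) ≤ n := by exact_mod_cast hn1
  have hn0 : (0 : ℝ) < n := by linarith
  have hk0 : (0 : ℝ) < k := by exact_mod_cast hk
  have hkn' : (k : ℝ) ≤ (n : ℝ) ^ (1 / 10 : ℝ) := by
    have e : (0.1 : ℝ) = 1 / 10 := by norm_num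
    rwa [e] at hkn
  set u : ℝ := (n : ℝ) ^ (1 / 10 : ℝ) with hu
  set v : ℝ := (n : ℝ) ^ (3 / 10 : ℝ) with hv
  have hu0 : 0 < u := by linarith
  have hv1 : 1 ≤ v := Real.one_le_rpow hnr (by norm_num)
  -- `1/2 = 3/10 + 1/10 + 1/10`: one factor `n^(1/10)` dominates `k`, the other the constant `70400
  -- = 3200 · 22`, so the cutoff `τ` is at least `n^(3/10)`.
  have hsq : Real.sqrt n = v * (u * u) := by
    rw [Real.sqrt_eq_rpow, hu, hv, ← Real.rpow_add hn0, ← Real.rpow_add hn0]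
    norm_num
  have hτv : v ≤ Real.sqrt n / (3200 * 22 * k) := by
    rw [le_div_iff₀ (by positivity), hsq]
    have : 3200 * 22 * (k : ℝ) ≤ u * u := mul_le_mul (by linarith) hkn' hk0.le hu0.le
    gcongr
  have h88 : 88 * v ≤ Real.sqrt n := by
    rw [hsq, mul_comm]
    have : 88 ≤ u * u := by nlinarith
    gcongr
  obtain ⟨a, b, hab, w, hw, hrest⟩ := hadj.exists_slot hM hM'
  -- Half the exponent of the tail at `n^(3/10)`, matching the `exp (-(2 * x))` required by
  -- `EntryDecay.tailControl`.
  set x : ℝ := (n : ℝ) ^ q / 2 with hx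
  have hxc : (n : ℝ) ^ c₀ ≤ x := by
    have h3 : (n : ℝ) ^ q = (n : ℝ) ^ (q / 2) * (n : ℝ) ^ (q / 2) := by
      rw [← Real.rpow_add hn0, add_halves]
    have h4 : (n : ℝ) ^ c₀ ≤ (n : ℝ) ^ (q / 2) :=
      Real.rpow_le_rpow_of_exponent_le hnr (min_le_right _ _)
    rw [hx, h3]
    nlinarith
  have hentry : ∀ N : Ω → Matrix (Fin n) (Fin n) ℂ, ExpDecay P C C' N →
      P.real {ω | v < ‖N ω a b‖} ≤ Real.exp (-(2 * x)) := by
    intro N hN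
    refine (htail P N hN a b).trans (le_of_eq ?_)
    rw [hx]; congr 1; ring
  have htc : ∀ N : Ω → Matrix (Fin n) (Fin n) ℂ, IsWigner P N → ExpDecay P C C' N →
      TailControl (P.map fun ω => slotVal a b w (N ω)) m K₁ (Real.sqrt n / (3200 * 22 * k))
        (K₁ * Real.exp (-x)) := by
    intro N hNw hN
    have hdec : EntryDecay P C C' fun ω => N ω a b := fun t ht => hN a b t ht
    refine hdec.tailControl (hNw.measurable_entry a b) (hNw.measurable_slotVal a b w)
      (fun ω => abs_slotVal_le hw) m ((measureReal_mono fun ω hω => ?_).trans (hentry N hN))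
    exact hτv.trans_lt hω
  have hE1 : Real.exp (-x) ≤ Real.exp (-(n : ℝ) ^ c₀) := Real.exp_le_exp.2 (by linarith)
  have hE2 : Real.exp (-(2 * x)) ≤ Real.exp (-(n : ℝ) ^ c₀) :=
    Real.exp_le_exp.2 (by linarith [Real.rpow_nonneg hn0.le c₀])
  have hE3 : Real.exp (-(n : ℝ) ^ c₁) ≤ Real.exp (-(n : ℝ) ^ c₀) := by
    have := Real.rpow_le_rpow_of_exponent_le hnr (min_le_left c₁ (q / 2))
    exact Real.exp_le_exp.2 (by linarith)
  have hsmall : 9 * (K₁ * Real.exp (-x)) + (Real.exp (-(n : ℝ) ^ c₁) + Real.exp (-(2 * x))) ≤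
      Real.exp (-(n : ℝ) ^ (c₀ / 2)) := by
    rw [pow_zero, mul_one] at hfin
    nlinarith
  have hle1 : Real.exp (-(n : ℝ) ^ (c₀ / 2)) ≤ 1 :=
    Real.exp_le_one_iff.2 (by linarith [Real.rpow_nonneg hn0.le (c₀ / 2)])
  have hδ : K₁ * Real.exp (-x) ≤ 1 / 2 := by
    have := Real.exp_pos (-(n : ℝ) ^ c₁)
    have := Real.exp_pos (-(2 * x))
    have : 0 < K₁ * Real.exp (-x) := by positivity
    linarith
  have hbad : P.real {ω | (fun i j => slotRest a b w (M ω) i j) ∈ badBlock a b E} ≤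
      Real.exp (-(n : ℝ) ^ c₁) + Real.exp (-(2 * x)) := by
    refine le_trans ?_ (add_le_add (hloc n hnN₁ P M hM hd E hE a b) (hentry M hd))
    refine le_trans (measureReal_mono fun ω hω => ?_) (measureReal_union_le _ _)
    by_contra hcon
    rw [Set.mem_union, not_or] at hcon
    obtain ⟨g1, g2⟩ := hcon
    simp only [Set.mem_ofPred_eq, not_not, not_lt] at g1 g2
    exact not_mem_badBlock_of_bounds hn1 (hM.isHermitian ω) hw (by linarith) g1 hω
  refine (integral_edgeB_pow_compare hn1 hM hM' hab hw hrest hmom E hk (hv1.trans hτv) hδ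
    (htc M hM hd) (htc M' hM' hd') hbad).trans ?_
  gcongr

end Assembly

end WignerEdge

end

/-- For large `n` this is `exists_moment_comparison`, whose error `exp (-n^c₁)` is weaker than
needed only in appearance, since `T ≤ n`. For the finitely many small `n`, the constant `K` makes
the last term exceed the trivial bound `n^k`. -/
theorem proposition4p1 (C C' : ℝ) (hC : 0 < C) (hC' : 0 < C') (m : ℕ) :
    ∃ K c : ℝ, 0 < K ∧ 0 < c ∧
      ∀ (Ω : Type*) [MeasurableSpace Ω] (P : Measure Ω) [IsProbabilityMeasure P]
        (n : ℕ) (_hn : 1 ≤ n) (M M' : Ω → Matrix (Fin n) (Fin n) ℂ),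
        WignerEdge.IsWigner P M → WignerEdge.IsWigner P M' →
        WignerEdge.ExpDecay P C C' M → WignerEdge.ExpDecay P C C' M' →
        WignerEdge.Adjacent P M M' → WignerEdge.MatchingMoments P m M M' →
        ∀ T E : ℝ, 0 < T → 2 + (n : ℝ) ^ (-(2 / 3) : ℝ) * T ≤ E → E ≤ 3 →
        ∀ k : ℕ, Real.log n ≤ k → (k : ℝ) ≤ (n : ℝ) ^ (0.1 : ℝ) →
          ∫ ω, WignerEdge.edgeB E (WignerEdge.normalized (M ω)) ^ k ∂P ≤
            (1 + K * ((k : ℝ) / Real.sqrt n) ^ (m + 1)) *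
                ∫ ω, WignerEdge.edgeB E (WignerEdge.normalized (M' ω)) ^ k ∂P
              + K * (100 : ℝ) ^ (-(k : ℝ))
              + K * (n : ℝ) ^ (K * (k : ℝ)) * Real.exp (-c * T ^ c) := by
  obtain ⟨K₁, c₁, hK₁, hc₁, N₀, hcomp⟩ := WignerEdge.exists_moment_comparison C C' hC hC' m
  set L : ℝ := Real.exp ((N₀ + 2 : ℝ) ^ c₁) with hL
  have hL0 : 0 < L := Real.exp_pos _
  refine ⟨K₁ + 1 + L, min 1 c₁, by positivity, lt_min one_pos hc₁, ?_⟩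
  intro Ω _ P _ n hn M M' hM hM' hd hd' hadj hmom T E hT hTE hE k hk hkn
  set K : ℝ := K₁ + 1 + L with hK
  set c : ℝ := min 1 c₁ with hc
  have hc0 : 0 < c := lt_min one_pos hc₁
  have hnr : (1 : ℝ) ≤ n := by exact_mod_cast hn
  have hn0 : (0 : ℝ) < n := by linarith
  have hη : 0 < (n : ℝ) ^ (-(2 / 3) : ℝ) := by positivity
  have hTn : T ≤ n := by
    have h1 : (n : ℝ) ^ (-(2 / 3) : ℝ) * T ≤ 1 := by linarith
    have h2 : (n : ℝ)⁻¹ ≤ (n : ℝ) ^ (-(2 / 3) : ℝ) := by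
      rw [← Real.rpow_neg_one]
      exact Real.rpow_le_rpow_of_exponent_le hnr (by norm_num)
    have h3 : (n : ℝ)⁻¹ * T ≤ 1 := le_trans (by gcongr) h1
    rwa [← div_eq_inv_mul, div_le_one hn0] at h3
  have hTc : c * T ^ c ≤ (n : ℝ) ^ c₁ := by
    have h1 : T ^ c ≤ (n : ℝ) ^ c₁ :=
      (Real.rpow_le_rpow hT.le hTn hc0.le).trans
        (Real.rpow_le_rpow_of_exponent_le hnr (min_le_right _ _))
    have h2 : 0 ≤ T ^ c := by positivity
    have h3 : c ≤ 1 := min_le_left _ _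
    nlinarith
  have hexp : Real.exp (-(n : ℝ) ^ c₁) ≤ Real.exp (-c * T ^ c) :=
    Real.exp_le_exp.2 (by linarith)
  have hK1 : 1 ≤ K := by linarith
  have hpow : (n : ℝ) ^ k ≤ (n : ℝ) ^ (K * (k : ℝ)) := by
    rw [← Real.rpow_natCast]
    refine Real.rpow_le_rpow_of_exponent_le hnr ?_
    nlinarith [(Nat.cast_nonneg k : (0 : ℝ) ≤ k)]
  have hB' : 0 ≤ ∫ ω, WignerEdge.edgeB E (WignerEdge.normalized (M' ω)) ^ k ∂P :=
    integral_nonneg fun ω => WignerEdge.edgeB_pow_nonneg hn E k (hM'.isHermitian ω)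
  have h100 : (100 : ℝ) ^ (-(k : ℝ)) = (1 / 100) ^ k := by
    rw [Real.rpow_neg (by norm_num), Real.rpow_natCast, one_div, inv_pow]
  rw [h100]
  have h100' : (0 : ℝ) ≤ (1 / 100) ^ k := by positivity
  have hkn0 : 0 ≤ (k : ℝ) / Real.sqrt n := by positivity
  by_cases hbig : N₀ + 2 ≤ n
  -- `N₀ + 2 ≤ n` ensures `log n > 0`, so `log n ≤ k` excludes `k = 0`.
  · have hk1 : 1 ≤ k := by
      by_contra h0
      have h1 : k = 0 := by omega
      have h2 : 0 < Real.log n := Real.log_pos (by exact_mod_cast (by omega : 1 < n))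
      rw [h1] at hk
      simp only [Nat.cast_zero] at hk
      linarith
    have hη1 : 0 < (n : ℝ) ^ (-(2 / 3) : ℝ) * T := by positivity
    refine (hcomp n (by omega) P M M' hM hM' hd hd' hadj hmom E (abs_le.2 ⟨by linarith, hE⟩) k hk1
      hkn).trans ?_
    refine add_le_add (add_le_add ?_ ?_) ?_
    · gcongr
      linarith
    · exact le_mul_of_one_le_left h100' hK1
    · calc (n : ℝ) ^ k * Real.exp (-(n : ℝ) ^ c₁)
          ≤ (n : ℝ) ^ (K * (k : ℝ)) * Real.exp (-c * T ^ c) := by gcongr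
        _ ≤ K * ((n : ℝ) ^ (K * (k : ℝ)) * Real.exp (-c * T ^ c)) :=
            le_mul_of_one_le_left (by positivity) hK1
        _ = _ := by ring
  · have hnN : (n : ℝ) ≤ N₀ + 2 := by exact_mod_cast (by omega : n ≤ N₀ + 2)
    -- `L` was chosen as the reciprocal of the smallest exponential factor possible for `n ≤ N₀ +
    -- 2`.
    have h1 : 1 ≤ K * Real.exp (-c * T ^ c) := by
      have h2 : (n : ℝ) ^ c₁ ≤ (N₀ + 2 : ℝ) ^ c₁ := Real.rpow_le_rpow hn0.le hnN hc₁.le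
      calc (1 : ℝ) = L * Real.exp (-(N₀ + 2 : ℝ) ^ c₁) := by
            rw [hL, ← Real.exp_add]; simp
        _ ≤ K * Real.exp (-c * T ^ c) := by
            refine mul_le_mul (by linarith) (Real.exp_le_exp.2 (by linarith))
              (Real.exp_pos _).le (by linarith)
    have h3 : (n : ℝ) ^ k ≤ K * (n : ℝ) ^ (K * (k : ℝ)) * Real.exp (-c * T ^ c) := by
      calc (n : ℝ) ^ k ≤ (n : ℝ) ^ (K * (k : ℝ)) * 1 := by rw [mul_one]; exact hpow
        _ ≤ (n : ℝ) ^ (K * (k : ℝ)) * (K * Real.exp (-c * T ^ c)) := by gcongr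
        _ = _ := by ring
    have h4 := hM.integral_edgeB_pow_le hn E k
    have h5 : 0 ≤ (1 + K * ((k : ℝ) / Real.sqrt n) ^ (m + 1)) *
        ∫ ω, WignerEdge.edgeB E (WignerEdge.normalized (M' ω)) ^ k ∂P := by positivity
    have h6 : 0 ≤ K * (1 / 100 : ℝ) ^ k := by positivity
    linarith
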